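/- Let $\mathfrak g$ be a compact semisimple Lie algebra, $\mathfrak g^{\mathbb C}$ its complexification, $\theta$ the conjugation of $\mathfrak g^{\mathbb C}$ with fixed point set $\mathfrak g$, and $\sigma$ a conjugate linear involutive Lie algebra automorphism of $\mathfrak g^{\mathbb C}$ commuting with $\theta$. Let $\mathrm G$, $\mathrm G^{\mathbb C}$ and $\mathrm K^{\mathbb C}$ be the connected groups of inner automorphisms of $\mathfrak g^{\mathbb C}$ with Lie algebras $\mathfrak g$, $\mathfrak g^{\mathbb C}$ and $\{u:\theta\sigma u=u\}$. Let $x\in i\mathfrak g$ with $\sigma x=x$, and put $X=\mathrm G(x)\subset i\mathfrak g$, $\mathcal O=\mathrm G^{\mathbb C}(x)$. For $y\in\mathcal O$ let $\mathfrak n(y)$ be the sum of the eigenspaces of $\mathrm{ad}\,y$ with positive eigenvalue. The Iwasawa fibre through $y$ is $y+\mathfrak n(y)$; the fibres partition $\mathcal O$ and each meets $X$ in exactly one point. The Iwasawa projection $\Pi:\mathcal O\to X$ sends a point to the point of $X$ in its fibre. The group $\mathrm K^{\mathbb C}$ acts on $X$ by $(k,y)\mapsto\Pi(ky)$; let $X^*\subset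 X$ be the open dense orbit, $\mathcal A=\Pi^{-1}(X^*)\subset\mathcal O$ and $\mathcal B=\mathcal A\cap-\theta(\mathcal A)$. Let $\langle\cdot,\cdot\rangle$ be the complex Killing form, $\Omega_y([u,y],[v,y])=\langle y,[u,v]\rangle$ the holomorphic Kostant–Kirillov–Souriau form on $\mathcal O$, $\omega=-\operatorname{Im}\Omega|_X$, and $J$ the complex structure on $X$ given by $Jv=\Pi_*(iv)$. For $y\in X^*$ let $s(y)$ be the unique point of $\mathrm K^{\mathbb C}(x)$ in the Iwasawa fibre through $y$, and let $\beta$ be the 1-form on $X^*$ with $\beta_y([v,y])=\operatorname{Re}\langle y-s(y),v\rangle$ for $v\in\mathfrak g$. Let $h:X^*\to\mathbb R$ be the function with $dh=2\beta$ and $h(x)=0$; it is a Kähler potential, $\omega=i\partial\bar\partial h$. Let $Y$ be one half of the gradient of $h$ with respect to the Kähler metric $\omega(\cdot,J\cdot)$ on $X^*$. Then $\mathcal B$ is open in $\mathcal O$ (indeed Zariski open in $\mathcal O$), connected and $\mathrm K^{\mathbb C}$-invariant, it contains $X^*$, the function $h$ exists, and the vector field $-Y$ on $X^*$ has a complexification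 defined on all of $\mathcal B$: there is a unique holomorphic vector field $\Lambda$ on $\mathcal B$ with $\Lambda|_{X^*}=-Y$. Moreover $\Lambda$ is $\mathrm K^{\mathbb C}$-equivariant, i.e. $\Lambda(kz)=k\,\Lambda(z)$ for all $k\in\mathrm K^{\mathbb C}$, $z\in\mathcal B$. -/

import Mathlib

/-- A Lie ring with a norm on its additive group; no relation between norm and bracket. -/
class NormedLieRing (L : Type*) extends NormedAddCommGroup L, LieRing L

/-- A Lie algebra with a norm. In finite dimension all norms are equivalent, so the norm only
serves to fix the usual topology (and calculus) of the underlying vector space. -/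
class NormedLieAlgebra (𝕜 : Type*) (L : Type*) [NormedField 𝕜] [NormedLieRing L] extends
  NormedSpace 𝕜 L, LieAlgebra 𝕜 L

noncomputable section

namespace HyperbolicOrbit

variable {L : Type*} [NormedLieRing L] [NormedLieAlgebra ℂ L] [FiniteDimensional ℂ L]

/-- A conjugate linear involutive automorphism of a complex Lie algebra. -/
structure IsConjugation (θ : L →ₛₗ[starRingEnd ℂ] L) : Prop where
  map_lie : ∀ u v, θ ⁅u, v⁆ = ⁅θ u, θ v⁆
  involutive : ∀ u, θ (θ u) = u

/-- `θ` is the conjugation with respect to a compact semisimple real form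
`𝔤 = {u | θ u = u}`, i.e. the Killing form is negative definite on `𝔤`. (The complex Killing form
of `L` restricts to the real Killing form of the real form `𝔤`.) -/
structure IsCompactConjugation (θ : L →ₛₗ[starRingEnd ℂ] L) : Prop extends IsConjugation θ where
  neg_def : ∀ u, θ u = u → u ≠ 0 → (killingForm ℂ L u u).re < 0

/-- `exp (ad u)` -/
def expAd (u : L) : L →L[ℂ] L :=
  NormedSpace.exp (LinearMap.toContinuousLinearMap (LieAlgebra.ad ℂ L u : L →ₗ[ℂ] L))

/-- The group generated by `exp (ad u)`, `u ∈ S`. If `S` is a real Lie subalgebra of `L`, this is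
the image in the adjoint group of the connected Lie subgroup with Lie algebra `S`. -/
def adGroup (S : Set L) : Subgroup (L ≃L[ℂ] L) :=
  Subgroup.closure {g | ∃ u ∈ S, (g : L →L[ℂ] L) = expAd u}

/-- `𝒪 = G^ℂ(x)`. -/
def complexOrbit (x : L) : Set L := {y | ∃ g ∈ adGroup (Set.univ : Set L), y = g x}

/-- `X = G(x)`, where `G` has Lie algebra `𝔤 = {u | θ u = u}`. -/
def compactOrbit (θ : L →ₛₗ[starRingEnd ℂ] L) (x : L) : Set L :=
  {y | ∃ g ∈ adGroup {u : L | θ u = u}, y = g x}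

/-- `K^ℂ`, the connected group whose Lie algebra is the fixed point set of the complex linear
involution `θσ`. -/
def sphericalGroup (θ σ : L →ₛₗ[starRingEnd ℂ] L) : Subgroup (L ≃L[ℂ] L) :=
  adGroup {u : L | θ (σ u) = u}

/-- `K^ℂ(x) ⊆ 𝒪`. -/
def sphericalOrbit (θ σ : L →ₛₗ[starRingEnd ℂ] L) (x : L) : Set L :=
  {y | ∃ k ∈ sphericalGroup θ σ, y = k x}

/-- `𝔫(y)`, the sum of the eigenspaces of `ad y` with positive eigenvalue. -/
def nilradical (y : L) : Submodule ℂ L :=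
  ⨆ c : {c : ℝ // 0 < c}, Module.End.eigenspace (LieAlgebra.ad ℂ L y) ((c : ℝ) : ℂ)

/-- The Iwasawa fibre `y + 𝔫(y)` through `y`. For `y = g x`, `g ∈ G^ℂ`, one has
`𝔫(y) = g 𝔫(x)`, so this is the translate by `g` of the fibre `x + 𝔫(x)` through `x`. -/
def iwasawaFiber (y : L) : Set L := {z | z - y ∈ nilradical y}

open Classical in
/-- The Iwasawa projection `Π : 𝒪 → X`: `Π z` is the point of `X` whose Iwasawa fibre
contains `z`. -/
def iwasawaProj (θ : L →ₛₗ[starRingEnd ℂ] L) (x z : L) : L :=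
  if h : ∃ y ∈ compactOrbit θ x, z ∈ iwasawaFiber y then h.choose else 0

/-- The orbit of `y ∈ X` for the action `(k, y) ↦ Π (k y)` of `K^ℂ` on `X ≅ G^ℂ/P`. -/
def flagOrbit (θ σ : L →ₛₗ[starRingEnd ℂ] L) (x y : L) : Set L :=
  {y' | ∃ k ∈ sphericalGroup θ σ, y' = iwasawaProj θ x (k y)}

/-- `B` is a relatively open subset of `M`. -/
def IsOpenIn (M B : Set L) : Prop := ∃ U : Set L, IsOpen U ∧ B = M ∩ U

/-- `X*`, the open dense orbit of `K^ℂ` on `X` (two open dense orbits meet, so there is at most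
one). -/
def openOrbit (θ σ : L →ₛₗ[starRingEnd ℂ] L) (x : L) : Set L :=
  {y ∈ compactOrbit θ x | IsOpenIn (compactOrbit θ x) (flagOrbit θ σ x y) ∧
    compactOrbit θ x ⊆ closure (flagOrbit θ σ x y)}

/-- `𝒜 = Π⁻¹(X*) ⊆ 𝒪`. -/
def domainA (θ σ : L →ₛₗ[starRingEnd ℂ] L) (x : L) : Set L :=
  {z ∈ complexOrbit x | iwasawaProj θ x z ∈ openOrbit θ σ x}

/-- `ℬ = 𝒜 ∩ -θ(𝒜)`. -/
def domainB (θ σ : L →ₛₗ[starRingEnd ℂ] L) (x : L) : Set L :=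
  domainA θ σ x ∩ (fun z => -θ z) '' domainA θ σ x

/-- Polynomial functions on `L`. -/
def polyFun (L : Type*) [NormedLieRing L] [NormedLieAlgebra ℂ L] : Subalgebra ℂ (L → ℂ) :=
  Algebra.adjoin ℂ (Set.range fun (φ : Module.Dual ℂ L) (y : L) => φ y)

/-- `B` is open in `M` for the topology induced by the Zariski topology of `L`. -/
def IsZariskiOpenIn (M B : Set L) : Prop :=
  ∃ S : Set (L → ℂ), S ⊆ polyFun L ∧ B = {y ∈ M | ∃ f ∈ S, f y ≠ 0}

/-- `kks y u v = ω_y([u,y],[v,y])` for `y ∈ X`, `u, v ∈ 𝔤`, where `ω = -Im Ω` and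
`Ω_y([u,y],[v,y]) = ⟨y,[u,v]⟩` is the holomorphic Kostant-Kirillov-Souriau form. -/
def kks (y u v : L) : ℝ := -(killingForm ℂ L y ⁅u, v⁆).im

/-- `J[v,y] = [v',y]` for `y ∈ X`, `v, v' ∈ 𝔤`, where `J` is the complex structure of
`X ≅ G^ℂ/P`: `[v',y] = Π_*(i[v,y])`, the tangent space of the fibre through `y` being `𝔫(y)`. -/
def IsJ (y v v' : L) : Prop := ⁅v', y⁆ - Complex.I • ⁅v, y⁆ ∈ nilradical y

/-- The normalized Kähler potential `h` of `ω` on `X*`.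

For `y ∈ X*` let `s` be the point in which the section `K^ℂ(x)` meets the Iwasawa fibre of `y`. The
vector `y - s`, tangent to the fibre, is identified by the Killing form with the covector
`[v,y] ↦ ⟨y - s, v⟩`; its real part is the 1-form `β`, and `h` is the primitive of `2β`
vanishing at `x`. It satisfies `i∂∂̄h = ω`; evaluated on `([v,y], J[v,y])` this says that half the
Laplacian at `0` of `h` along the holomorphic curve `z ↦ Π(exp(z ad v) y)` is `ω([v,y],J[v,y])`. -/
structure IsKahlerPotential (θ σ : L →ₛₗ[starRingEnd ℂ] L) (x : L) (h : L → ℝ) : Prop where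
  normalized : h x = 0
  primitive : ∀ y ∈ openOrbit θ σ x, ∃ s ∈ sphericalOrbit θ σ x, s ∈ iwasawaFiber y ∧
    ∀ v, θ v = v →
      HasDerivAt (fun t : ℝ => h (expAd ((t : ℂ) • v) y)) (2 * (killingForm ℂ L (y - s) v).re) 0
  potential : ∀ y ∈ openOrbit θ σ x, ∀ v v', θ v = v → θ v' = v' → IsJ y v v' →
    ContDiffAt ℝ 2 (fun z : ℂ => h (iwasawaProj θ x (expAd (z • v) y))) 0 ∧
    (1 / 2) * Laplacian.laplacian (fun z : ℂ => h (iwasawaProj θ x (expAd (z • v) y))) 0 =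
      kks y v v'

/-- On `X*`, `Y` is one half of the gradient of `h` for the Kähler metric `ω(·,J·)`:
`Y_y = [u,y]` is tangent to `X` and `ω([u,y],J[v,y]) = ½ dh([v,y])` for all `v ∈ 𝔤`. -/
def IsHalfGradient (θ σ : L →ₛₗ[starRingEnd ℂ] L) (x : L) (h : L → ℝ) (Y : L → L) : Prop :=
  ∀ y ∈ openOrbit θ σ x, ∃ u, θ u = u ∧ Y y = ⁅u, y⁆ ∧
    ∀ v v', θ v = v → θ v' = v' → IsJ y v v' →
      HasDerivAt (fun t : ℝ => h (expAd ((t : ℂ) • v) y)) (2 * kks y u v') 0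

/-- `Λ` is a holomorphic vector field on the open subset `B` of `𝒪` and restricts on the subset
`S` of the real form `X` to the vector field `V`. As `𝒪` is a complex submanifold of `L`, a map on
an open subset `B` of `𝒪` is holomorphic iff it is complex differentiable within `B`. -/
structure IsComplexification (V : L → L) (S B : Set L) (Λ : L → L) : Prop where
  subset : S ⊆ B
  tangent : ∀ z ∈ B, ∃ u : L, Λ z = ⁅u, z⁆
  holomorphic : DifferentiableOn ℂ Λ B
  restrict : ∀ y ∈ S, Λ y = V y

end HyperbolicOrbit

end

/-!
A point `z` of `𝒪` is determined by two opposite filtrations of `L`, by the sums of the eigenspaces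
of `ad z` with large and with small eigenvalues; `X` is the variety of the first ones, and the
Iwasawa projection forgets the second one. The complex linear involution `τ = θσ` fixes `K^ℂ` and
maps `x` to `-x`, and `X*` consists of the filtrations that are opposite to their image under `τ`:
this is a polynomial condition, so the set of these filtrations is connected, and as each orbit of
`K^ℂ` on it is open there is only one. Therefore `ℬ` is the set where both filtrations of `z` are
opposite to their images under `τ`, the complement in `𝒪` of the zeros of a polynomial.

On that set the equation `τ(z + n) = -(z + n)` has unique solutions `n₊` and `n₋` in the sums of the
eigenspaces of `ad z` with positive and with negative eigenvalues. They are rational functions of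
`z`, and for `y ∈ X*` they are `s(y) - y` and `-θ(s(y) - y)`. So `-Y = (n₊ - θn₊)/2` extends to the
holomorphic vector field `Λ = (n₊ + n₋)/2`. It is unique because a curve `t ↦ exp(u + tv)⋯x` with
`u, v ∈ 𝔤`, `t ∈ ℂ`, joins a given `z ∈ 𝒪` to a real analytic curve in `X`. The potential is an
explicit linear combination of logarithms of absolute values of determinants.
-/

noncomputable section

namespace HyperbolicOrbit

open Filter Topology Polynomial ComplexConjugate

/-! ### Functional calculus of a diagonalizable element -/

section SpectralCalculus

variable {K A : Type*} [Field K] [Ring A] [Algebra K A]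

/-- The element `a` of a `K`-algebra is diagonalizable with all eigenvalues in `S`; this is encoded
by the vanishing of `∏ (a - l)`, `l ∈ S`. -/
def SplitsOn (S : Finset K) (a : A) : Prop := aeval a (Lagrange.nodal S id) = 0

theorem SplitsOn.aeval_congr {S : Finset K} {a : A} (ha : SplitsOn S a) {p q : K[X]}
    (h : ∀ l ∈ S, p.eval l = q.eval l) : aeval a p = aeval a q := by
  have hdvd : Lagrange.nodal S id ∣ p - q := by
    refine Finset.prod_dvd_of_coprime
      ((pairwise_coprime_X_sub_C (s := id) Function.injective_id).set_pairwise _) fun l hl => ?_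
    rw [dvd_iff_isRoot, IsRoot, eval_sub, id_eq, h l hl, sub_self]
  obtain ⟨r, hr⟩ := hdvd
  rw [← sub_eq_zero, ← map_sub, hr, map_mul, show aeval a (Lagrange.nodal S id) = 0 from ha,
    zero_mul]

theorem SplitsOn.neg {S : Finset K} {a : A} (hS : ∀ l ∈ S, -l ∈ S) (ha : SplitsOn S a) :
    SplitsOn S (-a) := by
  have h := ha.aeval_congr (p := (Lagrange.nodal S id).comp (-X)) (q := 0) fun l hl => by
    rw [eval_comp, eval_neg, eval_X, eval_zero]
    exact Lagrange.eval_nodal_at_node (v := id) (hS l hl)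
  rwa [aeval_comp, map_neg, aeval_X, map_zero] at h

variable [DecidableEq K]

/-- The element `f(a)`, for `a` diagonalizable with all eigenvalues in `S`. It only depends on the
values of `f` on `S`, and it is polynomial in `a`. -/
def spectralCalc (S : Finset K) (f : K → K) (a : A) : A :=
  aeval a (Lagrange.interpolate S id f)

/-- The projection to the sum of the eigenspaces of `a` with eigenvalue in `I`, for `a`
diagonalizable with all eigenvalues in `S`. -/
def spectralProj (S : Finset K) (I : Set K) (a : A) : A := spectralCalc S (I.indicator 1) a

variable {S : Finset K} {a : A} {f g : K → K} {I J : Set K}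

theorem eval_interpolate_id {l : K} (hl : l ∈ S) : (Lagrange.interpolate S id f).eval l = f l :=
  Lagrange.eval_interpolate_at_node f (Set.injOn_id _) hl

theorem SplitsOn.aeval_eq (ha : SplitsOn S a) {p : K[X]} (h : ∀ l ∈ S, p.eval l = f l) :
    aeval a p = spectralCalc S f a :=
  ha.aeval_congr fun l hl => by rw [h l hl, eval_interpolate_id hl]

theorem spectralCalc_congr (h : ∀ l ∈ S, f l = g l) : spectralCalc S f a = spectralCalc S g a := by
  rw [spectralCalc, Lagrange.interpolate_eq_of_values_eq_on f g h, spectralCalc]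

theorem spectralCalc_add : spectralCalc S (f + g) a = spectralCalc S f a + spectralCalc S g a := by
  simp only [spectralCalc, map_add]

theorem spectralCalc_smul (c : K) : spectralCalc S (c • f) a = c • spectralCalc S f a := by
  simp only [spectralCalc, map_smul]

theorem spectralCalc_zero : spectralCalc S 0 a = 0 := by simp only [spectralCalc, map_zero]

theorem spectralCalc_sum {ι : Type*} (s : Finset ι) (f : ι → K → K) :
    spectralCalc S (∑ i ∈ s, f i) a = ∑ i ∈ s, spectralCalc S (f i) a := by
  simp only [spectralCalc, map_sum]

theorem SplitsOn.spectralCalc_one (ha : SplitsOn S a) : spectralCalc S 1 a = 1 := by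
  rw [← ha.aeval_eq (p := 1) (f := 1) fun l _ => eval_one, map_one]

theorem SplitsOn.spectralCalc_id (ha : SplitsOn S a) : spectralCalc S id a = a := by
  rw [← ha.aeval_eq (p := X) (f := id) fun l _ => eval_X, aeval_X]

theorem SplitsOn.spectralCalc_mul (ha : SplitsOn S a) :
    spectralCalc S f a * spectralCalc S g a = spectralCalc S (f * g) a := by
  rw [spectralCalc, spectralCalc, ← map_mul]
  exact ha.aeval_eq fun l hl => by
    rw [eval_mul, eval_interpolate_id hl, eval_interpolate_id hl, Pi.mul_apply]

theorem SplitsOn.spectralCalc_neg (hS : ∀ l ∈ S, -l ∈ S) (ha : SplitsOn S a) :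
    spectralCalc S f (-a) = spectralCalc S (fun l => f (-l)) a := by
  rw [← ha.aeval_eq (p := (Lagrange.interpolate S id f).comp (-X)) fun l hl => by
    rw [eval_comp, eval_neg, eval_X, eval_interpolate_id (hS l hl)]]
  rw [aeval_comp, map_neg, aeval_X, spectralCalc]

theorem commute_spectralCalc {b : A} (h : Commute b a) : Commute b (spectralCalc S f a) := by
  rw [spectralCalc, aeval_eq_sum_range]
  exact Commute.sum_right _ _ _ fun i _ => (h.pow_right i).smul_right _

theorem SplitsOn.spectralProj_univ (ha : SplitsOn S a) : spectralProj S Set.univ a = 1 := by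
  rw [spectralProj, Set.indicator_univ, ha.spectralCalc_one]

theorem spectralProj_empty : spectralProj S ∅ a = 0 := by
  rw [spectralProj, Set.indicator_empty']
  exact spectralCalc_zero

theorem spectralProj_union (h : Disjoint I J) :
    spectralProj S (I ∪ J) a = spectralProj S I a + spectralProj S J a := by
  rw [spectralProj, Set.indicator_union_of_disjoint h]
  exact spectralCalc_add

theorem spectralProj_diff (h : J ⊆ I) :
    spectralProj S (I \ J) a = spectralProj S I a - spectralProj S J a := by
  rw [eq_sub_iff_add_eq, ← spectralProj_union Set.disjoint_sdiff_left, Set.sdiff_union_of_subset h]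

theorem SplitsOn.spectralProj_compl (ha : SplitsOn S a) (I : Set K) :
    spectralProj S Iᶜ a = 1 - spectralProj S I a := by
  rw [Set.compl_eq_univ_sdiff, spectralProj_diff I.subset_univ, ha.spectralProj_univ]

theorem SplitsOn.spectralProj_mul (ha : SplitsOn S a) (I J : Set K) :
    spectralProj S I a * spectralProj S J a = spectralProj S (I ∩ J) a := by
  rw [spectralProj, spectralProj, ha.spectralCalc_mul, spectralProj, Set.inter_indicator_one]

theorem SplitsOn.spectralProj_mul_self (ha : SplitsOn S a) (I : Set K) :
    spectralProj S I a * spectralProj S I a = spectralProj S I a := by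
  rw [ha.spectralProj_mul, Set.inter_self]

theorem SplitsOn.spectralProj_mul_of_disjoint (ha : SplitsOn S a) (h : Disjoint I J) :
    spectralProj S I a * spectralProj S J a = 0 := by
  rw [ha.spectralProj_mul, h.inter_eq, spectralProj_empty]

theorem SplitsOn.spectralProj_neg (hS : ∀ l ∈ S, -l ∈ S) (ha : SplitsOn S a) (I : Set K) :
    spectralProj S I (-a) = spectralProj S (-I) a := by
  rw [spectralProj, ha.spectralCalc_neg hS]
  rfl

theorem spectralCalc_eq_sum :
    spectralCalc S f a = ∑ l ∈ S, f l • spectralProj S {l} a := by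
  simp only [spectralProj, ← spectralCalc_smul, ← spectralCalc_sum]
  refine spectralCalc_congr fun l hl => ?_
  rw [Finset.sum_apply, Finset.sum_eq_single_of_mem l hl fun m _ hm => by simp [hm.symm]]
  simp

theorem SplitsOn.sum_spectralProj (ha : SplitsOn S a) : ∑ l ∈ S, spectralProj S {l} a = 1 := by
  rw [← ha.spectralCalc_one, spectralCalc_eq_sum]
  simp only [Pi.one_apply, one_smul]

theorem SplitsOn.mul_spectralProj_singleton (ha : SplitsOn S a) (l : K) :
    a * spectralProj S {l} a = l • spectralProj S {l} a := by
  nth_rewrite 1 [← ha.spectralCalc_id]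
  rw [spectralProj, ha.spectralCalc_mul, ← spectralCalc_smul]
  refine spectralCalc_congr fun k _ => ?_
  by_cases hk : k = l <;> simp [hk]

theorem SplitsOn.spectralProj_singleton_mul (ha : SplitsOn S a) (l : K) :
    spectralProj S {l} a * a = l • spectralProj S {l} a := by
  rw [← ha.mul_spectralProj_singleton]
  exact (commute_spectralCalc (Commute.refl a)).symm

end SpectralCalculus

/-! ### Filtrations by eigenspaces -/

section Filtration

theorem eq_zero_of_smul_eq_smul {K M : Type*} [Field K] [AddCommGroup M] [Module K M]
    {k m : K} {d : M} (hkm : k ≠ m) (h : m • d = k • d) : d = 0 := by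
  rw [← sub_eq_zero, ← sub_smul] at h
  exact (smul_eq_zero.1 h).resolve_left (sub_ne_zero.2 hkm.symm)

variable {K A : Type*} [Field K] [LinearOrder K] [Ring A] [Algebra K A]

/-- The elements `a` and `b`, diagonalizable with all eigenvalues in `S`, define the same filtration
by sums of eigenspaces with large eigenvalue. -/
def SameFiltration (S : Finset K) (a b : A) : Prop :=
  ∀ I : Set K, IsUpperSet I → spectralProj S I a * spectralProj S I b = spectralProj S I b ∧
    spectralProj S I b * spectralProj S I a = spectralProj S I a

variable {S : Finset K} {a b c : A} {I : Set K}

theorem SameFiltration.mul_upper (h : SameFiltration S a b) (hI : IsUpperSet I) :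
    spectralProj S I a * spectralProj S I b = spectralProj S I b :=
  (h I hI).1

theorem SameFiltration.mul_lower (ha : SplitsOn S a) (hb : SplitsOn S b)
    (h : SameFiltration S a b) (hI : IsLowerSet I) :
    spectralProj S I a * spectralProj S I b = spectralProj S I a := by
  have hc := (h Iᶜ hI.compl).1
  rw [ha.spectralProj_compl, hb.spectralProj_compl] at hc
  have hexp : (1 - spectralProj S I a) * (1 - spectralProj S I b) =
      1 - spectralProj S I b - (spectralProj S I a - spectralProj S I a * spectralProj S I b) := by
    noncomm_ring
  rw [hexp, sub_eq_self, sub_eq_zero] at hc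
  exact hc.symm

theorem SameFiltration.refl (ha : SplitsOn S a) : SameFiltration S a a :=
  fun I _ => ⟨ha.spectralProj_mul_self I, ha.spectralProj_mul_self I⟩

theorem SameFiltration.symm (h : SameFiltration S a b) : SameFiltration S b a :=
  fun I hI => (h I hI).symm

theorem SameFiltration.trans (hab : SameFiltration S a b) (hbc : SameFiltration S b c) :
    SameFiltration S a c := by
  refine fun I hI => ⟨?_, ?_⟩
  · rw [← (hbc I hI).1, ← mul_assoc, (hab I hI).1]
  · rw [← (hab I hI).2, ← mul_assoc, (hbc I hI).2]

theorem spectralProj_mul_spectralProj_eq_zero {J : Set K}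
    (h : ∀ k ∈ S, k ∈ I → ∀ l ∈ S, l ∈ J → spectralProj S {k} a * spectralProj S {l} b = 0) :
    spectralProj S I a * spectralProj S J b = 0 := by
  classical
  rw [spectralProj, spectralProj, spectralCalc_eq_sum, spectralCalc_eq_sum, Finset.sum_mul_sum]
  refine Finset.sum_eq_zero fun k hk => Finset.sum_eq_zero fun l hl => ?_
  by_cases hkI : k ∈ I
  · by_cases hlJ : l ∈ J
    · rw [smul_mul_smul_comm, h k hk hkI l hl hlJ, smul_zero]
    · rw [Set.indicator_of_notMem hlJ, zero_smul, mul_zero]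
  · rw [Set.indicator_of_notMem hkI, zero_smul, zero_mul]

theorem sameFiltration_of_singleton (ha : SplitsOn S a) (hb : SplitsOn S b)
    (hab : ∀ k ∈ S, ∀ l ∈ S, k < l → spectralProj S {k} a * spectralProj S {l} b = 0)
    (hba : ∀ k ∈ S, ∀ l ∈ S, k < l → spectralProj S {k} b * spectralProj S {l} a = 0) :
    SameFiltration S a b := by
  intro I hI
  have hlt : ∀ {k l : K}, k ∈ Iᶜ → l ∈ I → k < l := fun hk hl =>
    lt_of_not_ge fun hlk => hk (hI hlk hl)
  have hab' := spectralProj_mul_spectralProj_eq_zero (I := Iᶜ) (J := I) fun k hk hkI l hl hlI =>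
    hab k hk l hl (hlt hkI hlI)
  have hba' := spectralProj_mul_spectralProj_eq_zero (I := Iᶜ) (J := I) fun k hk hkI l hl hlI =>
    hba k hk l hl (hlt hkI hlI)
  rw [ha.spectralProj_compl, sub_mul, one_mul, sub_eq_zero] at hab'
  rw [hb.spectralProj_compl, sub_mul, one_mul, sub_eq_zero] at hba'
  exact ⟨hab'.symm, hba'.symm⟩

theorem spectralProj_mul_eq_zero_of_strictlyUpper (ha : SplitsOn S a) (hb : SplitsOn S b)
    (h : ∀ k j, k ≤ j → spectralProj S {k} a * (b - a) * spectralProj S {j} a = 0) {k m : K}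
    (hk : k ∈ S) (hkm : k < m) : spectralProj S {k} a * spectralProj S {m} b = 0 := by
  revert hkm
  refine S.finite_toSet.wellFoundedOn.induction
    (P := fun k => k < m → spectralProj S {k} a * spectralProj S {m} b = 0) (r := (· < ·))
    hk fun k _ ih hkm => ?_
  have hoff : spectralProj S {k} a * (b - a) * spectralProj S {m} b = 0 := by
    rw [← mul_one (_ * (b - a)), ← ha.sum_spectralProj, Finset.mul_sum, Finset.sum_mul]
    refine Finset.sum_eq_zero fun j hj => ?_
    rcases lt_or_ge j k with hjk | hkj
    · rw [mul_assoc, ih j hj hjk (hjk.trans hkm), mul_zero]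
    · rw [h k j hkj, zero_mul]
  refine eq_zero_of_smul_eq_smul hkm.ne ?_
  rw [mul_sub, sub_mul, sub_eq_zero, mul_assoc, hb.mul_spectralProj_singleton,
    ha.spectralProj_singleton_mul, mul_smul_comm, smul_mul_assoc] at hoff
  exact hoff

theorem spectralProj_mul_eq_zero_of_strictlyUpper_symm (ha : SplitsOn S a) (hb : SplitsOn S b)
    (h : ∀ k j, k ≤ j → spectralProj S {k} a * (b - a) * spectralProj S {j} a = 0) {m l : K}
    (hl : l ∈ S) (hml : m < l) : spectralProj S {m} b * spectralProj S {l} a = 0 := by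
  revert hml
  refine S.finite_toSet.wellFoundedOn.induction
    (P := fun l => m < l → spectralProj S {m} b * spectralProj S {l} a = 0) (r := (· > ·))
    hl fun l _ ih hml => ?_
  have hoff : spectralProj S {m} b * ((b - a) * spectralProj S {l} a) = 0 := by
    rw [← one_mul (_ * spectralProj S {l} a), ← ha.sum_spectralProj, Finset.sum_mul,
      Finset.mul_sum]
    refine Finset.sum_eq_zero fun j hj => ?_
    rcases lt_or_ge l j with hlj | hjl
    · rw [← mul_assoc, ih j hj hlj (hml.trans hlj), zero_mul]
    · rw [← mul_assoc (spectralProj S {j} a), h j l hjl, mul_zero]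
  refine eq_zero_of_smul_eq_smul hml.ne' ?_
  rw [sub_mul, mul_sub, sub_eq_zero, ← mul_assoc, hb.spectralProj_singleton_mul,
    ha.mul_spectralProj_singleton, mul_smul_comm, smul_mul_assoc] at hoff
  exact hoff

/-- In block form with respect to `a`, the element `b` is upper triangular with the same diagonal
as `a`. -/
theorem sameFiltration_of_strictlyUpper (ha : SplitsOn S a) (hb : SplitsOn S b)
    (h : ∀ k j, k ≤ j → spectralProj S {k} a * (b - a) * spectralProj S {j} a = 0) :
    SameFiltration S a b :=
  sameFiltration_of_singleton ha hb
    (fun _ hk _ _ hkl => spectralProj_mul_eq_zero_of_strictlyUpper ha hb h hk hkl)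
    (fun _ _ _ hl hkl => spectralProj_mul_eq_zero_of_strictlyUpper_symm ha hb h hl hkl)

end Filtration

section Operators

theorem contDiff_aeval {𝕜 K E A : Type*} [NontriviallyNormedField 𝕜] [Field K]
    [NormedAddCommGroup E] [NormedSpace 𝕜 E] [NormedRing A] [NormedAlgebra 𝕜 A] [Algebra K A]
    [SMulCommClass 𝕜 K A] [ContinuousConstSMul K A] {f : E → A} {n : WithTop ℕ∞}
    (hf : ContDiff 𝕜 n f) (q : K[X]) : ContDiff 𝕜 n fun z => aeval (f z) q := by
  simp only [aeval_eq_sum_range]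
  exact ContDiff.sum fun i _ => (hf.pow i).const_smul _

variable {E F : Type*} [NormedAddCommGroup E] [NormedSpace ℂ E] [NormedAddCommGroup F]
  [NormedSpace ℂ F] {S : Finset ℝ} {T T₁ : E →L[ℂ] E} {T' T₁' : F →L[ℂ] F}

theorem clm_mul_apply (A B : E →L[ℂ] E) (u : E) : (A * B) u = A (B u) := rfl

theorem map_aeval_apply (φ : E →ₗ[ℝ] F) (h : ∀ u, φ (T u) = T' (φ u)) (p : ℝ[X]) (u : E) :
    φ (aeval T p u) = aeval T' p (φ u) := by
  have hpow : ∀ n : ℕ, ∀ u, φ ((T ^ n) u) = (T' ^ n) (φ u) := by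
    intro n
    induction n with
    | zero => exact fun u => rfl
    | succ n ih =>
      intro u
      rw [pow_succ, pow_succ]
      exact (ih (T u)).trans (by rw [h]; rfl)
  simp only [aeval_eq_sum_range, _root_.sum_apply, map_sum]
  refine Finset.sum_congr rfl fun n _ => ?_
  rw [_root_.smul_apply, map_smul, hpow, _root_.smul_apply]

theorem map_spectralCalc_apply (φ : E →ₗ[ℝ] F) (h : ∀ u, φ (T u) = T' (φ u)) (f : ℝ → ℝ)
    (u : E) : φ (spectralCalc S f T u) = spectralCalc S f T' (φ u) :=
  map_aeval_apply φ h _ u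

theorem SplitsOn.of_surjective (φ : E →ₗ[ℝ] F) (hφ : Function.Surjective φ)
    (h : ∀ u, φ (T u) = T' (φ u)) (hT : SplitsOn S T) : SplitsOn S T' := by
  ext u
  obtain ⟨v, rfl⟩ := hφ u
  rw [← map_aeval_apply φ h, show aeval T (Lagrange.nodal S id) = 0 from hT]
  exact map_zero φ

theorem SameFiltration.of_surjective (φ : E →ₗ[ℝ] F) (hφ : Function.Surjective φ)
    (h : ∀ u, φ (T u) = T' (φ u)) (h₁ : ∀ u, φ (T₁ u) = T₁' (φ u)) (hT : SameFiltration S T T₁) :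
    SameFiltration S T' T₁' := by
  have hmap : ∀ J u, spectralProj S J T' (φ u) = φ (spectralProj S J T u) := fun J u =>
    (map_spectralCalc_apply φ h _ u).symm
  have hmap₁ : ∀ J u, spectralProj S J T₁' (φ u) = φ (spectralProj S J T₁ u) := fun J u =>
    (map_spectralCalc_apply φ h₁ _ u).symm
  refine fun I hI => ⟨?_, ?_⟩ <;> ext u <;> obtain ⟨v, rfl⟩ := hφ u
  · rw [clm_mul_apply, hmap₁, hmap]
    exact congrArg (fun R : E →L[ℂ] E => φ (R v)) (hT I hI).1
  · rw [clm_mul_apply, hmap, hmap₁]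
    exact congrArg (fun R : E →L[ℂ] E => φ (R v)) (hT I hI).2

theorem aeval_apply_of_eq_smul {c : ℝ} {u : E} (h : T u = c • u) (p : ℝ[X]) :
    aeval T p u = p.eval c • u := by
  have hpow : ∀ n : ℕ, (T ^ n) u = c ^ n • u := by
    intro n
    induction n with
    | zero => exact (one_smul ℝ u).symm
    | succ n ih =>
      rw [pow_succ', pow_succ', mul_comm, mul_smul, ← h, ← T.map_smul_of_tower, ← ih]
      rfl
  rw [aeval_eq_sum_range, eval_eq_sum_range, Finset.sum_smul, _root_.sum_apply]
  refine Finset.sum_congr rfl fun n _ => ?_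
  rw [_root_.smul_apply, hpow, smul_smul]

theorem SplitsOn.spectralCalc_apply_of_eq_smul (hT : SplitsOn S T) {c : ℝ} {u : E}
    (h : T u = c • u) (f : ℝ → ℝ) : spectralCalc S f T u = f c • u := by
  rw [spectralCalc, aeval_apply_of_eq_smul h]
  by_cases hc : c ∈ S
  · rw [eval_interpolate_id hc]
  · have h0 := aeval_apply_of_eq_smul h (Lagrange.nodal S id)
    rw [show aeval T (Lagrange.nodal S id) = 0 from hT] at h0
    have hu : u = 0 := (smul_eq_zero.1 h0.symm).resolve_left
      (Lagrange.eval_nodal_not_at_node fun i hi hci => hc (hci ▸ hi))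
    rw [hu, smul_zero, smul_zero]

theorem SplitsOn.spectralProj_apply_of_mem (hT : SplitsOn S T) {c : ℝ} {u : E}
    (h : T u = c • u) {I : Set ℝ} (hc : c ∈ I) : spectralProj S I T u = u := by
  rw [spectralProj, hT.spectralCalc_apply_of_eq_smul h, Set.indicator_of_mem hc, Pi.one_apply,
    one_smul]

theorem SplitsOn.spectralProj_apply_of_notMem (hT : SplitsOn S T) {c : ℝ} {u : E}
    (h : T u = c • u) {I : Set ℝ} (hc : c ∉ I) : spectralProj S I T u = 0 := by
  rw [spectralProj, hT.spectralCalc_apply_of_eq_smul h, Set.indicator_of_notMem hc, zero_smul]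

theorem SplitsOn.apply_spectralProj_singleton (hT : SplitsOn S T) (l : ℝ) (u : E) :
    T (spectralProj S {l} T u) = l • spectralProj S {l} T u :=
  congrArg (fun R : E →L[ℂ] E => R u) (hT.mul_spectralProj_singleton l)

theorem SplitsOn.spectralProj_induction (hT : SplitsOn S T) {I : Set ℝ} {p : E → Prop}
    (zero : p 0) (add : ∀ v w, p v → p w → p (v + w))
    (eigen : ∀ l ∈ I, ∀ v, T v = l • v → p v) (u : E) : p (spectralProj S I T u) := by
  rw [spectralProj, spectralCalc_eq_sum, _root_.sum_apply]
  refine Finset.sum_induction _ p add zero fun l _ => ?_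
  by_cases hl : l ∈ I
  · rw [Set.indicator_of_mem hl, Pi.one_apply, one_smul]
    exact eigen l hl _ (hT.apply_spectralProj_singleton l u)
  · rwa [Set.indicator_of_notMem hl, zero_smul]

theorem SplitsOn.spectralProj_compl_apply (hT : SplitsOn S T) {I : Set ℝ} {u : E}
    (h : spectralProj S I T u = 0) : spectralProj S Iᶜ T u = u := by
  rw [hT.spectralProj_compl, _root_.sub_apply, h, sub_zero, one_apply_eq_self]

end Operators

section AdjointGroup

variable {L : Type*} [NormedLieRing L] [NormedLieAlgebra ℂ L]

theorem smul_lie_of_real (c : ℝ) (u v : L) : ⁅c • u, v⁆ = c • ⁅u, v⁆ := by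
  rw [← Complex.coe_smul, smul_lie, Complex.coe_smul]

theorem lie_smul_of_real (c : ℝ) (u v : L) : ⁅u, c • v⁆ = c • ⁅u, v⁆ := by
  rw [← Complex.coe_smul, lie_smul, Complex.coe_smul]

theorem lie_lie_of_eq_smul {z a b : L} {l m : ℝ} (ha : ⁅z, a⁆ = l • a) (hb : ⁅z, b⁆ = m • b) :
    ⁅z, ⁅a, b⁆⁆ = (l + m) • ⁅a, b⁆ := by
  rw [leibniz_lie, ha, hb, smul_lie_of_real, lie_smul_of_real, add_smul]

/-- A complex linear automorphism of the Lie algebra `L`. -/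
def IsAut (g : L ≃L[ℂ] L) : Prop := ∀ u v, g ⁅u, v⁆ = ⁅g u, g v⁆

theorem IsAut.mul {g k : L ≃L[ℂ] L} (hg : IsAut g) (hk : IsAut k) : IsAut (g * k) := fun u v =>
  (congrArg g (hk u v)).trans (hg _ _)

theorem IsAut.inv {g : L ≃L[ℂ] L} (hg : IsAut g) : IsAut g⁻¹ := fun u v => by
  apply g.injective
  change g (g.symm _) = g ⁅g.symm u, g.symm v⁆
  simp only [hg (g.symm u), ContinuousLinearEquiv.apply_symm_apply]

variable [FiniteDimensional ℂ L]

instance completeSpace : CompleteSpace L := FiniteDimensional.complete ℂ L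

/-! ### The adjoint group -/

/-- The adjoint representation, as a continuous linear map to the Banach algebra of operators. -/
def adC : L →L[ℂ] L →L[ℂ] L :=
  LinearMap.toContinuousLinearMap
    ((LinearMap.toContinuousLinearMap (𝕜 := ℂ) (E := L) (F' := L)).toLinearMap ∘ₗ
      (LieAlgebra.ad ℂ L : L →ₗ[ℂ] Module.End ℂ L))

@[simp] theorem adC_apply (u v : L) : adC u v = ⁅u, v⁆ := rfl

theorem expAd_eq (u : L) : expAd u = NormedSpace.exp (adC u) := rfl

@[simp] theorem expAd_zero : expAd (0 : L) = 1 := by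
  rw [expAd_eq, map_zero, NormedSpace.exp_zero]

theorem expAd_add_smul (u : L) (s t : ℂ) :
    expAd ((s + t) • u) = expAd (s • u) * expAd (t • u) := by
  let _ : NormedAlgebra ℚ (L →L[ℂ] L) := .restrictScalars ℚ ℂ _
  simp only [expAd_eq, add_smul, map_add]
  refine NormedSpace.exp_add_of_commute ?_
  simp only [map_smul]
  exact ((Commute.refl _).smul_left _).smul_right _

theorem expAd_neg_mul (u : L) : expAd (-u) * expAd u = 1 := by
  simpa using (expAd_add_smul u (-1) 1).symm

theorem expAd_mul_neg (u : L) : expAd u * expAd (-u) = 1 := by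
  simpa using expAd_neg_mul (-u)

theorem expAd_neg_apply (u v : L) : expAd (-u) (expAd u v) = v :=
  congrArg (fun T : L →L[ℂ] L => T v) (expAd_neg_mul u)

theorem expAd_apply_neg (u v : L) : expAd u (expAd (-u) v) = v :=
  congrArg (fun T : L →L[ℂ] L => T v) (expAd_mul_neg u)

theorem expAd_nsmul (n : ℕ) (u : L) : expAd (n • u) = expAd u ^ n := by
  let _ : NormedAlgebra ℚ (L →L[ℂ] L) := .restrictScalars ℚ ℂ _
  rw [expAd_eq, map_nsmul, NormedSpace.exp_nsmul, expAd_eq]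

/-- The invertible operator `exp (ad u)`. -/
def expEquiv (u : L) : L ≃L[ℂ] L :=
  ContinuousLinearEquiv.equivOfInverse (expAd u) (expAd (-u)) (expAd_neg_apply u)
    (expAd_apply_neg u)

@[simp] theorem coe_expEquiv (u : L) : (expEquiv u : L →L[ℂ] L) = expAd u := rfl

@[simp] theorem expEquiv_apply (u v : L) : expEquiv u v = expAd u v := rfl

theorem expEquiv_inv (u : L) : (expEquiv u)⁻¹ = expEquiv (-u) := by
  rw [inv_eq_iff_mul_eq_one]
  ext v
  exact expAd_apply_neg u v

theorem hasDerivAt_expAd (u : L) (t : ℂ) :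
    HasDerivAt (fun t : ℂ => expAd (t • u)) (adC u * expAd (t • u)) t := by
  simp only [expAd_eq, map_smul]
  exact hasDerivAt_exp_smul_const' (𝕂 := ℂ) (adC u) t

theorem hasDerivAt_expAd_apply (u v : L) (t : ℂ) :
    HasDerivAt (fun t : ℂ => expAd (t • u) v) ⁅u, expAd (t • u) v⁆ t :=
  (hasDerivAt_expAd u t).clm_apply (hasDerivAt_const t v) |>.congr_deriv (by simp)

theorem adC_mul_expAd (u : L) (t : ℂ) : adC u * expAd (t • u) = expAd (t • u) * adC u := by
  have h : Commute (adC u) (adC (t • u)) := by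
    rw [map_smul]
    exact (Commute.refl _).smul_right _
  exact h.exp_right.eq

theorem hasDerivAt_lie {𝕜 : Type*} [NontriviallyNormedField 𝕜] [NormedAlgebra 𝕜 ℂ]
    [NormedSpace 𝕜 L] [IsScalarTower 𝕜 ℂ L] {a b : 𝕜 → L} {a' b' : L} {t : 𝕜}
    (ha : HasDerivAt a a' t) (hb : HasDerivAt b b' t) :
    HasDerivAt (fun t => ⁅a t, b t⁆) (⁅a t, b'⁆ + ⁅a', b t⁆) t := by
  have had : HasDerivAt (fun t => ((adC (a t)).restrictScalars 𝕜 : L →L[𝕜] L))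
      ((adC a').restrictScalars 𝕜) t :=
    ((ContinuousLinearMap.restrictScalarsL ℂ L L 𝕜 𝕜).hasFDerivAt).comp_hasDerivAt t
      (((adC (L := L)).restrictScalars 𝕜).hasFDerivAt.comp_hasDerivAt t ha)
  simpa [add_comm] using had.clm_apply hb

theorem expAd_lie (u a b : L) : expAd u ⁅a, b⁆ = ⁅expAd u a, expAd u b⁆ := by
  set f : ℂ → L := fun t => expAd ((-t) • u) ⁅expAd (t • u) a, expAd (t • u) b⁆ with hf
  have hderiv : ∀ t, HasDerivAt f 0 t := by
    intro t
    have hneg : HasDerivAt (fun t : ℂ => expAd ((-t) • u)) (-(adC u * expAd ((-t) • u))) t := by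
      simpa [Function.comp_def] using (hasDerivAt_expAd u (-t)).scomp t (hasDerivAt_neg t)
    have hlie := hasDerivAt_lie (hasDerivAt_expAd_apply u a t) (hasDerivAt_expAd_apply u b t)
    refine (hneg.clm_apply hlie).congr_deriv ?_
    rw [adC_mul_expAd]
    change -(expAd (-t • u) ⁅u, ⁅expAd (t • u) a, expAd (t • u) b⁆⁆) + expAd (-t • u) _ = 0
    rw [leibniz_lie u (expAd (t • u) a) (expAd (t • u) b), add_comm (⁅expAd (t • u) a, _⁆)]
    exact neg_add_cancel _
  have hconst := is_const_of_deriv_eq_zero (fun t => (hderiv t).differentiableAt)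
    (fun t => (hderiv t).deriv) 1 0
  simp only [hf, neg_zero, zero_smul, one_smul, expAd_zero, neg_smul] at hconst
  have happly := congrArg (expAd u) hconst
  rw [expAd_apply_neg] at happly
  exact happly.symm

theorem isAut_expEquiv (u : L) : IsAut (expEquiv u) := expAd_lie u

theorem adGroup_eq_closure (S : Set L) : adGroup S = Subgroup.closure (expEquiv '' S) := by
  unfold adGroup
  congr 1
  ext g
  refine exists_congr fun u => and_congr_right fun _ => ⟨fun h => ?_, ?_⟩
  · ext v
    exact (congrArg (fun T : L →L[ℂ] L => T v) h).symm
  · rintro rfl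
    rfl

theorem expEquiv_mem {S : Set L} {u : L} (hu : u ∈ S) : expEquiv u ∈ adGroup S :=
  Subgroup.subset_closure ⟨u, hu, rfl⟩

theorem adGroup_mono {S T : Set L} (h : S ⊆ T) : adGroup S ≤ adGroup T :=
  Subgroup.closure_mono fun _ ⟨u, hu, e⟩ => ⟨u, h hu, e⟩

theorem adGroup_induction {S : Set L} {p : (L ≃L[ℂ] L) → Prop}
    (hexp : ∀ u ∈ S, p (expEquiv u)) (hone : p 1) (hmul : ∀ g k, p g → p k → p (g * k))
    (hinv : ∀ g, p g → p g⁻¹) {g : L ≃L[ℂ] L} (hg : g ∈ adGroup S) : p g := by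
  rw [adGroup_eq_closure] at hg
  induction hg using Subgroup.closure_induction with
  | mem g hg =>
    obtain ⟨u, hu, rfl⟩ := hg
    exact hexp u hu
  | one => exact hone
  | mul g k _ _ hg hk => exact hmul g k hg hk
  | inv g _ hg => exact hinv g hg

theorem isAut_of_mem {S : Set L} {g : L ≃L[ℂ] L} (hg : g ∈ adGroup S) : IsAut g :=
  adGroup_induction (p := IsAut) (fun u _ => isAut_expEquiv u) (fun _ _ => rfl)
    (fun _ _ => IsAut.mul) (fun _ => IsAut.inv) hg

theorem mem_complexOrbit_self (x : L) : x ∈ complexOrbit x := ⟨1, one_mem _, rfl⟩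

theorem apply_mem_complexOrbit {x z : L} {g : L ≃L[ℂ] L} {S : Set L} (hg : g ∈ adGroup S)
    (hz : z ∈ complexOrbit x) : g z ∈ complexOrbit x := by
  obtain ⟨k, hk, rfl⟩ := hz
  exact ⟨g * k, mul_mem (adGroup_mono (Set.subset_univ S) hg) hk, rfl⟩

/-! ### Eigenspaces of `ad z` -/

variable {S : Finset ℝ}

theorem contDiff_spectralProj_adC (S : Finset ℝ) (I : Set ℝ) {n : WithTop ℕ∞} :
    ContDiff ℂ n fun z : L => spectralProj S I (adC z) :=
  have hadC : ContDiff ℂ n fun z : L => adC z := (adC (L := L)).contDiff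
  contDiff_aeval hadC _

theorem isClosed_splitsOn_adC : IsClosed {z : L | SplitsOn S (adC z)} :=
  have hadC : ContDiff ℂ 0 fun z : L => adC z := (adC (L := L)).contDiff
  isClosed_eq (contDiff_aeval hadC _).continuous continuous_const

theorem spectralProj_adC_apply_map {g : L ≃L[ℂ] L} (hg : IsAut g) (I : Set ℝ) (z u : L) :
    spectralProj S I (adC (g z)) (g u) = g (spectralProj S I (adC z) u) :=
  (map_spectralCalc_apply (g.toLinearEquiv.toLinearMap.restrictScalars ℝ) (hg z) _ u).symm

theorem SplitsOn.adC_map {g : L ≃L[ℂ] L} (hg : IsAut g) {z : L} (hz : SplitsOn S (adC z)) :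
    SplitsOn S (adC (g z)) :=
  hz.of_surjective (g.toLinearEquiv.toLinearMap.restrictScalars ℝ) g.surjective (hg z)

theorem SameFiltration.adC_map {g : L ≃L[ℂ] L} (hg : IsAut g) {z w : L}
    (h : SameFiltration S (adC z) (adC w)) : SameFiltration S (adC (g z)) (adC (g w)) :=
  h.of_surjective (g.toLinearEquiv.toLinearMap.restrictScalars ℝ) g.surjective (hg z) (hg w)

theorem exists_lie_eq_spectralProj {z : L} (hz : SplitsOn S (adC z)) {I : Set ℝ}
    (h0 : (0 : ℝ) ∉ I) (u : L) :
    ∃ v, spectralProj S I (adC z) v = v ∧ ⁅v, z⁆ = spectralProj S I (adC z) u := by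
  classical
  refine ⟨spectralCalc S (fun l => I.indicator 1 l * -l⁻¹) (adC z) u, ?_, ?_⟩
  · rw [spectralProj, ← clm_mul_apply, hz.spectralCalc_mul]
    congr 2
    ext l
    by_cases hl : l ∈ I <;> simp [hl]
  · rw [← lie_skew, ← adC_apply z]
    nth_rewrite 1 [← hz.spectralCalc_id]
    rw [← clm_mul_apply, hz.spectralCalc_mul, ← _root_.neg_apply, ← neg_one_smul ℝ,
      ← spectralCalc_smul, spectralProj]
    congr 2
    ext l
    by_cases hl : l ∈ I
    · have hl0 : l ≠ 0 := fun h => h0 (h ▸ hl)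
      simp [hl, hl0]
    · simp [hl]

theorem mem_nilradical_iff {z : L} (hz : SplitsOn S (adC z)) {u : L} :
    u ∈ nilradical z ↔ spectralProj S (Set.Ioi 0) (adC z) u = u := by
  constructor
  · intro hu
    induction hu using Submodule.iSup_induction' with
    | mem c v hv =>
      rw [Module.End.mem_eigenspace_iff, Complex.coe_smul] at hv
      exact hz.spectralProj_apply_of_mem hv c.2
    | zero => exact map_zero _
    | add v w _ _ hv hw => rw [map_add, hv, hw]
  · intro hu
    rw [← hu, spectralProj, spectralCalc_eq_sum, _root_.sum_apply]
    refine Submodule.sum_mem _ fun l _ => ?_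
    by_cases hl : 0 < l
    · rw [Set.indicator_of_mem (Set.mem_Ioi.2 hl), Pi.one_apply, one_smul]
      refine Submodule.mem_iSup_of_mem ⟨l, hl⟩ (Module.End.mem_eigenspace_iff.mpr ?_)
      rw [Complex.coe_smul]
      exact hz.apply_spectralProj_singleton l u
    · rw [Set.indicator_of_notMem (by exact hl), zero_smul]
      exact zero_mem _

theorem map_mem_nilradical {g : L ≃L[ℂ] L} (hg : IsAut g) {z : L} (hz : SplitsOn S (adC z))
    {u : L} (hu : u ∈ nilradical z) : g u ∈ nilradical (g z) := by
  rw [mem_nilradical_iff hz] at hu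
  rw [mem_nilradical_iff (hz.adC_map hg), spectralProj_adC_apply_map hg, hu]

theorem spectralProj_mul_adC_mul_spectralProj {z n : L} (hz : SplitsOn S (adC z))
    (hn : n ∈ nilradical z) {k j : ℝ} (hkj : k ≤ j) :
    spectralProj S {k} (adC z) * adC n * spectralProj S {j} (adC z) = 0 := by
  induction hn using Submodule.iSup_induction' with
  | mem c v hv =>
    rw [Module.End.mem_eigenspace_iff, Complex.coe_smul] at hv
    ext u
    refine hz.spectralProj_apply_of_notMem
      (lie_lie_of_eq_smul hv (hz.apply_spectralProj_singleton j u)) fun h => ?_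
    rw [Set.mem_singleton_iff] at h
    linarith [c.2]
  | zero => rw [map_zero, mul_zero, zero_mul]
  | add v w _ _ hv hw => rw [map_add, mul_add, add_mul, hv, hw, add_zero]

theorem sameFiltration_of_mem_iwasawaFiber {z w : L} (hz : SplitsOn S (adC z))
    (hw : SplitsOn S (adC w)) (h : w ∈ iwasawaFiber z) : SameFiltration S (adC z) (adC w) :=
  sameFiltration_of_strictlyUpper hz hw fun k j hkj => by
    rw [← map_sub]
    exact spectralProj_mul_adC_mul_spectralProj hz h hkj

theorem SameFiltration.nilradical_eq {z w : L} (hz : SplitsOn S (adC z))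
    (hw : SplitsOn S (adC w)) (h : SameFiltration S (adC z) (adC w)) :
    nilradical z = nilradical w := by
  have hle : ∀ {z w : L}, SplitsOn S (adC z) → SplitsOn S (adC w) →
      SameFiltration S (adC z) (adC w) → nilradical w ≤ nilradical z := by
    intro z w hz hw h u hu
    rw [mem_nilradical_iff hw] at hu
    rw [mem_nilradical_iff hz, ← hu, ← clm_mul_apply, h.mul_upper (isUpperSet_Ioi 0)]
  exact le_antisymm (hle hw hz h.symm) (hle hz hw h)

end AdjointGroup

section Conjugations

/-! ### Conjugations of complex vector spaces -/

variable {V : Type*} [AddCommGroup V] [Module ℂ V] {θ : V →ₛₗ[starRingEnd ℂ] V}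

/-- The image under a conjugation of a basis; the coordinates are conjugated along with it. -/
def conjBasis {ι : Type*} [Fintype ι] (hθ : ∀ u, θ (θ u) = u) (b : Module.Basis ι ℂ V) :
    Module.Basis ι ℂ V :=
  Module.Basis.ofEquivFun
    { toFun := fun u i => conj (b.equivFun (θ u) i)
      map_add' := fun u v => by ext i; simp
      map_smul' := fun c u => by ext i; simp
      invFun := fun f => θ (b.equivFun.symm fun i => conj (f i))
      left_inv := fun u => by simp [hθ u]
      right_inv := fun f => by
        ext i
        change conj (b.equivFun (θ (θ _)) i) = f i
        rw [hθ, LinearEquiv.apply_symm_apply, Complex.conj_conj] }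

theorem conjBasis_repr {ι : Type*} [Fintype ι] (hθ : ∀ u, θ (θ u) = u)
    (b : Module.Basis ι ℂ V) (u : V) (i : ι) :
    (conjBasis hθ b).repr u i = conj (b.repr (θ u) i) := rfl

theorem conjBasis_apply {ι : Type*} [Fintype ι] (hθ : ∀ u, θ (θ u) = u)
    (b : Module.Basis ι ℂ V) (i : ι) : conjBasis hθ b i = θ (b i) := by
  classical
  apply (conjBasis hθ b).repr.injective
  ext j
  rw [Module.Basis.repr_self, conjBasis_repr, hθ, Module.Basis.repr_self]
  by_cases h : i = j <;> simp [h]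

theorem trace_conj [FiniteDimensional ℂ V] (hθ : ∀ u, θ (θ u) = u) {A B : Module.End ℂ V}
    (h : ∀ u, B (θ u) = θ (A u)) : LinearMap.trace ℂ V B = conj (LinearMap.trace ℂ V A) := by
  classical
  let b := Module.finBasis ℂ V
  rw [LinearMap.trace_eq_matrix_trace ℂ b A, LinearMap.trace_eq_matrix_trace ℂ (conjBasis hθ b) B,
    Matrix.trace, Matrix.trace, map_sum]
  refine Finset.sum_congr rfl fun i _ => ?_
  rw [Matrix.diag_apply, Matrix.diag_apply, LinearMap.toMatrix_apply, LinearMap.toMatrix_apply,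
    conjBasis_repr, conjBasis_apply, h, hθ]

/-- The component of `u` in the real form `{v | θ v = v}`. -/
def realPart (θ : V →ₛₗ[starRingEnd ℂ] V) (u : V) : V := (1 / 2 : ℂ) • (u + θ u)

/-- The component `q` of `u` in the decomposition `u = p + i q` with `p` and `q` in the real form
`{v | θ v = v}`. -/
def imagPart (θ : V →ₛₗ[starRingEnd ℂ] V) (u : V) : V := (-Complex.I / 2) • (u - θ u)

theorem conj_smul_of_real (θ : V →ₛₗ[starRingEnd ℂ] V) (c : ℝ) (u : V) :
    θ (c • u) = c • θ u := by
  rw [← Complex.coe_smul, LinearMap.map_smulₛₗ, Complex.conj_ofReal, Complex.coe_smul]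

theorem conj_realPart (hθ : ∀ u, θ (θ u) = u) (u : V) :
    θ (realPart θ u) = realPart θ u := by
  simp only [realPart, LinearMap.map_smulₛₗ, map_add, hθ u, map_div₀, map_one,
    Complex.conj_ofNat, add_comm]

theorem conj_imagPart (hθ : ∀ u, θ (θ u) = u) (u : V) :
    θ (imagPart θ u) = imagPart θ u := by
  simp only [imagPart, LinearMap.map_smulₛₗ, map_sub, hθ u, map_div₀, map_neg,
    Complex.conj_I, Complex.conj_ofNat]
  module

theorem realPart_add_imagPart (u : V) :
    realPart θ u + Complex.I • imagPart θ u = u := by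
  rw [realPart, imagPart, smul_smul, mul_div_assoc', mul_neg, Complex.I_mul_I]
  module

theorem iSup_eigenspace_ofReal_eq_top [FiniteDimensional ℂ V]
    (core : InnerProductSpace.Core ℂ V) {A : Module.End ℂ V}
    (hA : ∀ u v, core.inner (A u) v = core.inner u (A v)) :
    ⨆ r : ℝ, A.eigenspace (r : ℂ) = ⊤ := by
  let _ : NormedAddCommGroup V := core.toNormedAddCommGroup
  let _ : InnerProductSpace ℂ V := InnerProductSpace.ofCore core.toCore
  have hsymm : A.IsSymmetric := hA
  rw [eq_top_iff, ← Submodule.orthogonal_eq_bot_iff.mp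
    hsymm.orthogonalComplement_iSup_eigenspaces_eq_bot]
  refine iSup_le fun c => ?_
  rcases eq_or_ne (A.eigenspace c) ⊥ with hc | hc
  · exact hc.trans_le bot_le
  · obtain ⟨r, rfl⟩ := Complex.conj_eq_iff_real.mp (hsymm.conj_eigenvalue_eq_self hc)
    exact le_iSup (fun r : ℝ => A.eigenspace (r : ℂ)) r

end Conjugations

/-! ### The Killing form -/

section KillingForm

variable {𝕜 𝔤 : Type*} [CommRing 𝕜] [LieRing 𝔤] [LieAlgebra 𝕜 𝔤]

theorem killingForm_lie (a b c : 𝔤) : killingForm 𝕜 𝔤 ⁅a, b⁆ c = killingForm 𝕜 𝔤 a ⁅b, c⁆ :=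
  LieModule.traceForm_apply_lie_apply 𝕜 𝔤 𝔤 a b c

theorem killingForm_comm (a b : 𝔤) : killingForm 𝕜 𝔤 a b = killingForm 𝕜 𝔤 b a :=
  LieModule.traceForm_comm 𝕜 𝔤 𝔤 a b

theorem killingForm_lie_left (a b c : 𝔤) :
    killingForm 𝕜 𝔤 ⁅a, b⁆ c = -killingForm 𝕜 𝔤 b ⁅a, c⁆ := by
  rw [← lie_skew, map_neg, LinearMap.neg_apply, killingForm_lie]

end KillingForm

section RealStructure

variable {L : Type*} [NormedLieRing L] [NormedLieAlgebra ℂ L]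

theorem killingForm_map {g : L ≃L[ℂ] L} (hg : IsAut g) (a b : L) :
    killingForm ℂ L (g a) (g b) = killingForm ℂ L a b :=
  LieAlgebra.killingForm_of_equiv_apply
    ({ (g : L ≃ₗ[ℂ] L) with map_lie' := fun {u v} => hg u v } : L ≃ₗ⁅ℂ⁆ L) a b

theorem killingForm_eq_zero_of_lie_eq_smul {z a b : L} {l m : ℝ} (ha : ⁅z, a⁆ = l • a)
    (hb : ⁅z, b⁆ = m • b) (h : l + m ≠ 0) : killingForm ℂ L a b = 0 := by
  have hskew := killingForm_lie_left (𝕜 := ℂ) z a b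
  rw [ha, hb, ← Complex.coe_smul, ← Complex.coe_smul, map_smul, map_smul, LinearMap.smul_apply,
    smul_eq_mul, smul_eq_mul] at hskew
  have hmul : ((l + m : ℝ) : ℂ) * killingForm ℂ L a b = 0 := by
    push_cast
    linear_combination hskew
  exact (mul_eq_zero.mp hmul).resolve_left (by exact_mod_cast h)

variable {θ : L →ₛₗ[starRingEnd ℂ] L}

theorem IsCompactConjugation.killingForm_conj_neg (hθ : IsCompactConjugation θ) {u : L}
    (hu : u ≠ 0) : (killingForm ℂ L u (θ u)).re < 0 := by
  obtain ⟨p, hp, q, hq, rfl⟩ : ∃ p, θ p = p ∧ ∃ q, θ q = q ∧ u = p + Complex.I • q :=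
    ⟨_, conj_realPart hθ.involutive u, _, conj_imagPart hθ.involutive u,
      (realPart_add_imagPart u).symm⟩
  have hle : ∀ {v : L}, θ v = v → (killingForm ℂ L v v).re ≤ 0 := fun {v} hv => by
    rcases eq_or_ne v 0 with rfl | h
    · simp
    · exact (hθ.neg_def v hv h).le
  have hsum : killingForm ℂ L (p + Complex.I • q) (θ (p + Complex.I • q)) =
      killingForm ℂ L p p + killingForm ℂ L q q := by
    rw [map_add θ, LinearMap.map_smulₛₗ, hp, hq, Complex.conj_I]
    simp only [map_add, map_smul, LinearMap.add_apply, LinearMap.smul_apply, smul_eq_mul]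
    rw [killingForm_comm q p]
    linear_combination (-killingForm ℂ L q q) * Complex.I_mul_I
  rw [hsum, Complex.add_re]
  rcases eq_or_ne p 0 with rfl | h
  · have hq0 : q ≠ 0 := by
      rintro rfl
      simp at hu
    linarith [hle hp, hθ.neg_def q hq hq0]
  · linarith [hle hq, hθ.neg_def p hp h]

variable [FiniteDimensional ℂ L]

theorem IsConjugation.killingForm_conj (hθ : IsConjugation θ) (a b : L) :
    killingForm ℂ L (θ a) (θ b) = conj (killingForm ℂ L a b) := by
  rw [killingForm_apply_apply, killingForm_apply_apply]
  exact trace_conj hθ.involutive fun u => by simp [hθ.map_lie]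

theorem IsCompactConjugation.adC_injective (hθ : IsCompactConjugation θ) :
    Function.Injective (adC : L →L[ℂ] L →L[ℂ] L) := by
  rw [injective_iff_map_eq_zero]
  intro z hz
  by_contra h
  have had : LieAlgebra.ad ℂ L z = 0 :=
    LinearMap.ext fun u => congrArg (fun T : L →L[ℂ] L => T u) hz
  have hneg := hθ.killingForm_conj_neg h
  rw [killingForm_apply_apply, had, LinearMap.zero_comp, map_zero] at hneg
  exact lt_irrefl _ hneg

/-- The Hermitian inner product `⟨u, v⟩ = -⟨θ u, v⟩` on `L` given by the Killing form. -/
@[reducible] def IsCompactConjugation.innerCore (hθ : IsCompactConjugation θ) :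
    InnerProductSpace.Core ℂ L where
  inner u v := -killingForm ℂ L (θ u) v
  conj_inner_symm u v := by
    rw [map_neg, ← hθ.killingForm_conj, hθ.involutive, killingForm_comm]
  re_inner_nonneg u := by
    rcases eq_or_ne u 0 with rfl | h
    · simp
    · rw [killingForm_comm, map_neg]
      exact neg_nonneg.2 (hθ.killingForm_conj_neg h).le
  add_left u v w := by rw [map_add, map_add, LinearMap.add_apply, neg_add]
  smul_left u v c := by
    rw [LinearMap.map_smulₛₗ, map_smul, LinearMap.smul_apply, smul_eq_mul, mul_neg]
  definite u h := by
    by_contra hu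
    refine (hθ.killingForm_conj_neg hu).ne ?_
    rw [killingForm_comm, neg_eq_zero.mp h, Complex.zero_re]

/-! ### The spectrum of `ad x` for `x ∈ i𝔤` -/

/-- The set of real eigenvalues of `ad x`. -/
def realSpectrum (x : L) : Finset ℝ :=
  ((Module.End.finite_hasEigenvalue (LieAlgebra.ad ℂ L x)).preimage
    Complex.ofReal_injective.injOn).toFinset

theorem mem_realSpectrum {x : L} {l : ℝ} :
    l ∈ realSpectrum x ↔ ∃ u : L, u ≠ 0 ∧ ⁅x, u⁆ = l • u := by
  rw [realSpectrum, Set.Finite.mem_toFinset, Set.mem_preimage, Set.mem_ofPred_eq]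
  constructor
  · intro h
    obtain ⟨u, hu, hu0⟩ := Module.End.HasEigenvalue.exists_hasEigenvector h
    rw [Module.End.mem_eigenspace_iff, Complex.coe_smul] at hu
    exact ⟨u, hu0, hu⟩
  · rintro ⟨u, hu0, hu⟩
    refine Module.End.hasEigenvalue_of_hasEigenvector (x := u) ⟨?_, hu0⟩
    rw [Module.End.mem_eigenspace_iff, Complex.coe_smul]
    exact hu

theorem neg_mem_realSpectrum (hθ : IsConjugation θ) {x : L} (hx : θ x = -x) {l : ℝ}
    (hl : l ∈ realSpectrum x) : -l ∈ realSpectrum x := by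
  obtain ⟨u, hu0, hu⟩ := mem_realSpectrum.mp hl
  refine mem_realSpectrum.mpr ⟨θ u, fun h => hu0 ?_, ?_⟩
  · rw [← hθ.involutive u, h, map_zero]
  · rw [neg_smul, ← conj_smul_of_real, ← hu, hθ.map_lie, hx, neg_lie, neg_neg]

/-- `ad x` is symmetric for the inner product given by the Killing form and `θ`. -/
theorem splitsOn_realSpectrum (hθ : IsCompactConjugation θ) {x : L} (hx : θ x = -x) :
    SplitsOn (realSpectrum x) (adC x) := by
  have htop := iSup_eigenspace_ofReal_eq_top hθ.innerCore (A := LieAlgebra.ad ℂ L x) fun u v => by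
    change -killingForm ℂ L (θ ⁅x, u⁆) v = -killingForm ℂ L (θ u) ⁅x, v⁆
    rw [hθ.map_lie, hx, neg_lie, map_neg, LinearMap.neg_apply, killingForm_lie_left, neg_neg]
  rw [SplitsOn]
  ext u
  have hu : u ∈ ⨆ r : ℝ, (LieAlgebra.ad ℂ L x).eigenspace (r : ℂ) := htop ▸ Submodule.mem_top
  induction hu using Submodule.iSup_induction' with
  | mem r v hv =>
    rw [Module.End.mem_eigenspace_iff, Complex.coe_smul] at hv
    rw [aeval_apply_of_eq_smul (T := adC x) hv]
    rcases eq_or_ne v 0 with rfl | hv0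
    · simp
    · have hr : r ∈ realSpectrum x := mem_realSpectrum.mpr ⟨v, hv0, hv⟩
      have heval := Lagrange.eval_nodal_at_node (v := id) hr
      rw [id_eq] at heval
      rw [heval, zero_smul, _root_.zero_apply]
  | zero => rw [map_zero, map_zero]
  | add v w _ _ hv hw => rw [map_add, map_add, hv, hw]

/-! ### Conjugations and exponentials -/

/-- A conjugation as a continuous real linear map. -/
def conjR (θ : L →ₛₗ[starRingEnd ℂ] L) : L →L[ℝ] L :=
  LinearMap.toContinuousLinearMap
    { toFun := θ
      map_add' := map_add θ
      map_smul' := conj_smul_of_real θ }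

theorem continuous_conj (θ : L →ₛₗ[starRingEnd ℂ] L) : Continuous θ := (conjR θ).continuous

/-- The ring automorphism `T ↦ θ T θ` of the algebra of operators. -/
def conjOp (hθ : ∀ u, θ (θ u) = u) : (L →L[ℂ] L) →+* (L →L[ℂ] L) where
  toFun T := LinearMap.toContinuousLinearMap (θ.comp ((T : L →ₗ[ℂ] L).comp θ))
  map_one' := by ext; exact hθ _
  map_mul' A B := by
    ext u
    change θ (A (B (θ u))) = θ (A (θ (θ (B (θ u)))))
    rw [hθ]
  map_zero' := by ext; exact map_zero θ
  map_add' A B := by ext u; exact map_add θ _ _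

theorem conjOp_apply (hθ : ∀ u, θ (θ u) = u) (T : L →L[ℂ] L) (u : L) :
    conjOp hθ T u = θ (T (θ u)) := rfl

theorem continuous_conjOp (hθ : ∀ u, θ (θ u) = u) : Continuous (conjOp hθ) := by
  let f : (L →L[ℂ] L) →ₗ[ℝ] (L →L[ℂ] L) :=
    { toFun := conjOp hθ
      map_add' := map_add _
      map_smul' := fun r T => by
        ext u
        exact conj_smul_of_real θ r (T (θ u)) }
  exact f.continuous_of_finiteDimensional

theorem IsConjugation.conj_expAd (hθ : IsConjugation θ) (u v : L) :
    θ (expAd u v) = expAd (θ u) (θ v) := by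
  let _ : NormedAlgebra ℚ (L →L[ℂ] L) := .restrictScalars ℚ ℂ _
  have had : conjOp hθ.involutive (adC u) = adC (θ u) := by
    ext w
    rw [conjOp_apply, adC_apply, hθ.map_lie, hθ.involutive, adC_apply]
  have hexp := NormedSpace.map_exp (conjOp hθ.involutive) (continuous_conjOp hθ.involutive) (adC u)
  rw [had] at hexp
  rw [expAd_eq, expAd_eq, ← hexp, conjOp_apply, hθ.involutive]

theorem IsConjugation.exists_conj_mem (hθ : IsConjugation θ) {T : Set L} {g : L ≃L[ℂ] L}
    (hg : g ∈ adGroup T) : ∃ k ∈ adGroup (θ '' T), ∀ v, θ (g v) = k (θ v) := by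
  refine adGroup_induction (p := fun g => ∃ k ∈ adGroup (θ '' T), ∀ v, θ (g v) = k (θ v))
    ?_ ?_ ?_ ?_ hg
  · intro u hu
    exact ⟨expEquiv (θ u), expEquiv_mem ⟨u, hu, rfl⟩, fun v => hθ.conj_expAd u v⟩
  · exact ⟨1, one_mem _, fun v => rfl⟩
  · rintro g k ⟨g', hg', hgv⟩ ⟨k', hk', hkv⟩
    refine ⟨g' * k', mul_mem hg' hk', fun v => ?_⟩
    change θ (g (k v)) = g' (k' _)
    rw [hgv, hkv]
  · rintro g ⟨g', hg', hgv⟩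
    refine ⟨g'⁻¹, inv_mem hg', fun v => ?_⟩
    apply g'.injective
    change g' (θ (g.symm v)) = g' (g'.symm (θ v))
    rw [← hgv]
    simp

theorem IsConjugation.conj_apply_of_mem (hθ : IsConjugation θ) {g : L ≃L[ℂ] L}
    (hg : g ∈ adGroup {u : L | θ u = u}) (v : L) : θ (g v) = g (θ v) := by
  revert v
  refine adGroup_induction (p := fun g => ∀ v, θ (g v) = g (θ v)) ?_ ?_ ?_ ?_ hg
  · intro u hu v
    rw [expEquiv_apply, expEquiv_apply, hθ.conj_expAd, show θ u = u from hu]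
  · exact fun v => rfl
  · intro g k hg hk v
    change θ (g (k v)) = g (k _)
    rw [hg, hk]
  · intro g hg v
    apply g.injective
    change g (θ (g.symm v)) = g (g.symm (θ v))
    rw [← hg]
    simp

end RealStructure

/-! ### Local slices -/

section LocalSlices

section Algebra

variable {A : Type*} [NormedRing A] [NormedAlgebra ℝ A] {S : Finset ℝ}

theorem continuous_spectralProj (S : Finset ℝ) (I : Set ℝ) :
    Continuous fun a : A => spectralProj S I a :=
  (contDiff_aeval (𝕜 := ℝ) (n := 0) contDiff_id _).continuous

theorem tendsto_spectralCalc {ι : Type*} {F : Filter ι} {f : ι → ℝ → ℝ} {g : ℝ → ℝ}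
    (h : ∀ l ∈ S, Tendsto (fun i => f i l) F (𝓝 (g l))) (a : A) :
    Tendsto (fun i => spectralCalc S (f i) a) F (𝓝 (spectralCalc S g a)) := by
  simp only [spectralCalc_eq_sum (a := a)]
  exact tendsto_finsetSum _ fun l hl => (h l hl).smul_const _

theorem eq_of_commute_of_norm_sub_lt_one {A : Type*} [NormedRing A] {p q : A}
    (hp : p * p = p) (hq : q * q = q) (h : Commute p q) (hlt : ‖p - q‖ < 1) : p = q := by
  have hcube : p - q = (p - q) * (p - q) * (p - q) := by
    have hpqp : p * q * p = p * q := by rw [h.eq, mul_assoc, hp]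
    have hpqq : p * q * q = p * q := by rw [mul_assoc, hq]
    simp only [sub_mul, mul_sub, hp, hq, ← h.eq, hpqp, hpqq]
    abel
  by_contra hne
  have hpos : 0 < ‖p - q‖ := norm_pos_iff.mpr (sub_ne_zero.mpr hne)
  have hle : ‖p - q‖ ≤ ‖p - q‖ * ‖p - q‖ * ‖p - q‖ := by
    conv_lhs => rw [hcube]
    exact (norm_mul_le _ _).trans (mul_le_mul_of_nonneg_right (norm_mul_le _ _) (norm_nonneg _))
  nlinarith [mul_pos hpos hpos]

theorem SplitsOn.eventually_eq_of_commute {a : A} (ha : SplitsOn S a) :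
    ∀ᶠ b in 𝓝 a, SplitsOn S b → Commute b a → b = a := by
  have hclose : ∀ᶠ b in 𝓝 a, ∀ l ∈ S, ‖spectralProj S {l} b - spectralProj S {l} a‖ < 1 := by
    rw [Filter.eventually_all_finset]
    intro l _
    refine (((continuous_spectralProj S {l}).sub
      continuous_const).norm.continuousAt.eventually_lt continuousAt_const ?_)
    rw [sub_self, norm_zero]
    exact zero_lt_one
  filter_upwards [hclose] with b hb hbS hcomm
  rw [← hbS.spectralCalc_id, ← ha.spectralCalc_id, spectralCalc_eq_sum, spectralCalc_eq_sum]
  refine Finset.sum_congr rfl fun l hl => ?_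
  rw [eq_of_commute_of_norm_sub_lt_one (hbS.spectralProj_mul_self _)
    (ha.spectralProj_mul_self _) (commute_spectralCalc (commute_spectralCalc hcomm.symm).symm)
    (hb l hl)]

theorem exp_apply_of_eq_smul {E : Type*} [NormedAddCommGroup E] [NormedSpace ℂ E]
    [CompleteSpace E] {T : E →L[ℂ] E} {c : ℝ} {u : E} (h : T u = c • u) :
    NormedSpace.exp T u = Real.exp c • u := by
  have hexp : HasSum (fun n : ℕ => ((n.factorial : ℝ)⁻¹ * c ^ n) • u) (NormedSpace.exp T u) := by
    have hsum := ((ContinuousLinearMap.apply ℂ E u).restrictScalars ℝ).hasSum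
      (NormedSpace.exp_series_hasSum_exp' (𝕂 := ℝ) T)
    have hpow : ∀ n : ℕ, (T ^ n) u = c ^ n • u := fun n => by
      simpa using aeval_apply_of_eq_smul h (X ^ n)
    simpa [hpow, smul_smul] using hsum
  refine hexp.unique ?_
  have hsum := (NormedSpace.exp_series_hasSum_exp' (𝕂 := ℝ) c).smul_const u
  rwa [← Real.exp_eq_exp_ℝ] at hsum

theorem SplitsOn.exp_smul {E : Type*} [NormedAddCommGroup E] [NormedSpace ℂ E]
    [CompleteSpace E] {T : E →L[ℂ] E} (hT : SplitsOn S T) (s : ℝ) :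
    NormedSpace.exp (s • T) = spectralCalc S (fun l => Real.exp (s * l)) T := by
  ext u
  have hu : u = ∑ l ∈ S, spectralProj S {l} T u := by
    conv_lhs => rw [← one_apply_eq_self (F := E →L[ℂ] E) u, ← hT.sum_spectralProj,
      _root_.sum_apply]
  conv_lhs => rw [hu]
  rw [map_sum, spectralCalc_eq_sum, _root_.sum_apply]
  refine Finset.sum_congr rfl fun l _ => ?_
  rw [_root_.smul_apply]
  exact exp_apply_of_eq_smul (by
    rw [_root_.smul_apply, hT.apply_spectralProj_singleton, smul_smul])

end Algebra

variable {L : Type*} [NormedLieRing L] [NormedLieAlgebra ℂ L] [FiniteDimensional ℂ L]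
  {S : Finset ℝ} {θ : L →ₛₗ[starRingEnd ℂ] L}

theorem spectralProj_adC_lie (S : Finset ℝ) (I : Set ℝ) (z u : L) :
    spectralProj S I (adC z) ⁅z, u⁆ = ⁅z, spectralProj S I (adC z) u⁆ :=
  congrArg (fun T : L →L[ℂ] L => T u) (commute_spectralCalc (Commute.refl (adC z))).symm

/-- If `q` lies in the parabolic subalgebra of nonnegative eigenvalues of `ad z`, then
`exp (s ad z) (z + q)` converges to `z + q₀` as `s → -∞`. -/
theorem splitsOn_add_spectralProj_zero {z q : L} (hz : SplitsOn S (adC z))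
    (hq : spectralProj S (Set.Iio 0) (adC z) q = 0) (h : SplitsOn S (adC (z + q))) :
    SplitsOn S (adC (z + spectralProj S {0} (adC z) q)) := by
  have hqnonneg : spectralProj S (Set.Ici 0) (adC z) q = q := by
    rw [← Set.compl_Iio, hz.spectralProj_compl, _root_.sub_apply, hq, sub_zero,
      one_apply_eq_self]
  have hmem : ∀ s : ℝ, SplitsOn S (adC (expAd (s • z) (z + q))) := fun s =>
    h.adC_map (isAut_expEquiv (s • z))
  have hexp : ∀ s : ℝ, expAd (s • z) (z + q) = z + spectralCalc S
      (fun l => Real.exp (s * l) * (Set.Ici (0 : ℝ)).indicator 1 l) (adC z) q := by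
    intro s
    have hfix : expAd (s • z) z = z := by
      rw [expAd_eq, ← Complex.coe_smul, map_smul, Complex.coe_smul,
        exp_apply_of_eq_smul (c := 0) (by simp), Real.exp_zero, one_smul]
    rw [map_add, hfix, expAd_eq, ← Complex.coe_smul, map_smul, Complex.coe_smul, hz.exp_smul]
    nth_rewrite 1 [← hqnonneg]
    rw [spectralProj, ← clm_mul_apply, hz.spectralCalc_mul]
    rfl
  have hlim : Tendsto (fun s : ℝ => expAd (s • z) (z + q)) atBot
      (𝓝 (z + spectralProj S {0} (adC z) q)) := by
    simp only [hexp]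
    refine tendsto_const_nhds.add (((ContinuousLinearMap.apply ℂ L q).continuous.tendsto _).comp
      (tendsto_spectralCalc (fun l _ => ?_) (adC z)))
    rcases lt_trichotomy l 0 with hl | rfl | hl
    · simp [hl.ne, hl.not_ge]
    · simp
    · have hexponent : Tendsto (fun s : ℝ => s * l) atBot atBot := tendsto_id.atBot_mul_const hl
      simpa [hl.ne', hl.le] using hexponent
  exact isClosed_splitsOn_adC.mem_of_tendsto hlim (Eventually.of_forall hmem)

theorem eventually_mem_nilradical (hθ : IsCompactConjugation θ) {z : L}
    (hz : SplitsOn S (adC z)) : ∀ᶠ q in 𝓝 (0 : L),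
      spectralProj S (Set.Iio 0) (adC z) q = 0 → SplitsOn S (adC (z + q)) → q ∈ nilradical z := by
  have hlim : Tendsto (fun q => adC (z + spectralProj S {0} (adC z) q)) (𝓝 0) (𝓝 (adC z)) := by
    have hcont : Continuous fun q => adC (z + spectralProj S {0} (adC z) q) := by fun_prop
    simpa using hcont.tendsto 0
  filter_upwards [hlim.eventually hz.eventually_eq_of_commute] with q hq hneg hsplit
  have hcomm : Commute (adC (z + spectralProj S {0} (adC z) q)) (adC z) := by
    ext u
    change ⁅_, ⁅z, u⁆⁆ = ⁅z, ⁅_, u⁆⁆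
    have hlie : ⁅z, z + spectralProj S {0} (adC z) q⁆ = 0 := by
      rw [lie_add, lie_self, zero_add, ← adC_apply z, hz.apply_spectralProj_singleton, zero_smul]
    rw [leibniz_lie z, hlie, zero_lie, zero_add]
  have hzero : spectralProj S {0} (adC z) q = 0 := by
    simpa using hθ.adC_injective (hq (splitsOn_add_spectralProj_zero hz hneg hsplit) hcomm)
  rw [mem_nilradical_iff hz, ← Set.compl_Iic, hz.spectralProj_compl, ← Set.Iio_union_right,
    spectralProj_union (by simp), _root_.sub_apply, _root_.add_apply, hneg, hzero, add_zero,
    sub_zero, one_apply_eq_self]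

theorem hasStrictFDerivAt_expAd_apply (z : L) :
    HasStrictFDerivAt (fun p : L × L => expAd p.1 (z + p.2))
      (adC.flip z ∘L ContinuousLinearMap.fst ℂ L L + ContinuousLinearMap.snd ℂ L L) 0 := by
  have hexp : HasStrictFDerivAt (fun p : L × L => expAd p.1)
      (adC (L := L) ∘L ContinuousLinearMap.fst ℂ L L) 0 := by
    have had := (adC (L := L) ∘L ContinuousLinearMap.fst ℂ L L).hasStrictFDerivAt (x := 0)
    have h1 : HasStrictFDerivAt (NormedSpace.exp : (L →L[ℂ] L) → (L →L[ℂ] L))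
        (1 : (L →L[ℂ] L) →L[ℂ] (L →L[ℂ] L)) ((adC ∘L ContinuousLinearMap.fst ℂ L L) 0) := by
      rw [map_zero]
      exact hasStrictFDerivAt_exp_zero
    exact h1.comp (0 : L × L) had
  refine (hexp.clm_apply ((ContinuousLinearMap.snd ℂ L L).hasStrictFDerivAt.const_add
    z)).congr_fderiv ?_
  ext p <;> simp

/-- If `V + 𝔭(z) = L` for the parabolic subalgebra `𝔭(z)` of nonnegative eigenvalues of `ad z`,
the map `(v, q) ↦ exp (ad v) (z + q)` on `V × 𝔭(z)` is a submersion at the origin. -/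
theorem eventually_exists_expAd (hθ : IsCompactConjugation θ) {z : L} (hz : SplitsOn S (adC z))
    (V : Submodule ℝ L)
    (hV : ∀ u, ∃ v ∈ V, spectralProj S (Set.Iio 0) (adC z) (u - v) = 0) :
    ∀ᶠ w in 𝓝 z, SplitsOn S (adC w) →
      ∃ v ∈ V, ∃ q ∈ nilradical z, w = expAd v (z + q) := by
  let P : Submodule ℝ L :=
    LinearMap.ker ((spectralProj S (Set.Iio 0) (adC z)).restrictScalars ℝ).toLinearMap
  have hcV : CompleteSpace V := FiniteDimensional.complete ℝ V
  have hcP : CompleteSpace P := FiniteDimensional.complete ℝ P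
  let ι : V × P →L[ℝ] L × L := V.subtypeL.prodMap P.subtypeL
  have hΨ : HasStrictFDerivAt (fun p : V × P => expAd (p.1 : L) (z + p.2)) _ 0 :=
    ((hasStrictFDerivAt_expAd_apply z).restrictScalars ℝ).comp (0 : V × P) ι.hasStrictFDerivAt
  have hsurj : LinearMap.range (((adC.flip z ∘L ContinuousLinearMap.fst ℂ L L +
      ContinuousLinearMap.snd ℂ L L).restrictScalars ℝ ∘L ι : V × P →L[ℝ] L) :
      V × P →ₗ[ℝ] L) = ⊤ := by
    rw [LinearMap.range_eq_top]
    intro u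
    obtain ⟨u', -, hu'⟩ := exists_lie_eq_spectralProj hz (I := Set.Iio 0) (by simp) u
    obtain ⟨v, hv, hp⟩ := hV u'
    refine ⟨(⟨v, hv⟩, ⟨u - ⁅v, z⁆, ?_⟩), by simp [ι]⟩
    have hlie : spectralProj S (Set.Iio 0) (adC z) ⁅u' - v, z⁆ = 0 := by
      rw [← lie_skew, map_neg, spectralProj_adC_lie, hp, lie_zero, neg_zero]
    rwa [sub_lie, hu', map_sub, ← clm_mul_apply, hz.spectralProj_mul_self, ← map_sub] at hlie
  have hmap := hΨ.map_nhds_eq_of_surj hsurj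
  have hzero : expAd (((0 : V × P).1 : V) : L) (z + ((0 : V × P).2 : P)) = z := by simp
  rw [hzero] at hmap
  rw [← hmap, eventually_map]
  have hlim : Tendsto (fun p : V × P => (p.2 : L)) (𝓝 0) (𝓝 0) :=
    (continuous_subtype_val.comp continuous_snd).tendsto (0 : V × P)
  filter_upwards [hlim.eventually (eventually_mem_nilradical hθ hz)] with p hp hsplit
  refine ⟨p.1, p.1.2, p.2, hp p.2.2 ?_, rfl⟩
  have h := hsplit.adC_map (isAut_expEquiv (-(p.1 : L)))
  rwa [expEquiv_apply, expAd_neg_apply] at h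

end LocalSlices

section IwasawaDecomposition

variable {L : Type*} [NormedLieRing L] [NormedLieAlgebra ℂ L] {S : Finset ℝ}
  {θ : L →ₛₗ[starRingEnd ℂ] L} {x : L}

theorem mem_iwasawaFiber_self (y : L) : y ∈ iwasawaFiber y := by
  rw [iwasawaFiber, Set.mem_ofPred_eq, sub_self]
  exact zero_mem _

theorem add_mem_iwasawaFiber {y q : L} (hq : q ∈ nilradical y) : y + q ∈ iwasawaFiber y := by
  rwa [iwasawaFiber, Set.mem_ofPred_eq, add_sub_cancel_left]

/-- The real subspace fixed by a conjugation. -/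
def realForm (θ : L →ₛₗ[starRingEnd ℂ] L) : Submodule ℝ L where
  carrier := {u | θ u = u}
  add_mem' {a b} ha hb := (map_add θ a b).trans (congrArg₂ _ ha hb)
  zero_mem' := map_zero θ
  smul_mem' r u hu := (conj_smul_of_real θ r u).trans (congrArg _ hu)

variable [FiniteDimensional ℂ L]

theorem compactOrbit_subset : compactOrbit θ x ⊆ complexOrbit x := fun _ ⟨g, hg, h⟩ =>
  ⟨g, adGroup_mono (Set.subset_univ _) hg, h⟩

theorem mem_compactOrbit_self : x ∈ compactOrbit θ x := ⟨1, one_mem _, rfl⟩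

theorem apply_mem_compactOrbit {y : L} {g : L ≃L[ℂ] L} (hg : g ∈ adGroup {u : L | θ u = u})
    (hy : y ∈ compactOrbit θ x) : g y ∈ compactOrbit θ x := by
  obtain ⟨k, hk, rfl⟩ := hy
  exact ⟨g * k, mul_mem hg hk, rfl⟩

theorem conj_eq_neg_of_mem (hθ : IsConjugation θ) (hx : θ x = -x) {y : L}
    (hy : y ∈ compactOrbit θ x) : θ y = -y := by
  obtain ⟨g, hg, rfl⟩ := hy
  rw [hθ.conj_apply_of_mem hg, hx, map_neg]

theorem splitsOn_of_mem_complexOrbit (hθ : IsCompactConjugation θ) (hx : θ x = -x) {z : L}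
    (hz : z ∈ complexOrbit x) : SplitsOn (realSpectrum x) (adC z) := by
  obtain ⟨g, hg, rfl⟩ := hz
  exact (splitsOn_realSpectrum hθ hx).adC_map (isAut_of_mem hg)

theorem map_expAd {g : L ≃L[ℂ] L} (hg : IsAut g) (u v : L) :
    g (expAd u v) = expAd (g u) (g v) := by
  let _ : NormedAlgebra ℚ (L →L[ℂ] L) := .restrictScalars ℚ ℂ _
  have h : SemiconjBy (g : L →L[ℂ] L) (adC u) (adC (g u)) := by
    ext w
    exact hg u w
  exact congrArg (fun T : L →L[ℂ] L => T v) h.exp_right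

theorem map_mem_iwasawaFiber {g : L ≃L[ℂ] L} (hg : IsAut g) {y z : L}
    (hy : SplitsOn S (adC y)) (h : z ∈ iwasawaFiber y) : g z ∈ iwasawaFiber (g y) := by
  rw [iwasawaFiber, Set.mem_ofPred_eq, ← map_sub]
  exact map_mem_nilradical hg hy h

theorem mem_iwasawaFiber_trans {a b c : L} (hb : SplitsOn S (adC b)) (hc : SplitsOn S (adC c))
    (hab : a ∈ iwasawaFiber b) (hbc : b ∈ iwasawaFiber c) : a ∈ iwasawaFiber c := by
  have hnil := (sameFiltration_of_mem_iwasawaFiber hc hb hbc).nilradical_eq hc hb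
  rw [iwasawaFiber, Set.mem_ofPred_eq] at hab hbc ⊢
  rw [← sub_add_sub_cancel a b c]
  exact add_mem (hnil ▸ hab) hbc

/-! ### The Iwasawa decomposition -/

theorem spectralProj_adC_conj (hθ : IsConjugation θ) (hS : ∀ l ∈ S, -l ∈ S) {y : L}
    (hy : SplitsOn S (adC y)) (hθy : θ y = -y) (I : Set ℝ) (u : L) :
    spectralProj S I (adC y) (θ u) = θ (spectralProj S (-I) (adC y) u) := by
  have hconj : ∀ v, conjR θ (-adC y v) = adC y (conjR θ v) := fun v => by
    change θ (-⁅y, v⁆) = ⁅y, θ v⁆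
    rw [map_neg, hθ.map_lie, hθy, neg_lie, neg_neg]
  rw [← hy.spectralProj_neg hS]
  exact (map_spectralCalc_apply (conjR θ : L →ₗ[ℝ] L) hconj _ u).symm

theorem exists_realForm_spectralProj_sub_eq_zero (hθ : IsConjugation θ) (hS : ∀ l ∈ S, -l ∈ S)
    {y : L} (hy : SplitsOn S (adC y)) (hθy : θ y = -y) (u : L) :
    ∃ v ∈ realForm θ, spectralProj S (Set.Iio 0) (adC y) (u - v) = 0 := by
  set a := spectralProj S (Set.Iio 0) (adC y) u with ha
  refine ⟨a + θ a, ?_, ?_⟩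
  · change θ (a + θ a) = a + θ a
    rw [map_add, hθ.involutive, add_comm]
  · have hdisj : Disjoint (-Set.Iio (0 : ℝ)) (Set.Iio 0) := by
      rw [Set.neg_Iio, neg_zero]
      exact Set.Ioi_disjoint_Iio_same
    rw [map_sub, map_add, spectralProj_adC_conj hθ hS hy hθy, ha, ← clm_mul_apply,
      ← clm_mul_apply, hy.spectralProj_mul_self, hy.spectralProj_mul_of_disjoint hdisj,
      _root_.zero_apply, map_zero, add_zero, sub_self]

/-- The Killing form as a continuous bilinear map. -/
def killingCLM (L : Type*) [NormedLieRing L] [NormedLieAlgebra ℂ L] [FiniteDimensional ℂ L] :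
    L →L[ℂ] L →L[ℂ] ℂ :=
  LinearMap.toContinuousLinearMap
    ((LinearMap.toContinuousLinearMap (𝕜 := ℂ) (E := L) (F' := ℂ)).toLinearMap ∘ₗ killingForm ℂ L)

@[simp]
theorem killingCLM_apply (a b : L) : killingCLM L a b = killingForm ℂ L a b := rfl

theorem continuous_killingForm_conj (θ : L →ₛₗ[starRingEnd ℂ] L) :
    Continuous fun u : L => -(killingForm ℂ L u (θ u)).re := by
  have hcont : Continuous fun u : L => -(killingCLM L u (θ u)).re :=
    (Complex.continuous_re.comp ((killingCLM L).continuous.clm_apply (continuous_conj θ))).neg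
  exact hcont

theorem exists_pos_mul_sq_le_killingForm_conj (hθ : IsCompactConjugation θ) :
    ∃ c > 0, ∀ u : L, c * ‖u‖ ^ 2 ≤ -(killingForm ℂ L u (θ u)).re := by
  rcases subsingleton_or_nontrivial L with _ | _
  · exact ⟨1, one_pos, fun u => by simp [Subsingleton.elim u 0]⟩
  have : ProperSpace L := FiniteDimensional.proper ℂ L
  obtain ⟨v, hv, hmin⟩ := (isCompact_sphere (0 : L) 1).exists_isMinOn
    (NormedSpace.sphere_nonempty.mpr zero_le_one) (continuous_killingForm_conj θ).continuousOn
  have hv_ne : v ≠ 0 := ne_zero_of_mem_unit_sphere ⟨v, hv⟩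
  refine ⟨_, neg_pos.mpr (hθ.killingForm_conj_neg hv_ne), fun u => ?_⟩
  rcases eq_or_ne u 0 with rfl | hu
  · simp
  have hunit : ‖u‖⁻¹ • u ∈ Metric.sphere (0 : L) 1 := by
    rw [mem_sphere_zero_iff_norm, norm_smul, norm_inv, norm_norm,
      inv_mul_cancel₀ (norm_ne_zero_iff.mpr hu)]
  have hle : -(killingForm ℂ L v (θ v)).re ≤ -(killingForm ℂ L (‖u‖⁻¹ • u) (θ (‖u‖⁻¹ • u))).re :=
    hmin hunit
  rw [conj_smul_of_real, ← Complex.coe_smul, ← Complex.coe_smul, map_smul,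
    map_smul, LinearMap.smul_apply, smul_eq_mul, smul_eq_mul, Complex.re_ofReal_mul,
    Complex.re_ofReal_mul, ← mul_assoc, ← mul_neg, ← mul_inv, ← div_eq_inv_mul,
    le_div_iff₀ (by positivity)] at hle
  rwa [sq]

theorem eventually_forall_apply_of_compact (hθ : IsCompactConjugation θ) {P : L → Prop}
    (hP : ∀ᶠ u in 𝓝 (0 : L), P u) :
    ∀ᶠ u in 𝓝 (0 : L), ∀ g ∈ adGroup {u : L | θ u = u}, P (g u) := by
  obtain ⟨δ, hδ, hball⟩ := Metric.eventually_nhds_iff.mp hP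
  obtain ⟨c, hc, hle⟩ := exists_pos_mul_sq_le_killingForm_conj hθ
  have hlim := (continuous_killingForm_conj θ).tendsto 0
  simp only [map_zero, Complex.zero_re, neg_zero] at hlim
  filter_upwards [hlim.eventually_lt_const (show 0 < c * δ ^ 2 by positivity)] with u hu g hg
  refine hball ?_
  rw [← killingForm_map (isAut_of_mem hg), ← hθ.conj_apply_of_mem hg] at hu
  rw [dist_zero_right]
  exact lt_of_pow_lt_pow_left₀ 2 hδ.le (lt_of_mul_lt_mul_left ((hle (g u)).trans_lt hu) hc.le)

theorem continuous_expAd : Continuous (expAd : L → L →L[ℂ] L) := by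
  let _ : NormedAlgebra ℚ (L →L[ℂ] L) := .restrictScalars ℚ ℂ _
  exact NormedSpace.exp_continuous.comp adC.continuous

theorem apply_mem_of_eventually_expAd_mem {B : Set L}
    (hB : ∀ᶠ u in 𝓝 (0 : L), ∀ z ∈ B, expAd u z ∈ B) {g : L ≃L[ℂ] L}
    (hg : g ∈ adGroup (Set.univ : Set L)) {z : L} (hz : z ∈ B) : g z ∈ B := by
  have hexp : ∀ u, ∀ z ∈ B, expAd u z ∈ B := by
    intro u
    have hlim : Tendsto (fun n : ℕ => ((n : ℝ) + 1)⁻¹ • u) atTop (𝓝 0) := by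
      simpa using (tendsto_one_div_add_atTop_nhds_zero_nat (𝕜 := ℝ)).smul_const u
    obtain ⟨n, hn⟩ := (hlim.eventually hB).exists
    have hu : u = (n + 1) • (((n : ℝ) + 1)⁻¹ • u) := by
      rw [← Nat.cast_smul_eq_nsmul ℝ, smul_smul, Nat.cast_succ,
        mul_inv_cancel₀ (Nat.cast_add_one_ne_zero n), one_smul]
    rw [hu, expAd_nsmul]
    generalize n + 1 = m
    induction m with
    | zero => exact fun z hz => hz
    | succ m ih =>
      intro z hz
      rw [pow_succ', clm_mul_apply]
      exact hn _ (ih z hz)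
  have hinv : (∀ z ∈ B, g z ∈ B) ∧ ∀ z ∈ B, g⁻¹ z ∈ B := by
    refine adGroup_induction (p := fun g => (∀ z ∈ B, g z ∈ B) ∧ ∀ z ∈ B, g⁻¹ z ∈ B)
      (fun u _ => ?_) ⟨fun _ h => h, fun _ h => h⟩ (fun g k hg hk => ?_) (fun g hg => ?_) hg
    · rw [expEquiv_inv]
      exact ⟨hexp u, hexp (-u)⟩
    · rw [mul_inv_rev]
      exact ⟨fun z h => hg.1 _ (hk.1 z h), fun z h => hk.2 _ (hg.2 z h)⟩
    · rw [inv_inv]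
      exact hg.symm
  exact hinv.1 z hz

theorem eventually_expAd_mem_iwasawaFiber (hθ : IsCompactConjugation θ) (hx : θ x = -x) :
    ∀ᶠ u in 𝓝 (0 : L), ∃ y ∈ compactOrbit θ x, expAd u x ∈ iwasawaFiber y := by
  have hxS := splitsOn_realSpectrum hθ hx
  have hslice := eventually_exists_expAd hθ hxS (realForm θ)
    (exists_realForm_spectralProj_sub_eq_zero hθ.toIsConjugation
      (fun _ => neg_mem_realSpectrum hθ.toIsConjugation hx) hxS hx)
  have hlim : Tendsto (fun u : L => expAd u x) (𝓝 0) (𝓝 x) := by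
    simpa using (continuous_expAd.clm_apply continuous_const).tendsto (0 : L)
  filter_upwards [hlim.eventually hslice] with u hu
  obtain ⟨v, hv, q, hq, hvq⟩ := hu (hxS.adC_map (isAut_expEquiv u))
  refine ⟨expEquiv v x, apply_mem_compactOrbit (expEquiv_mem hv) mem_compactOrbit_self, ?_⟩
  rw [hvq]
  exact map_mem_iwasawaFiber (isAut_expEquiv v) hxS (add_mem_iwasawaFiber hq)

/-- Translating by the compact group, the local statement at `x` becomes uniform along `X`, and
the union of the fibres through `X` is then stable under a neighbourhood of `1` in `G^ℂ`. -/
theorem exists_mem_compactOrbit (hθ : IsCompactConjugation θ) (hx : θ x = -x) {z : L}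
    (hz : z ∈ complexOrbit x) : ∃ y ∈ compactOrbit θ x, z ∈ iwasawaFiber y := by
  have hsplit {y : L} (hy : y ∈ compactOrbit θ x) : SplitsOn (realSpectrum x) (adC y) :=
    splitsOn_of_mem_complexOrbit hθ hx (compactOrbit_subset hy)
  have huniform : ∀ᶠ u in 𝓝 (0 : L), ∀ y ∈ compactOrbit θ x,
      ∃ y' ∈ compactOrbit θ x, expAd u y ∈ iwasawaFiber y' := by
    filter_upwards [eventually_forall_apply_of_compact hθ
      (eventually_expAd_mem_iwasawaFiber hθ hx)] with u hu
    rintro _ ⟨g, hg, rfl⟩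
    obtain ⟨y, hy, hfib⟩ := hu g⁻¹ (inv_mem hg)
    refine ⟨g y, apply_mem_compactOrbit hg hy, ?_⟩
    have hmap := map_mem_iwasawaFiber (isAut_of_mem hg) (hsplit hy) hfib
    rwa [map_expAd (isAut_of_mem hg), show g (g⁻¹ u) = u from g.apply_symm_apply u] at hmap
  obtain ⟨g, hg, rfl⟩ := hz
  refine apply_mem_of_eventually_expAd_mem (B := {z | ∃ y ∈ compactOrbit θ x, z ∈ iwasawaFiber y})
    ?_ hg ⟨x, mem_compactOrbit_self, mem_iwasawaFiber_self x⟩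
  filter_upwards [huniform] with u hu z ⟨y, hy, hz⟩
  obtain ⟨y', hy', hyy'⟩ := hu y hy
  exact ⟨y', hy', mem_iwasawaFiber_trans ((hsplit hy).adC_map (isAut_expEquiv u)) (hsplit hy')
    (map_mem_iwasawaFiber (isAut_expEquiv u) (hsplit hy) hz) hyy'⟩

theorem SameFiltration.eq_of_conj_eq_neg (hθ : IsCompactConjugation θ) (hS : ∀ l ∈ S, -l ∈ S)
    {y y' : L} (hy : SplitsOn S (adC y)) (hy' : SplitsOn S (adC y')) (hθy : θ y = -y)
    (hθy' : θ y' = -y') (h : SameFiltration S (adC y) (adC y')) : y = y' := by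
  have hupper {I : Set ℝ} (hI : IsUpperSet I) :
      spectralProj S I (adC y) = spectralProj S I (adC y') := by
    rw [← h.mul_upper hI]
    ext u
    obtain ⟨v, rfl⟩ : ∃ v, θ v = u := ⟨θ u, hθ.involutive u⟩
    have hneg : IsLowerSet (-I) := fun _ _ hab ha => hI (neg_le_neg hab) ha
    have hconj {y : L} (hy : SplitsOn S (adC y)) (hθy : θ y = -y) :=
      spectralProj_adC_conj hθ.toIsConjugation hS hy hθy I
    rw [clm_mul_apply, hconj hy' hθy', hconj hy hθy, hconj hy hθy, ← clm_mul_apply,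
      h.mul_lower hy hy' hneg]
  apply hθ.adC_injective
  rw [← hy.spectralCalc_id, ← hy'.spectralCalc_id, spectralCalc_eq_sum, spectralCalc_eq_sum]
  refine Finset.sum_congr rfl fun l _ => ?_
  have hsingleton : ({l} : Set ℝ) = Set.Ici l \ Set.Ioi l := Set.Ici_sdiff_Ioi_same.symm
  rw [hsingleton, spectralProj_diff Set.Ioi_subset_Ici_self,
    spectralProj_diff Set.Ioi_subset_Ici_self, hupper (isUpperSet_Ici l),
    hupper (isUpperSet_Ioi l)]

theorem iwasawaProj_mem (hθ : IsCompactConjugation θ) (hx : θ x = -x) {z : L}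
    (hz : z ∈ complexOrbit x) : iwasawaProj θ x z ∈ compactOrbit θ x := by
  have h := exists_mem_compactOrbit hθ hx hz
  rw [iwasawaProj, dif_pos h]
  exact h.choose_spec.1

theorem mem_iwasawaFiber_iwasawaProj (hθ : IsCompactConjugation θ) (hx : θ x = -x) {z : L}
    (hz : z ∈ complexOrbit x) : z ∈ iwasawaFiber (iwasawaProj θ x z) := by
  have h := exists_mem_compactOrbit hθ hx hz
  rw [iwasawaProj, dif_pos h]
  exact h.choose_spec.2

theorem sameFiltration_iwasawaProj (hθ : IsCompactConjugation θ) (hx : θ x = -x) {z : L}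
    (hz : z ∈ complexOrbit x) :
    SameFiltration (realSpectrum x) (adC (iwasawaProj θ x z)) (adC z) :=
  sameFiltration_of_mem_iwasawaFiber
    (splitsOn_of_mem_complexOrbit hθ hx (compactOrbit_subset (iwasawaProj_mem hθ hx hz)))
    (splitsOn_of_mem_complexOrbit hθ hx hz) (mem_iwasawaFiber_iwasawaProj hθ hx hz)

theorem iwasawaProj_eq (hθ : IsCompactConjugation θ) (hx : θ x = -x) {y z : L}
    (hz : z ∈ complexOrbit x) (hy : y ∈ compactOrbit θ x)
    (h : SameFiltration (realSpectrum x) (adC z) (adC y)) : iwasawaProj θ x z = y := by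
  have hsplit {z : L} (hz : z ∈ complexOrbit x) := splitsOn_of_mem_complexOrbit hθ hx hz
  have hproj := iwasawaProj_mem hθ hx hz
  exact SameFiltration.eq_of_conj_eq_neg hθ
    (fun _ => neg_mem_realSpectrum hθ.toIsConjugation hx) (hsplit (compactOrbit_subset hproj))
    (hsplit (compactOrbit_subset hy)) (conj_eq_neg_of_mem hθ.toIsConjugation hx hproj)
    (conj_eq_neg_of_mem hθ.toIsConjugation hx hy)
    ((sameFiltration_iwasawaProj hθ hx hz).trans h)

theorem iwasawaProj_self (hθ : IsCompactConjugation θ) (hx : θ x = -x) {y : L}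
    (hy : y ∈ compactOrbit θ x) : iwasawaProj θ x y = y :=
  iwasawaProj_eq hθ hx (compactOrbit_subset hy) hy
    (.refl (splitsOn_of_mem_complexOrbit hθ hx (compactOrbit_subset hy)))

end IwasawaDecomposition

section EntireFunctions

theorem eventually_ne_zero_of_entire {f : ℂ → ℂ} (hf : Differentiable ℂ f) {t₀ : ℂ}
    (h : f t₀ ≠ 0) (t : ℂ) : ∀ᶠ s in 𝓝[≠] t, f s ≠ 0 := by
  have ha : AnalyticOnNhd ℂ f Set.univ := fun t _ => hf.analyticAt t
  refine (ha t trivial).eventually_eq_zero_or_eventually_ne_zero.resolve_left fun h0 => h ?_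
  exact ha.eqOn_zero_of_preconnected_of_eventuallyEq_zero isPreconnected_univ trivial h0
    (Set.mem_univ t₀)

theorem isPreconnected_ne_zero_of_entire {f : ℂ → ℂ} (hf : Differentiable ℂ f) :
    IsPreconnected {t | f t ≠ 0} := by
  rcases Set.eq_empty_or_nonempty {t | f t ≠ 0} with hempty | ⟨t₀, ht₀⟩
  · exact hempty ▸ isPreconnected_empty
  have hdiscrete : DiscreteTopology {t | f t = 0} := by
    rw [discreteTopology_subtype_iff]
    intro t _
    rw [← disjoint_iff, disjoint_principal_right]
    exact eventually_ne_zero_of_entire hf ht₀ t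
  have hcountable : {t | f t = 0}.Countable :=
    Set.countable_coe_iff.mp (TopologicalSpace.separableSpace_iff_countable.mp inferInstance)
  refine (hcountable.isConnected_compl_of_one_lt_rank ?_).isPreconnected
  exact Complex.rank_real_complex ▸ Cardinal.one_lt_two

theorem tendsto_ofReal_nhdsNE (r : ℝ) :
    Tendsto (fun s : ℝ => (s : ℂ)) (𝓝[≠] r) (𝓝[≠] (r : ℂ)) :=
  Complex.continuous_ofReal.continuousWithinAt.tendsto_nhdsWithin fun _ hs =>
    Complex.ofReal_injective.ne hs

/-- Off the discrete zero set of `f` the complex plane is connected, so the identity theorem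
applies. -/
theorem eq_zero_of_forall_real {E : Type*} [NormedAddCommGroup E] [NormedSpace ℂ E]
    [CompleteSpace E] {f : ℂ → ℂ} (hf : Differentiable ℂ f) {H : ℂ → E}
    (hH : DifferentiableOn ℂ H {t | f t ≠ 0}) (hreal : ∀ r : ℝ, f r ≠ 0 → H r = 0) {t : ℂ}
    (ht : f t ≠ 0) : H t = 0 := by
  have hne : ∀ r : ℝ, ∀ᶠ s : ℝ in 𝓝[≠] r, f s ≠ 0 := fun r =>
    (tendsto_ofReal_nhdsNE r).eventually (eventually_ne_zero_of_entire hf ht r)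
  obtain ⟨r, hr⟩ := (hne 0).exists
  have hfreq : ∃ᶠ s in 𝓝[≠] (r : ℂ), H s = 0 :=
    (tendsto_ofReal_nhdsNE r).frequently ((hne r).mono hreal).frequently
  have hanalytic : AnalyticOnNhd ℂ H {t | f t ≠ 0} :=
    hH.analyticOnNhd (isOpen_ne_fun hf.continuous continuous_const)
  exact hanalytic.eqOn_zero_of_preconnected_of_frequently_eq_zero
    (isPreconnected_ne_zero_of_entire hf) hr hfreq ht

section Determinant

variable {𝕜 E : Type*} [NontriviallyNormedField 𝕜] [NormedAddCommGroup E] [NormedSpace 𝕜 E]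

theorem clm_det_eq_sum {n : Type*} [Fintype n] [DecidableEq n] (b : Module.Basis n 𝕜 E)
    (A : E →L[𝕜] E) :
    A.det = ∑ p : Equiv.Perm n, ((Equiv.Perm.sign p : ℤ) : 𝕜) * ∏ i, b.coord (p i) (A (b i)) := by
  rw [ContinuousLinearMap.det, ← LinearMap.det_toMatrix b, Matrix.det_apply']
  simp only [LinearMap.toMatrix_apply, ContinuousLinearMap.coe_coe, Module.Basis.coord_apply]

theorem clm_det_mul (A B : E →L[𝕜] E) : (A * B).det = A.det * B.det :=
  LinearMap.det_comp (A : E →ₗ[𝕜] E) B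

theorem clm_det_eq_of_semiconj (e : E ≃L[𝕜] E) {A B : E →L[𝕜] E} (h : ∀ u, e (A u) = B (e u)) :
    A.det = B.det := by
  rw [ContinuousLinearMap.det, ContinuousLinearMap.det, ← LinearMap.det_conj _ e.toLinearEquiv]
  congr 1
  ext u
  simp only [LinearMap.comp_apply, LinearEquiv.coe_coe, ContinuousLinearEquiv.coe_toLinearEquiv,
    ContinuousLinearMap.coe_coe, h, ← e.coe_toLinearEquiv, LinearEquiv.apply_symm_apply]

variable [FiniteDimensional 𝕜 E]

theorem clm_det_ne_zero_iff (A : E →L[𝕜] E) : A.det ≠ 0 ↔ ∀ u, A u = 0 → u = 0 := by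
  rw [ContinuousLinearMap.det, ← isUnit_iff_ne_zero, ← LinearMap.isUnit_iff_isUnit_det,
    LinearMap.isUnit_iff_ker_eq_bot, LinearMap.ker_eq_bot']
  rfl

theorem contDiff_clm_det [CompleteSpace 𝕜] {n : WithTop ℕ∞} :
    ContDiff 𝕜 n (fun A : E →L[𝕜] E => A.det) := by
  let b := Module.finBasis 𝕜 E
  simp only [clm_det_eq_sum b]
  refine ContDiff.sum fun p _ => contDiff_const.mul (contDiff_prod fun i _ => ?_)
  exact ((LinearMap.toContinuousLinearMap (b.coord (p i))).comp
    (ContinuousLinearMap.apply 𝕜 E (b i))).contDiff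

end Determinant

section Curve

variable {L : Type*} [NormedLieRing L] [NormedLieAlgebra ℂ L] [FiniteDimensional ℂ L]

theorem exists_differentiable_curve {T : Set L} {c : L → ℂ → L} {t₁ : ℂ}
    (hc : ∀ u ∈ T, Differentiable ℂ (c u)) (ht₁ : ∀ u ∈ T, c u t₁ = u) {g : L ≃L[ℂ] L}
    (hg : g ∈ adGroup T) :
    ∃ G : ℂ → (L ≃L[ℂ] L), Differentiable ℂ (fun t => (G t : L →L[ℂ] L)) ∧ G t₁ = g ∧
      ∀ (t : ℂ) (T' : Set L), (∀ u ∈ T, c u t ∈ T') → G t ∈ adGroup T' := by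
  refine adGroup_induction (p := fun g => ∃ G : ℂ → (L ≃L[ℂ] L),
    Differentiable ℂ (fun t => (G t : L →L[ℂ] L)) ∧ G t₁ = g ∧
      ∀ (t : ℂ) (T' : Set L), (∀ u ∈ T, c u t ∈ T') → G t ∈ adGroup T') ?_ ?_ ?_ ?_ hg
  · intro u hu
    refine ⟨fun t => expEquiv (c u t), fun t => ?_, by simp only [ht₁ u hu],
      fun t T' hT' => expEquiv_mem (hT' u hu)⟩
    simp only [coe_expEquiv, expAd_eq]
    exact (NormedSpace.exp_analytic (𝕂 := ℂ) (adC (c u t))).differentiableAt.comp t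
      ((adC (L := L)).differentiableAt.comp t (hc u hu t))
  · exact ⟨fun _ => 1, differentiable_const _, rfl, fun _ _ _ => one_mem _⟩
  · rintro g k ⟨G, hGdiff, rfl, hGmem⟩ ⟨K, hKdiff, rfl, hKmem⟩
    exact ⟨fun t => G t * K t, hGdiff.mul hKdiff, rfl,
      fun t T' hT' => mul_mem (hGmem t T' hT') (hKmem t T' hT')⟩
  · rintro g ⟨G, hGdiff, rfl, hGmem⟩
    refine ⟨fun t => (G t)⁻¹, fun t => ?_, rfl, fun t T' hT' => inv_mem (hGmem t T' hT')⟩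
    have hinv : (fun s => ((G s)⁻¹ : L ≃L[ℂ] L).toContinuousLinearMap) =
        fun s => ContinuousLinearMap.inverse (G s : L →L[ℂ] L) :=
      funext fun s => (ContinuousLinearMap.inverse_equiv (G s)).symm
    rw [hinv]
    exact ((contDiffAt_map_inverse (𝕜 := ℂ) (n := 1) (G t)).differentiableAt one_ne_zero).comp t
      (hGdiff t)

end Curve

section PolyOp

variable {L : Type*} [NormedLieRing L] [NormedLieAlgebra ℂ L] [FiniteDimensional ℂ L]

variable (L) in
/-- The algebra of operator-valued maps on `L` all of whose matrix coefficients are polynomial. -/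
def polyOp : Subalgebra ℂ (L → L →L[ℂ] L) where
  carrier := {F | ∀ (φ : Module.Dual ℂ L) (v : L), (fun z => φ (F z v)) ∈ polyFun L}
  algebraMap_mem' c φ v := (polyFun L).algebraMap_mem (φ (c • v))
  add_mem' {F G} hF hG φ v := by
    simp only [Pi.add_apply, _root_.add_apply, map_add]
    exact add_mem (hF φ v) (hG φ v)
  mul_mem' {F G} hF hG φ v := by
    let b := Module.finBasis ℂ L
    have hsum : (fun z => φ ((F * G) z v)) =
        ∑ i, (fun z => b.coord i (G z v)) * fun z => φ (F z (b i)) := by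
      ext z
      rw [Pi.mul_apply, clm_mul_apply]
      conv_lhs => rw [← b.sum_repr (G z v)]
      simp only [map_sum, map_smul, Finset.sum_apply, Pi.mul_apply, smul_eq_mul,
        Module.Basis.coord_apply]
    rw [hsum]
    exact sum_mem fun i _ => mul_mem (hG _ v) (hF φ _)

theorem adC_mem_polyOp : (fun z : L => adC z) ∈ polyOp L := fun φ v =>
  Algebra.subset_adjoin ⟨φ ∘ₗ ((adC.flip v : L →L[ℂ] L) : L →ₗ[ℂ] L), rfl⟩

theorem spectralProj_adC_mem_polyOp (S : Finset ℝ) (I : Set ℝ) :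
    (fun z : L => spectralProj S I (adC z)) ∈ polyOp L := by
  have hmem := (Algebra.adjoin_le (Set.singleton_subset_iff.mpr adC_mem_polyOp) :
    Algebra.adjoin ℂ {fun z : L => adC z} ≤ polyOp L)
    (Polynomial.aeval_mem_adjoin_singleton ℂ (fun z : L => adC z)
      (p := (Lagrange.interpolate S id (I.indicator 1)).map (algebraMap ℝ ℂ)))
  convert hmem using 1
  ext1 z
  rw [spectralProj, spectralCalc, Polynomial.aeval_map_algebraMap, Polynomial.aeval_pi_apply]

theorem det_mem_polyFun {F : L → L →L[ℂ] L} (hF : F ∈ polyOp L) :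
    (fun z => (F z).det) ∈ polyFun L := by
  let b := Module.finBasis ℂ L
  have hsum : (fun z => (F z).det) =
      ∑ p : Equiv.Perm (Fin (Module.finrank ℂ L)), ((Equiv.Perm.sign p : ℤ) : ℂ) •
        ∏ i, fun z => b.coord (p i) (F z (b i)) := by
    ext z
    simp only [clm_det_eq_sum b, Finset.sum_apply, Pi.smul_apply, Finset.prod_apply, smul_eq_mul]
  rw [hsum]
  exact sum_mem fun p _ => Subalgebra.smul_mem _ (prod_mem fun i _ => hF _ _) _

end PolyOp

end EntireFunctions

/-! ### Opposite filtrations -/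

section OppositeFiltrations

section Ring

variable {K A : Type*} [Field K] [DecidableEq K] [Ring A] [Algebra K A]

/-- For an operator `a`, this is the operator that exchanges the sums of the eigenspaces of `a` with
eigenvalues in `I` and in `-I` by the components of `τ` between them, and that fixes the other
eigenspaces. Its invertibility expresses that `τ` reverses the filtration of `a`. -/
def oppOp (S : Finset K) (I : Set K) (τ a : A) : A :=
  spectralProj S (-I) a * τ * spectralProj S I a + spectralProj S I a * τ * spectralProj S (-I) a +
    (1 - spectralProj S I a - spectralProj S (-I) a)

variable {S : Finset K} {I : Set K} {a : A}

theorem oppOp_neg (τ : A) : oppOp S (-I) τ a = oppOp S I τ a := by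
  rw [oppOp, neg_neg, sub_right_comm, add_comm (_ * τ * _), oppOp]

theorem SplitsOn.oppOp_neg_right (hS : ∀ l ∈ S, -l ∈ S) (ha : SplitsOn S a) (τ : A) :
    oppOp S I τ (-a) = oppOp S I τ a := by
  rw [← oppOp_neg]
  simp only [oppOp, ha.spectralProj_neg hS, neg_neg]

theorem SplitsOn.oppOp_mul_spectralProj (ha : SplitsOn S a) (hI : Disjoint I (-I)) (τ : A) :
    oppOp S I τ a * spectralProj S I a = spectralProj S (-I) a * τ * spectralProj S I a := by
  rw [oppOp, add_mul, add_mul, sub_mul, sub_mul, mul_assoc _ (spectralProj S I a),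
    mul_assoc _ (spectralProj S (-I) a), ha.spectralProj_mul_of_disjoint hI.symm,
    ha.spectralProj_mul_self, mul_zero, add_zero, one_mul, sub_self, sub_zero, add_zero]

theorem SplitsOn.spectralProj_mul_oppOp (ha : SplitsOn S a) (hI : Disjoint I (-I)) (τ : A) :
    spectralProj S I a * oppOp S I τ a = spectralProj S I a * τ * spectralProj S (-I) a := by
  simp only [oppOp, mul_add, mul_sub, ← mul_assoc, ha.spectralProj_mul_of_disjoint hI,
    ha.spectralProj_mul_self, zero_mul, zero_add, mul_one, sub_self, add_zero]

theorem SplitsOn.oppOp_mul_spectralProj_neg (ha : SplitsOn S a) (hI : Disjoint I (-I)) (τ : A) :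
    oppOp S I τ a * spectralProj S (-I) a = spectralProj S I a * τ * spectralProj S (-I) a := by
  have h := ha.oppOp_mul_spectralProj (I := -I) (by rw [neg_neg]; exact hI.symm) τ
  rwa [oppOp_neg, neg_neg] at h

theorem SplitsOn.spectralProj_neg_mul_oppOp (ha : SplitsOn S a) (hI : Disjoint I (-I)) (τ : A) :
    spectralProj S (-I) a * oppOp S I τ a = spectralProj S (-I) a * τ * spectralProj S I a := by
  have h := ha.spectralProj_mul_oppOp (I := -I) (by rw [neg_neg]; exact hI.symm) τ
  rwa [oppOp_neg, neg_neg] at h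

end Ring

theorem disjoint_neg_of_pos {R : Type*} [Ring R] [LinearOrder R] [IsStrictOrderedRing R]
    {I : Set R} (hI : ∀ t ∈ I, 0 < t) : Disjoint I (-I) :=
  Set.disjoint_left.mpr fun t ht hnt => (neg_pos.mp (hI (-t) hnt)).not_gt (hI t ht)

section Operator

variable {E F : Type*} [NormedAddCommGroup E] [NormedSpace ℂ E] [NormedAddCommGroup F]
  [NormedSpace ℂ F] {S : Finset ℝ} {I : Set ℝ} {τ T T₁ : E →L[ℂ] E} {τ' T' : F →L[ℂ] F}

theorem map_oppOp_apply (φ : E →ₗ[ℝ] F) (hT : ∀ u, φ (T u) = T' (φ u))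
    (hτ : ∀ u, φ (τ u) = τ' (φ u)) (u : E) :
    φ (oppOp S I τ T u) = oppOp S I τ' T' (φ u) := by
  have hP : ∀ J v, φ (spectralProj S J T v) = spectralProj S J T' (φ v) := fun J v =>
    map_spectralCalc_apply φ hT _ v
  simp only [oppOp, _root_.add_apply, _root_.sub_apply, clm_mul_apply, one_apply_eq_self, map_add,
    map_sub, hP, hτ]

/-- `τ` maps the part of the space on which `T` has its eigenvalues in `I` injectively to the part
with eigenvalues in `-I`, along the other eigenspaces. For an upper set `I` this means that the
filtration of `T` and its image under `τ` are opposite at `I`. -/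
def IsOpp (S : Finset ℝ) (I : Set ℝ) (τ T : E →L[ℂ] E) : Prop :=
  ∀ u, spectralProj S I T u = u → spectralProj S (-I) T (τ u) = 0 → u = 0

theorem isOpp_iff_of_bijective (φ : E →ₗ[ℝ] F) (hφ : Function.Bijective φ)
    (hT : ∀ u, φ (T u) = T' (φ u)) (hτ : ∀ u, φ (τ u) = τ' (φ u)) :
    IsOpp S I τ T ↔ IsOpp S I τ' T' := by
  have hP : ∀ J v, φ (spectralProj S J T v) = spectralProj S J T' (φ v) := fun J v =>
    map_spectralCalc_apply φ hT _ v
  simp only [IsOpp, hφ.surjective.forall, ← hP, ← hτ, hφ.injective.eq_iff,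
    map_eq_zero_iff φ hφ.injective]

theorem SplitsOn.isOpp_neg_iff (hS : ∀ l ∈ S, -l ∈ S) (hT : SplitsOn S T) :
    IsOpp S I τ (-T) ↔ IsOpp S (-I) τ T := by
  simp only [IsOpp, hT.spectralProj_neg hS]

theorem IsOpp.of_sameFiltration (hT : SplitsOn S T) (hT₁ : SplitsOn S T₁) (hI : IsUpperSet I)
    (h : SameFiltration S T T₁) (ho : IsOpp S I τ T) : IsOpp S I τ T₁ := by
  intro u hu hτu
  refine ho u ?_ ?_
  · have hmul := congrArg (fun A : E →L[ℂ] E => A u) (h.mul_upper hI)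
    simp only [clm_mul_apply, hu] at hmul
    exact hmul
  · have hmul := congrArg (fun A : E →L[ℂ] E => A (τ u)) (h.mul_lower hT hT₁ hI.neg)
    simp only [clm_mul_apply, hτu, map_zero] at hmul
    exact hmul.symm

theorem SplitsOn.oppOp_injective_iff (hT : SplitsOn S T) (hI : Disjoint I (-I)) :
    (∀ u, oppOp S I τ T u = 0 → u = 0) ↔ IsOpp S I τ T ∧ IsOpp S (-I) τ T := by
  constructor
  · refine fun h => ⟨fun u hu hτu => h u ?_, fun u hu hτu => h u ?_⟩
    · have hmul := congrArg (fun A : E →L[ℂ] E => A u) (hT.oppOp_mul_spectralProj hI τ)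
      simp only [clm_mul_apply, hu, hτu] at hmul
      exact hmul
    · rw [neg_neg] at hτu
      have hmul := congrArg (fun A : E →L[ℂ] E => A u) (hT.oppOp_mul_spectralProj_neg hI τ)
      simp only [clm_mul_apply, hu, hτu] at hmul
      exact hmul
  · rintro ⟨hpos, hneg⟩ u hu
    have hidem : ∀ J, spectralProj S J T (spectralProj S J T u) = spectralProj S J T u := fun J =>
      congrArg (fun A : E →L[ℂ] E => A u) (hT.spectralProj_mul_self J)
    have hmul := congrArg (fun A : E →L[ℂ] E => A u) (hT.spectralProj_mul_oppOp hI τ)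
    have hmul_neg := congrArg (fun A : E →L[ℂ] E => A u) (hT.spectralProj_neg_mul_oppOp hI τ)
    simp only [clm_mul_apply, hu, map_zero] at hmul hmul_neg
    have hu_pos : spectralProj S I T u = 0 := hpos _ (hidem I) hmul_neg.symm
    have hu_neg : spectralProj S (-I) T u = 0 :=
      hneg _ (hidem (-I)) (by rw [neg_neg]; exact hmul.symm)
    simpa only [oppOp, _root_.add_apply, _root_.sub_apply, clm_mul_apply, one_apply_eq_self,
      hu_pos, hu_neg, map_zero, zero_add, sub_zero] using hu

end Operator

section Adjoint

variable {L : Type*} [NormedLieRing L] [NormedLieAlgebra ℂ L] [FiniteDimensional ℂ L]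

/-- The determinant of the operator `oppOp` formed with the spectral projections of `ad z`. -/
def oppDet (S : Finset ℝ) (I : Set ℝ) (τ : L →L[ℂ] L) (z : L) : ℂ := (oppOp S I τ (adC z)).det

theorem contDiff_oppOp_adC (S : Finset ℝ) (I : Set ℝ) (τ : L →L[ℂ] L) {n : WithTop ℕ∞} :
    ContDiff ℂ n fun z : L => oppOp S I τ (adC z) := by
  have hpos := contDiff_spectralProj_adC (L := L) S I (n := n)
  have hneg := contDiff_spectralProj_adC (L := L) S (-I) (n := n)
  exact (((hneg.mul contDiff_const).mul hpos).add ((hpos.mul contDiff_const).mul hneg)).add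
    ((contDiff_const.sub hpos).sub hneg)

theorem contDiff_oppDet (S : Finset ℝ) (I : Set ℝ) (τ : L →L[ℂ] L) {n : WithTop ℕ∞} :
    ContDiff ℂ n (oppDet S I τ) :=
  contDiff_clm_det.comp (contDiff_oppOp_adC S I τ)

theorem oppDet_mem_polyFun (S : Finset ℝ) (I : Set ℝ) (τ : L →L[ℂ] L) :
    oppDet S I τ ∈ polyFun L := by
  have hpos := spectralProj_adC_mem_polyOp (L := L) S I
  have hneg := spectralProj_adC_mem_polyOp (L := L) S (-I)
  have hτ : (fun _ : L => τ) ∈ polyOp L := fun φ v => (polyFun L).algebraMap_mem (φ (τ v))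
  exact det_mem_polyFun (add_mem (add_mem (mul_mem (mul_mem hneg hτ) hpos)
    (mul_mem (mul_mem hpos hτ) hneg)) (sub_mem (sub_mem (one_mem _) hpos) hneg))

theorem oppDet_ne_zero_iff {S : Finset ℝ} {I : Set ℝ} {τ : L →L[ℂ] L} {z : L}
    (hz : SplitsOn S (adC z)) (hI : Disjoint I (-I)) :
    oppDet S I τ z ≠ 0 ↔ IsOpp S I τ (adC z) ∧ IsOpp S (-I) τ (adC z) :=
  (clm_det_ne_zero_iff _).trans (hz.oppOp_injective_iff hI)

end Adjoint

end OppositeFiltrations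

/-! ### The spherical group and its open orbit -/

section SphericalOrbit

variable {L : Type*} [NormedLieRing L] [NormedLieAlgebra ℂ L] [FiniteDimensional ℂ L]
  {θ σ : L →ₛₗ[starRingEnd ℂ] L} {x : L}

/-- The complex linear involution `θσ`. -/
def tau (θ σ : L →ₛₗ[starRingEnd ℂ] L) : L →L[ℂ] L :=
  LinearMap.toContinuousLinearMap (θ.comp σ : L →ₗ[ℂ] L)

theorem tau_apply (u : L) : tau θ σ u = θ (σ u) := rfl

/-- The Lie algebra of `K^ℂ`, as a real subspace. -/
def sphericalForm (θ σ : L →ₛₗ[starRingEnd ℂ] L) : Submodule ℝ L :=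
  (LinearMap.ker (tau θ σ - 1).toLinearMap).restrictScalars ℝ

theorem mem_sphericalForm {u : L} : u ∈ sphericalForm θ σ ↔ θ (σ u) = u := sub_eq_zero

/-- The polynomial whose non-vanishing on `𝒪` defines `ℬ`. -/
def discr (θ σ : L →ₛₗ[starRingEnd ℂ] L) (x z : L) : ℂ :=
  oppDet (realSpectrum x) (Set.Ioi 0) (tau θ σ) z

theorem differentiable_discr : Differentiable ℂ (discr θ σ x) :=
  (contDiff_oppDet (realSpectrum x) (Set.Ioi 0) (tau θ σ) (n := 1)).differentiable one_ne_zero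

theorem isOpen_discr_ne_zero : IsOpen {z : L | discr θ σ x z ≠ 0} :=
  isOpen_ne_fun differentiable_discr.continuous continuous_const

theorem neg_Ioi_zero : -Set.Ioi (0 : ℝ) = Set.Iio 0 := by rw [Set.neg_Ioi, neg_zero]

theorem disjoint_Ioi_zero : Disjoint (Set.Ioi (0 : ℝ)) (-Set.Ioi 0) :=
  disjoint_neg_of_pos fun _ h => h

theorem eq_one_of_mem_adGroup_zero {g : L ≃L[ℂ] L} (hg : g ∈ adGroup ({0} : Set L)) : g = 1 := by
  refine adGroup_induction (p := fun g => g = 1) ?_ rfl ?_ ?_ hg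
  · rintro u rfl
    ext v
    rw [expEquiv_apply, expAd_zero]
    rfl
  · rintro g k rfl rfl
    rfl
  · rintro g rfl
    exact inv_one

theorem exists_entire_curve_from_one {T : Set L} {g : L ≃L[ℂ] L} (hg : g ∈ adGroup T) :
    ∃ G : ℂ → (L ≃L[ℂ] L), Differentiable ℂ (fun t => (G t : L →L[ℂ] L)) ∧ G 0 = 1 ∧ G 1 = g ∧
      ∀ (t : ℂ) (T' : Set L), (∀ u ∈ T, t • u ∈ T') → G t ∈ adGroup T' := by
  obtain ⟨G, hG, hG1, hGmem⟩ := exists_differentiable_curve (c := fun u t => t • u) (t₁ := 1)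
    (fun u _ => differentiable_id.smul_const u) (fun u _ => one_smul ℂ u) hg
  exact ⟨G, hG, eq_one_of_mem_adGroup_zero (hGmem 0 {0} fun u _ => zero_smul ℂ u), hG1, hGmem⟩

theorem exists_entire_curve_joining {z w : L} (hz : z ∈ complexOrbit x)
    (hw : w ∈ complexOrbit x) :
    ∃ c : ℂ → L, Differentiable ℂ c ∧ c 0 = z ∧ c 1 = w ∧ ∀ t, c t ∈ complexOrbit x := by
  obtain ⟨g, hg, rfl⟩ := hz
  obtain ⟨k, hk, rfl⟩ := hw
  obtain ⟨G, hG, hG0, hG1, hGmem⟩ := exists_entire_curve_from_one (mul_mem hk (inv_mem hg))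
  refine ⟨fun t => G t (g x), fun t => (hG t).clm_apply (differentiableAt_const _), ?_, ?_,
    fun t => apply_mem_complexOrbit (hGmem t Set.univ fun _ _ => trivial) ⟨g, hg, rfl⟩⟩
  · exact congrArg (fun e : L ≃L[ℂ] L => e (g x)) hG0
  · exact (congrArg (fun e : L ≃L[ℂ] L => e (g x)) hG1).trans
      (congrArg k (g.symm_apply_apply x))

/-- The hypotheses of the theorem: commuting conjugations `θ`, `σ`, the first one compact, and a
point `x ∈ i𝔤` fixed by `σ`. -/
structure SphericalData (θ σ : L →ₛₗ[starRingEnd ℂ] L) (x : L) : Prop where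
  compact : IsCompactConjugation θ
  second : IsConjugation σ
  comm : ∀ u, θ (σ u) = σ (θ u)
  base_compact : θ x = -x
  base_conj : σ x = x

/-- The points `z` and `w` of `𝒪` project to the same `K^ℂ`-orbit in the flag manifold `X`: some
element of `K^ℂ` moves the filtration of `z` to that of `w`. -/
def SphericalRel (θ σ : L →ₛₗ[starRingEnd ℂ] L) (x z w : L) : Prop :=
  ∃ k ∈ sphericalGroup θ σ, SameFiltration (realSpectrum x) (adC (k z)) (adC w)

theorem SphericalRel.symm {z w : L} (h : SphericalRel θ σ x z w) : SphericalRel θ σ x w z := by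
  obtain ⟨k, hk, h⟩ := h
  refine ⟨k⁻¹, inv_mem hk, ?_⟩
  have hinv := h.symm.adC_map (isAut_of_mem (inv_mem hk))
  rwa [show k⁻¹ (k z) = z from k.symm_apply_apply z] at hinv

theorem SphericalRel.trans {z w v : L} (hzw : SphericalRel θ σ x z w)
    (hwv : SphericalRel θ σ x w v) : SphericalRel θ σ x z v := by
  obtain ⟨k, hk, hzw⟩ := hzw
  obtain ⟨k', hk', hwv⟩ := hwv
  exact ⟨k' * k, mul_mem hk' hk, (hzw.adC_map (isAut_of_mem hk')).trans hwv⟩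

namespace SphericalData

theorem tau_lie (D : SphericalData θ σ x) (u v : L) :
    tau θ σ ⁅u, v⁆ = ⁅tau θ σ u, tau θ σ v⁆ := by
  rw [tau_apply, D.second.map_lie, D.compact.map_lie, tau_apply, tau_apply]

theorem tau_tau (D : SphericalData θ σ x) (u : L) : tau θ σ (tau θ σ u) = u := by
  rw [tau_apply, tau_apply, ← D.comm, D.compact.involutive, D.second.involutive]

theorem conj_tau (D : SphericalData θ σ x) (u : L) : θ (tau θ σ u) = tau θ σ (θ u) := by
  rw [tau_apply, tau_apply, D.comm]

theorem tau_base (D : SphericalData θ σ x) : tau θ σ x = -x := by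
  rw [tau_apply, D.base_conj, D.base_compact]

theorem neg_mem (D : SphericalData θ σ x) : ∀ l ∈ realSpectrum x, -l ∈ realSpectrum x :=
  fun _ => neg_mem_realSpectrum D.compact.toIsConjugation D.base_compact

theorem splitsOn (D : SphericalData θ σ x) {z : L} (hz : z ∈ complexOrbit x) :
    SplitsOn (realSpectrum x) (adC z) :=
  splitsOn_of_mem_complexOrbit D.compact D.base_compact hz

theorem conj_eq_neg (D : SphericalData θ σ x) {y : L} (hy : y ∈ compactOrbit θ x) : θ y = -y :=
  conj_eq_neg_of_mem D.compact.toIsConjugation D.base_compact hy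

theorem spectralProj_tau (D : SphericalData θ σ x) {s : L}
    (hs : SplitsOn (realSpectrum x) (adC s)) (h : tau θ σ s = -s) (I : Set ℝ) (u : L) :
    spectralProj (realSpectrum x) I (adC s) (tau θ σ u) =
      tau θ σ (spectralProj (realSpectrum x) (-I) (adC s) u) := by
  rw [← hs.spectralProj_neg D.neg_mem]
  refine (map_spectralCalc_apply ((tau θ σ : L →ₗ[ℂ] L).restrictScalars ℝ) (fun v => ?_) _ u).symm
  change tau θ σ (-⁅s, v⁆) = ⁅s, tau θ σ v⁆
  rw [map_neg, D.tau_lie, h, neg_lie, neg_neg]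

theorem tau_apply_of_mem (D : SphericalData θ σ x) {k : L ≃L[ℂ] L}
    (hk : k ∈ sphericalGroup θ σ) (v : L) : tau θ σ (k v) = k (tau θ σ v) := by
  refine adGroup_induction (p := fun g => ∀ v, tau θ σ (g v) = g (tau θ σ v)) ?_ ?_ ?_ ?_ hk v
  · intro u hu v
    rw [expEquiv_apply, expEquiv_apply, tau_apply, D.second.conj_expAd,
      D.compact.toIsConjugation.conj_expAd, show θ (σ u) = u from hu, tau_apply]
  · exact fun v => rfl
  · exact fun g k hg hk v => (hg (k v)).trans (congrArg g (hk v))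
  · intro g hg v
    apply g.injective
    rw [← hg]
    exact (congrArg (tau θ σ) (g.apply_symm_apply v)).trans (g.apply_symm_apply _).symm

theorem tau_of_mem_sphericalOrbit (D : SphericalData θ σ x) {s : L}
    (hs : s ∈ sphericalOrbit θ σ x) : tau θ σ s = -s := by
  obtain ⟨k, hk, rfl⟩ := hs
  rw [D.tau_apply_of_mem hk, D.tau_base, map_neg]

theorem isOpp_adC_neg_conj_iff (D : SphericalData θ σ x) {z : L}
    (hz : SplitsOn (realSpectrum x) (adC z)) (I : Set ℝ) :
    IsOpp (realSpectrum x) I (tau θ σ) (adC (-θ z)) ↔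
      IsOpp (realSpectrum x) (-I) (tau θ σ) (adC z) := by
  rw [← hz.isOpp_neg_iff D.neg_mem]
  refine (isOpp_iff_of_bijective (conjR θ : L →ₗ[ℝ] L)
    (Function.Involutive.bijective D.compact.involutive) (fun u => ?_) D.conj_tau).symm
  change θ (-⁅z, u⁆) = ⁅-θ z, θ u⁆
  rw [map_neg, D.compact.map_lie, neg_lie]

theorem isOpp_adC_map_iff (D : SphericalData θ σ x) {k : L ≃L[ℂ] L}
    (hk : k ∈ sphericalGroup θ σ) (I : Set ℝ) (z : L) :
    IsOpp (realSpectrum x) I (tau θ σ) (adC (k z)) ↔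
      IsOpp (realSpectrum x) I (tau θ σ) (adC z) :=
  (isOpp_iff_of_bijective (k.toLinearEquiv.toLinearMap.restrictScalars ℝ) k.bijective
    (isAut_of_mem hk z) fun u => (D.tau_apply_of_mem hk u).symm).symm

theorem isOpp_of_tau (D : SphericalData θ σ x) {s : L} (hs : SplitsOn (realSpectrum x) (adC s))
    (h : tau θ σ s = -s) (I : Set ℝ) : IsOpp (realSpectrum x) I (tau θ σ) (adC s) := by
  intro u hu hτu
  rw [D.spectralProj_tau hs h, neg_neg, hu] at hτu
  rw [← D.tau_tau u, hτu, map_zero]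

theorem discr_ne_zero_iff (D : SphericalData θ σ x) {z : L}
    (hz : SplitsOn (realSpectrum x) (adC z)) :
    discr θ σ x z ≠ 0 ↔ IsOpp (realSpectrum x) (Set.Ioi 0) (tau θ σ) (adC z) ∧
      IsOpp (realSpectrum x) (Set.Ioi 0) (tau θ σ) (adC (-θ z)) := by
  rw [discr, oppDet_ne_zero_iff hz disjoint_Ioi_zero, D.isOpp_adC_neg_conj_iff hz]

theorem discr_ne_zero_iff_of_compact (D : SphericalData θ σ x) {y : L}
    (hy : y ∈ compactOrbit θ x) :
    discr θ σ x y ≠ 0 ↔ IsOpp (realSpectrum x) (Set.Ioi 0) (tau θ σ) (adC y) := by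
  rw [D.discr_ne_zero_iff (D.splitsOn (compactOrbit_subset hy)), D.conj_eq_neg hy, neg_neg,
    and_self]

theorem discr_base (D : SphericalData θ σ x) : discr θ σ x x ≠ 0 :=
  (D.discr_ne_zero_iff_of_compact mem_compactOrbit_self).mpr
    (D.isOpp_of_tau (D.splitsOn (mem_complexOrbit_self x)) D.tau_base _)

theorem exists_sphericalForm_sub (D : SphericalData θ σ x) {z : L}
    (hz : SplitsOn (realSpectrum x) (adC z)) (h : discr θ σ x z ≠ 0) (u : L) :
    ∃ v ∈ sphericalForm θ σ,
      spectralProj (realSpectrum x) (Set.Iio 0) (adC z) (u - v) = 0 := by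
  let O := ContinuousLinearMap.toContinuousLinearEquivOfDetNeZero
    (oppOp (realSpectrum x) (Set.Ioi 0) (tau θ σ) (adC z)) h
  obtain ⟨w, hw⟩ := O.surjective (spectralProj (realSpectrum x) (Set.Iio 0) (adC z) u)
  have hOw : oppOp (realSpectrum x) (Set.Ioi 0) (tau θ σ) (adC z) w =
    spectralProj (realSpectrum x) (Set.Iio 0) (adC z) u := hw
  set n := spectralProj (realSpectrum x) (Set.Ioi 0) (adC z) w with hn
  have hτn : spectralProj (realSpectrum x) (Set.Iio 0) (adC z) (tau θ σ n) =
      spectralProj (realSpectrum x) (Set.Iio 0) (adC z) u := by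
    have hmul := congrArg (fun T : L →L[ℂ] L => T w)
      (hz.spectralProj_neg_mul_oppOp disjoint_Ioi_zero (tau θ σ))
    rw [neg_Ioi_zero] at hmul
    simp only [clm_mul_apply, hOw] at hmul
    rw [hn, ← hmul, ← clm_mul_apply, hz.spectralProj_mul_self]
  have hneg : spectralProj (realSpectrum x) (Set.Iio 0) (adC z) n = 0 := by
    have hdisj := disjoint_Ioi_zero.symm
    rw [neg_Ioi_zero] at hdisj
    rw [hn, ← clm_mul_apply, hz.spectralProj_mul_of_disjoint hdisj, _root_.zero_apply]
  refine ⟨tau θ σ n + n, ?_, ?_⟩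
  · rw [mem_sphericalForm, ← tau_apply, map_add, D.tau_tau, add_comm]
  · rw [map_sub, map_add, hneg, add_zero, hτn, sub_self]

theorem eventually_sphericalRel (D : SphericalData θ σ x) {z : L}
    (hz : SplitsOn (realSpectrum x) (adC z)) (h : discr θ σ x z ≠ 0) :
    ∀ᶠ w in 𝓝 z, SplitsOn (realSpectrum x) (adC w) → SphericalRel θ σ x z w := by
  filter_upwards [eventually_exists_expAd D.compact hz (sphericalForm θ σ)
    (D.exists_sphericalForm_sub hz h)] with w hslice hw
  obtain ⟨v, hv, q, hq, rfl⟩ := hslice hw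
  have hzq : SplitsOn (realSpectrum x) (adC (z + q)) := by
    have hback := hw.adC_map (isAut_expEquiv (-v))
    rwa [expEquiv_apply, expAd_neg_apply] at hback
  refine ⟨expEquiv v, expEquiv_mem (mem_sphericalForm.mp hv), ?_⟩
  exact SameFiltration.adC_map (isAut_expEquiv v)
    (sameFiltration_of_mem_iwasawaFiber hz hzq (add_mem_iwasawaFiber hq))

theorem sphericalRel_of_discr (D : SphericalData θ σ x) {z w : L} (hz : z ∈ complexOrbit x)
    (hw : w ∈ complexOrbit x) (hz' : discr θ σ x z ≠ 0) (hw' : discr θ σ x w ≠ 0) :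
    SphericalRel θ σ x z w := by
  obtain ⟨c, hc, rfl, rfl, hcO⟩ := exists_entire_curve_joining hz hw
  refine (isPreconnected_ne_zero_of_entire (differentiable_discr.comp hc)).induction₂
    (fun s t => SphericalRel θ σ x (c s) (c t)) ?_ ?_ ?_ hz' hw'
  · intro t ht
    have hev := hc.continuous.continuousAt.eventually
      (D.eventually_sphericalRel (D.splitsOn (hcO t)) ht)
    filter_upwards [mem_nhdsWithin_of_mem_nhds hev] with s hs
    exact hs (D.splitsOn (hcO s))
  · exact fun r s t _ _ _ hrs hst => hrs.trans hst
  · exact fun s t _ _ hst => hst.symm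

theorem discr_iwasawaProj_ne_zero_iff (D : SphericalData θ σ x) {z : L}
    (hz : z ∈ complexOrbit x) :
    discr θ σ x (iwasawaProj θ x z) ≠ 0 ↔
      IsOpp (realSpectrum x) (Set.Ioi 0) (tau θ σ) (adC z) := by
  have hmem := iwasawaProj_mem D.compact D.base_compact hz
  have hsame := sameFiltration_iwasawaProj D.compact D.base_compact hz
  have hy := D.splitsOn (compactOrbit_subset hmem)
  have hz := D.splitsOn hz
  rw [D.discr_ne_zero_iff_of_compact hmem]
  exact ⟨.of_sameFiltration hy hz (isUpperSet_Ioi 0) hsame,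
    .of_sameFiltration hz hy (isUpperSet_Ioi 0) hsame.symm⟩

theorem discr_iwasawaProj_map_ne_zero_iff (D : SphericalData θ σ x) {y : L}
    (hy : y ∈ compactOrbit θ x) {k : L ≃L[ℂ] L} (hk : k ∈ sphericalGroup θ σ) :
    discr θ σ x (iwasawaProj θ x (k y)) ≠ 0 ↔ discr θ σ x y ≠ 0 := by
  rw [D.discr_iwasawaProj_ne_zero_iff (apply_mem_complexOrbit hk (compactOrbit_subset hy)),
    D.isOpp_adC_map_iff hk, D.discr_ne_zero_iff_of_compact hy]

theorem flagOrbit_eq (D : SphericalData θ σ x) {y : L} (hy : y ∈ compactOrbit θ x)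
    (h : discr θ σ x y ≠ 0) :
    flagOrbit θ σ x y = {y' ∈ compactOrbit θ x | discr θ σ x y' ≠ 0} := by
  have hyO := compactOrbit_subset hy
  ext y'
  constructor
  · rintro ⟨k, hk, rfl⟩
    exact ⟨iwasawaProj_mem D.compact D.base_compact (apply_mem_complexOrbit hk hyO),
      (D.discr_iwasawaProj_map_ne_zero_iff hy hk).mpr h⟩
  · rintro ⟨hy', h'⟩
    obtain ⟨k, hk, hsame⟩ := D.sphericalRel_of_discr hyO (compactOrbit_subset hy') h h'
    exact ⟨k, hk, (iwasawaProj_eq D.compact D.base_compact (apply_mem_complexOrbit hk hyO) hy'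
      hsame).symm⟩

theorem compactOrbit_subset_closure (D : SphericalData θ σ x) :
    compactOrbit θ x ⊆ closure {y ∈ compactOrbit θ x | discr θ σ x y ≠ 0} := by
  rintro _ ⟨g, hg, rfl⟩
  obtain ⟨G, hG, hG0, rfl, hGmem⟩ := exists_entire_curve_from_one hg
  have hc : Differentiable ℂ fun t => G t x := fun t =>
    (hG t).clm_apply (differentiableAt_const _)
  have hne : discr θ σ x (G 0 x) ≠ 0 := hG0 ▸ D.discr_base
  have hev := eventually_ne_zero_of_entire (differentiable_discr.comp hc) hne 1
  have hlim := tendsto_ofReal_nhdsNE 1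
  rw [Complex.ofReal_one] at hlim
  refine mem_closure_of_tendsto (b := 𝓝[≠] (1 : ℝ)) (f := fun r : ℝ => G (r : ℂ) x)
    ((hc.continuous.tendsto 1).comp (tendsto_nhds_of_tendsto_nhdsWithin hlim)) ?_
  filter_upwards [hlim.eventually hev] with r hr
  refine ⟨⟨G r, hGmem r _ fun u hu => ?_, rfl⟩, hr⟩
  rw [Set.mem_ofPred_eq, Complex.coe_smul, conj_smul_of_real, show θ u = u from hu]

theorem openOrbit_eq (D : SphericalData θ σ x) :
    openOrbit θ σ x = {y ∈ compactOrbit θ x | discr θ σ x y ≠ 0} := by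
  ext y
  constructor
  · rintro ⟨hy, -, hdense⟩
    obtain ⟨_, hw, k, hk, rfl⟩ := mem_closure_iff.mp (hdense mem_compactOrbit_self) _
      isOpen_discr_ne_zero D.discr_base
    exact ⟨hy, (D.discr_iwasawaProj_map_ne_zero_iff hy hk).mp hw⟩
  · rintro ⟨hy, h⟩
    rw [openOrbit, Set.mem_ofPred_eq, D.flagOrbit_eq hy h]
    exact ⟨hy, ⟨_, isOpen_discr_ne_zero, rfl⟩, D.compactOrbit_subset_closure⟩

theorem mem_openOrbit (D : SphericalData θ σ x) {y : L} :
    y ∈ openOrbit θ σ x ↔ y ∈ compactOrbit θ x ∧ discr θ σ x y ≠ 0 := by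
  rw [D.openOrbit_eq, Set.mem_ofPred_eq]

theorem neg_conj_mem_complexOrbit (D : SphericalData θ σ x) {z : L} (hz : z ∈ complexOrbit x) :
    -θ z ∈ complexOrbit x := by
  obtain ⟨g, hg, rfl⟩ := hz
  obtain ⟨k, hk, h⟩ := D.compact.toIsConjugation.exists_conj_mem hg
  refine ⟨k, adGroup_mono (Set.subset_univ _) hk, ?_⟩
  rw [h, D.base_compact, map_neg, neg_neg]

theorem mem_domainA (D : SphericalData θ σ x) {z : L} :
    z ∈ domainA θ σ x ↔ z ∈ complexOrbit x ∧
      IsOpp (realSpectrum x) (Set.Ioi 0) (tau θ σ) (adC z) := by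
  refine and_congr_right fun hz => ?_
  rw [D.mem_openOrbit, D.discr_iwasawaProj_ne_zero_iff hz]
  exact and_iff_right (iwasawaProj_mem D.compact D.base_compact hz)

theorem mem_domainB (D : SphericalData θ σ x) {z : L} :
    z ∈ domainB θ σ x ↔ z ∈ complexOrbit x ∧ discr θ σ x z ≠ 0 := by
  have hθθ : ∀ w, -θ (-θ w) = w := fun w => by rw [map_neg, D.compact.involutive, neg_neg]
  constructor
  · rintro ⟨hz, w, hw, rfl⟩
    rw [D.mem_domainA] at hz hw
    refine ⟨hz.1, (D.discr_ne_zero_iff (D.splitsOn hz.1)).mpr ⟨hz.2, ?_⟩⟩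
    rw [hθθ]
    exact hw.2
  · rintro ⟨hz, hne⟩
    rw [D.discr_ne_zero_iff (D.splitsOn hz)] at hne
    exact ⟨D.mem_domainA.mpr ⟨hz, hne.1⟩, -θ z,
      D.mem_domainA.mpr ⟨D.neg_conj_mem_complexOrbit hz, hne.2⟩, hθθ z⟩

theorem openOrbit_subset_domainB (D : SphericalData θ σ x) :
    openOrbit θ σ x ⊆ domainB θ σ x := fun _ hy =>
  D.mem_domainB.mpr ⟨compactOrbit_subset (D.mem_openOrbit.mp hy).1, (D.mem_openOrbit.mp hy).2⟩

theorem isOpenIn_domainB (D : SphericalData θ σ x) :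
    IsOpenIn (complexOrbit x) (domainB θ σ x) :=
  ⟨_, isOpen_discr_ne_zero, Set.ext fun _ => D.mem_domainB⟩

theorem isZariskiOpenIn_domainB (D : SphericalData θ σ x) :
    IsZariskiOpenIn (complexOrbit x) (domainB θ σ x) := by
  refine ⟨{discr θ σ x}, Set.singleton_subset_iff.mpr (oppDet_mem_polyFun _ _ _), ?_⟩
  ext z
  simp only [D.mem_domainB, Set.mem_ofPred_eq, Set.mem_singleton_iff, exists_eq_left]

theorem isConnected_domainB (D : SphericalData θ σ x) : IsConnected (domainB θ σ x) := by
  refine ⟨⟨x, D.mem_domainB.mpr ⟨mem_complexOrbit_self x, D.discr_base⟩⟩, ?_⟩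
  refine isPreconnected_of_forall_pair fun z hz w hw => ?_
  rw [D.mem_domainB] at hz hw
  obtain ⟨c, hc, rfl, rfl, hcO⟩ := exists_entire_curve_joining hz.1 hw.1
  refine ⟨c '' {t | discr θ σ x (c t) ≠ 0}, ?_, ⟨0, hz.2, rfl⟩, ⟨1, hw.2, rfl⟩, ?_⟩
  · rintro _ ⟨t, ht, rfl⟩
    exact D.mem_domainB.mpr ⟨hcO t, ht⟩
  · exact (isPreconnected_ne_zero_of_entire (differentiable_discr.comp hc)).image _
      hc.continuous.continuousOn

theorem apply_mem_domainB (D : SphericalData θ σ x) {k : L ≃L[ℂ] L}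
    (hk : k ∈ sphericalGroup θ σ) {z : L} (hz : z ∈ domainB θ σ x) : k z ∈ domainB θ σ x := by
  rw [D.mem_domainB] at hz ⊢
  have hkz := apply_mem_complexOrbit hk hz.1
  refine ⟨hkz, (oppDet_ne_zero_iff (D.splitsOn hkz) disjoint_Ioi_zero).mpr ?_⟩
  rw [D.isOpp_adC_map_iff hk, D.isOpp_adC_map_iff hk]
  exact (oppDet_ne_zero_iff (D.splitsOn hz.1) disjoint_Ioi_zero).mp hz.2

end SphericalData

end SphericalOrbit

/-! ### The complexified gradient field -/

section FibreSection

variable {L : Type*} [NormedLieRing L] [NormedLieAlgebra ℂ L] [FiniteDimensional ℂ L]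
  {S : Finset ℝ} {I : Set ℝ} {τ : L →L[ℂ] L} {z m : L}

/-- The vector `m` in the sum of the eigenspaces of `ad z` with eigenvalues in `I` for which
`τ (z + m)` has no component in the eigenspaces with eigenvalues in `-I`. It is a junk value where
`oppDet S I τ z` vanishes. -/
def oppVec (S : Finset ℝ) (I : Set ℝ) (τ : L →L[ℂ] L) (z : L) : L :=
  -Ring.inverse (oppOp S I τ (adC z)) (spectralProj S (-I) (adC z) (τ z))

theorem isUnit_oppOp_adC (h : oppDet S I τ z ≠ 0) : IsUnit (oppOp S I τ (adC z)) :=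
  ContinuousLinearMap.isUnit_iff_isUnit_toLinearMap.mpr
    ((LinearMap.isUnit_iff_isUnit_det _).mpr h.isUnit)

theorem oppOp_oppVec (h : oppDet S I τ z ≠ 0) :
    oppOp S I τ (adC z) (oppVec S I τ z) = -spectralProj S (-I) (adC z) (τ z) := by
  rw [oppVec, map_neg, ← clm_mul_apply, Ring.mul_inverse_cancel _ (isUnit_oppOp_adC h),
    one_apply_eq_self]

theorem eq_oppVec_of_oppOp_eq (h : oppDet S I τ z ≠ 0)
    (hm : oppOp S I τ (adC z) m = -spectralProj S (-I) (adC z) (τ z)) : m = oppVec S I τ z := by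
  refine sub_eq_zero.mp ((clm_det_ne_zero_iff _).mp h _ ?_)
  rw [map_sub, hm, oppOp_oppVec h, sub_self]

theorem contDiffAt_oppVec (h : oppDet S I τ z ≠ 0) {n : WithTop ℕ∞} :
    ContDiffAt ℂ n (oppVec S I τ) z := by
  obtain ⟨U, hU⟩ := isUnit_oppOp_adC h
  have hinv := contDiffAt_ringInverse ℂ (n := n) U
  rw [hU] at hinv
  exact ((hinv.comp z (contDiff_oppOp_adC S I τ).contDiffAt).clm_apply
    ((contDiff_spectralProj_adC S (-I)).contDiffAt.clm_apply τ.contDiff.contDiffAt)).neg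

theorem oppOp_spectralProj_apply (hz : SplitsOn S (adC z)) (hI : Disjoint I (-I)) (u : L) :
    oppOp S I τ (adC z) (spectralProj S I (adC z) u) =
      spectralProj S (-I) (adC z) (oppOp S I τ (adC z) u) :=
  congrArg (fun T : L →L[ℂ] L => T u)
    ((hz.oppOp_mul_spectralProj hI τ).trans (hz.spectralProj_neg_mul_oppOp hI τ).symm)

theorem spectralProj_oppVec (hz : SplitsOn S (adC z)) (hI : Disjoint I (-I))
    (h : oppDet S I τ z ≠ 0) : spectralProj S I (adC z) (oppVec S I τ z) = oppVec S I τ z := by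
  refine eq_oppVec_of_oppOp_eq h ?_
  rw [oppOp_spectralProj_apply hz hI, oppOp_oppVec h, map_neg, ← clm_mul_apply,
    hz.spectralProj_mul_self]

theorem eq_oppVec (hz : SplitsOn S (adC z)) (hI : Disjoint I (-I)) (h0 : 0 ∉ I)
    (h : oppDet S I τ z ≠ 0) (hm : spectralProj S I (adC z) m = m)
    (hτ : τ (z + m) = -(z + m)) : m = oppVec S I τ z := by
  have hm_neg : spectralProj S (-I) (adC z) m = 0 := by
    rw [← hm, ← clm_mul_apply, hz.spectralProj_mul_of_disjoint hI.symm, _root_.zero_apply]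
  have hz_neg : spectralProj S (-I) (adC z) z = 0 :=
    hz.spectralProj_apply_of_notMem (c := 0) (by rw [adC_apply, lie_self, zero_smul])
      (by rwa [Set.mem_neg, neg_zero])
  have hOm : oppOp S I τ (adC z) m = spectralProj S (-I) (adC z) (τ m) := by
    have hmul := congrArg (fun T : L →L[ℂ] L => T m) (hz.oppOp_mul_spectralProj hI τ)
    simp only [clm_mul_apply, hm] at hmul
    exact hmul
  refine eq_oppVec_of_oppOp_eq h (hOm.trans (eq_neg_of_add_eq_zero_left ?_))
  rw [← map_add, ← map_add, add_comm, hτ, map_neg, map_add, hm_neg, hz_neg, add_zero, neg_zero]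

theorem map_oppVec (φ : L →ₗ[ℝ] L) (hlie : ∀ u v, φ ⁅u, v⁆ = ⁅φ u, φ v⁆)
    (hτ : ∀ u, φ (τ u) = τ (φ u)) (h : oppDet S I τ z ≠ 0) (hφ : oppDet S I τ (φ z) ≠ 0) :
    φ (oppVec S I τ z) = oppVec S I τ (φ z) := by
  refine eq_oppVec_of_oppOp_eq hφ ?_
  rw [← map_oppOp_apply (T := adC z) (T' := adC (φ z)) φ (hlie z) hτ, oppOp_oppVec h, map_neg, ← hτ]
  exact congrArg _ (map_spectralCalc_apply φ (hlie z) _ _)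

theorem oppDet_neg_set : oppDet S (-I) τ z = oppDet S I τ z :=
  congrArg ContinuousLinearMap.det (oppOp_neg τ)

theorem oppDet_neg (hS : ∀ l ∈ S, -l ∈ S) (hz : SplitsOn S (adC z)) :
    oppDet S I τ (-z) = oppDet S I τ z := by
  rw [oppDet, map_neg, hz.oppOp_neg_right hS, oppDet]

theorem oppVec_neg (hS : ∀ l ∈ S, -l ∈ S) (hz : SplitsOn S (adC z)) :
    oppVec S I τ (-z) = -oppVec S (-I) τ z := by
  rw [oppVec, map_neg, hz.oppOp_neg_right hS, hz.spectralProj_neg hS, map_neg, map_neg, map_neg,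
    oppVec, oppOp_neg]

end FibreSection

section GradientField

variable {L : Type*} [NormedLieRing L] [NormedLieAlgebra ℂ L] [FiniteDimensional ℂ L]
  {θ σ : L →ₛₗ[starRingEnd ℂ] L} {x : L}

theorem exists_entire_curve_of_mem_complexOrbit (hθ : IsConjugation θ) {z : L}
    (hz : z ∈ complexOrbit x) :
    ∃ c : ℂ → L, Differentiable ℂ c ∧ c Complex.I = z ∧ (∀ t, c t ∈ complexOrbit x) ∧
      ∀ r : ℝ, c r ∈ compactOrbit θ x := by
  obtain ⟨g, hg, rfl⟩ := hz
  obtain ⟨G, hG, rfl, hGmem⟩ := exists_differentiable_curve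
    (c := fun u t => realPart θ u + t • imagPart θ u) (t₁ := Complex.I)
    (fun u _ => (differentiable_id.smul_const _).const_add _)
    (fun u _ => realPart_add_imagPart u) hg
  refine ⟨fun t => G t x, fun t => (hG t).clm_apply (differentiableAt_const _), rfl, fun t =>
    ⟨G t, hGmem t _ fun _ _ => trivial, rfl⟩, fun r => ⟨G r, hGmem r _ fun u _ => ?_, rfl⟩⟩
  rw [Set.mem_ofPred_eq, Complex.coe_smul, map_add, conj_smul_of_real,
    conj_realPart hθ.involutive, conj_imagPart hθ.involutive]

/-- The vector `s(z) - z`, where `s(z)` is the point of `K^ℂ(x)` in the Iwasawa fibre of `z`. -/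
def sectionVec (θ σ : L →ₛₗ[starRingEnd ℂ] L) (x z : L) : L :=
  oppVec (realSpectrum x) (Set.Ioi 0) (tau θ σ) z

/-- The vector field `Λ` of the theorem. The two summands are the sections of the Iwasawa fibres
and of the opposite fibres; on `X*` the map `-θ` exchanges them. -/
def gradField (θ σ : L →ₛₗ[starRingEnd ℂ] L) (x z : L) : L :=
  (1 / 2 : ℂ) • (sectionVec θ σ x z + oppVec (realSpectrum x) (-Set.Ioi 0) (tau θ σ) z)

namespace SphericalData

theorem gradField_tangent (D : SphericalData θ σ x) {z : L} (hz : z ∈ domainB θ σ x) :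
    ∃ u : L, gradField θ σ x z = ⁅u, z⁆ := by
  obtain ⟨hzO, hne⟩ := D.mem_domainB.mp hz
  have hsplit := D.splitsOn hzO
  obtain ⟨v, -, hv⟩ := exists_lie_eq_spectralProj hsplit (I := Set.Ioi 0)
    (lt_irrefl (0 : ℝ)) (sectionVec θ σ x z)
  obtain ⟨w, -, hw⟩ := exists_lie_eq_spectralProj hsplit (I := -Set.Ioi 0)
    (by rw [Set.mem_neg, neg_zero]; exact lt_irrefl (0 : ℝ))
    (oppVec (realSpectrum x) (-Set.Ioi 0) (tau θ σ) z)
  rw [sectionVec, spectralProj_oppVec hsplit disjoint_Ioi_zero hne] at hv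
  rw [spectralProj_oppVec hsplit (by rw [neg_neg]; exact disjoint_Ioi_zero.symm)
    (oppDet_neg_set.trans_ne hne)] at hw
  exact ⟨(1 / 2 : ℂ) • (v + w), by rw [gradField, smul_lie, add_lie, hv, hw, sectionVec]⟩

theorem differentiableOn_gradField (D : SphericalData θ σ x) :
    DifferentiableOn ℂ (gradField θ σ x) (domainB θ σ x) := fun z hz => by
  have hne := (D.mem_domainB.mp hz).2
  exact ((((contDiffAt_oppVec hne (n := 1)).add (contDiffAt_oppVec
    (oppDet_neg_set.trans_ne hne))).const_smul (1 / 2 : ℂ)).differentiableAt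
      one_ne_zero).differentiableWithinAt

theorem gradField_map (D : SphericalData θ σ x) {k : L ≃L[ℂ] L} (hk : k ∈ sphericalGroup θ σ)
    {z : L} (hz : z ∈ domainB θ σ x) : gradField θ σ x (k z) = k (gradField θ σ x z) := by
  have hne := (D.mem_domainB.mp hz).2
  have hne_map := (D.mem_domainB.mp (D.apply_mem_domainB hk hz)).2
  have hmap : ∀ I, oppDet (realSpectrum x) I (tau θ σ) z ≠ 0 →
      oppDet (realSpectrum x) I (tau θ σ) (k z) ≠ 0 →
      k (oppVec (realSpectrum x) I (tau θ σ) z) = oppVec (realSpectrum x) I (tau θ σ) (k z) :=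
    fun I => map_oppVec (k.toLinearEquiv.toLinearMap.restrictScalars ℝ) (isAut_of_mem hk)
      fun u => (D.tau_apply_of_mem hk u).symm
  rw [gradField, gradField, sectionVec, sectionVec, map_smul, map_add, hmap _ hne hne_map,
    hmap _ (oppDet_neg_set.trans_ne hne) (oppDet_neg_set.trans_ne hne_map)]

theorem add_sectionVec_mem (D : SphericalData θ σ x) {y : L} (hy : y ∈ openOrbit θ σ x) :
    y + sectionVec θ σ x y ∈ sphericalOrbit θ σ x := by
  rw [D.openOrbit_eq, ← D.flagOrbit_eq mem_compactOrbit_self D.discr_base] at hy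
  have hyO := D.flagOrbit_eq mem_compactOrbit_self D.discr_base ▸ hy
  obtain ⟨k, hk, hky⟩ := hy
  have hkx : k x ∈ complexOrbit x := apply_mem_complexOrbit hk (mem_complexOrbit_self x)
  have hsplit := D.splitsOn (compactOrbit_subset hyO.1)
  have hfibre : k x - y ∈ nilradical y :=
    hky ▸ mem_iwasawaFiber_iwasawaProj D.compact D.base_compact hkx
  have hs : k x ∈ sphericalOrbit θ σ x := ⟨k, hk, rfl⟩
  have hsub : k x - y = sectionVec θ σ x y :=
    eq_oppVec hsplit disjoint_Ioi_zero (lt_irrefl (0 : ℝ)) hyO.2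
      ((mem_nilradical_iff hsplit).mp hfibre)
      (by rw [add_sub_cancel]; exact D.tau_of_mem_sphericalOrbit hs)
  rwa [← hsub, add_sub_cancel]

theorem oppVec_neg_Ioi (D : SphericalData θ σ x) {y : L} (hy : y ∈ openOrbit θ σ x) :
    oppVec (realSpectrum x) (-Set.Ioi 0) (tau θ σ) y = -θ (sectionVec θ σ x y) := by
  obtain ⟨hyX, hne⟩ := D.mem_openOrbit.mp hy
  have hsplit := D.splitsOn (compactOrbit_subset hyX)
  have hmap : θ (sectionVec θ σ x y) = oppVec (realSpectrum x) (Set.Ioi 0) (tau θ σ) (θ y) :=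
    map_oppVec (conjR θ : L →ₗ[ℝ] L) D.compact.map_lie D.conj_tau hne (by
      change oppDet _ _ _ (θ y) ≠ 0
      rw [D.conj_eq_neg hyX, oppDet_neg D.neg_mem hsplit]
      exact hne)
  rw [hmap, D.conj_eq_neg hyX, oppVec_neg D.neg_mem hsplit, neg_neg]

theorem eqOn_domainB (D : SphericalData θ σ x) {F G : L → L}
    (hF : DifferentiableOn ℂ F (domainB θ σ x)) (hG : DifferentiableOn ℂ G (domainB θ σ x))
    (h : ∀ y ∈ openOrbit θ σ x, F y = G y) : Set.EqOn F G (domainB θ σ x) := by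
  intro z hz
  obtain ⟨hzO, hne⟩ := D.mem_domainB.mp hz
  obtain ⟨c, hc, rfl, hcO, hcX⟩ :=
    exists_entire_curve_of_mem_complexOrbit D.compact.toIsConjugation hzO
  have hmaps : Set.MapsTo c {t | discr θ σ x (c t) ≠ 0} (domainB θ σ x) := fun t ht =>
    D.mem_domainB.mpr ⟨hcO t, ht⟩
  exact sub_eq_zero.mp (eq_zero_of_forall_real (differentiable_discr.comp hc)
    ((hF.comp hc.differentiableOn hmaps).sub (hG.comp hc.differentiableOn hmaps))
    (fun r hr => sub_eq_zero.mpr (h _ (D.mem_openOrbit.mpr ⟨hcX r, hr⟩))) hne)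

end SphericalData

end GradientField

/-! ### The logarithmic derivative of a determinant -/

section Jacobi

variable {𝕜 E : Type*} [NontriviallyNormedField 𝕜] [CompleteSpace 𝕜] [NormedAddCommGroup E]
  [NormedSpace 𝕜 E] [FiniteDimensional 𝕜 E] {A G : E →L[𝕜] E}

/-- The trace as a continuous linear form on the operators of a finite-dimensional space. -/
def clmTrace (𝕜 E : Type*) [NontriviallyNormedField 𝕜] [CompleteSpace 𝕜] [NormedAddCommGroup E]
    [NormedSpace 𝕜 E] [FiniteDimensional 𝕜 E] : (E →L[𝕜] E) →L[𝕜] 𝕜 :=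
  LinearMap.toContinuousLinearMap (LinearMap.trace 𝕜 E ∘ₗ ContinuousLinearMap.coeLM 𝕜)

theorem clmTrace_apply (A : E →L[𝕜] E) : clmTrace 𝕜 E A = LinearMap.trace 𝕜 E A := rfl

theorem clmTrace_mul_comm (A B : E →L[𝕜] E) : clmTrace 𝕜 E (A * B) = clmTrace 𝕜 E (B * A) :=
  LinearMap.trace_mul_comm 𝕜 (A : E →ₗ[𝕜] E) B

theorem exists_det_one_add_smul_eq (A : E →L[𝕜] E) :
    ∃ p : 𝕜[X], ∀ t : 𝕜, (1 + t • A).det = 1 + clmTrace 𝕜 E A * t + p.eval t * t ^ 2 := by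
  let b := Module.finBasis 𝕜 E
  let M := LinearMap.toMatrix b b (A : E →ₗ[𝕜] E)
  have htoMatrix : ∀ t : 𝕜,
      LinearMap.toMatrix b b ((1 + t • A : E →L[𝕜] E) : E →ₗ[𝕜] E) = 1 + t • M := fun t => by
    rw [show ((1 + t • A : E →L[𝕜] E) : E →ₗ[𝕜] E) = LinearMap.id + t • (A : E →ₗ[𝕜] E) from rfl,
      map_add, map_smul, LinearMap.toMatrix_id]
  refine ⟨(1 + (X : 𝕜[X]) • M.map C).det.divX.divX, fun t => ?_⟩
  rw [ContinuousLinearMap.det, ← LinearMap.det_toMatrix b, htoMatrix, Matrix.det_one_add_smul,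
    clmTrace_apply, LinearMap.trace_eq_matrix_trace 𝕜 b]

theorem hasDerivAt_det_one_add_smul (A : E →L[𝕜] E) :
    HasDerivAt (fun t : 𝕜 => (1 + t • A).det) (clmTrace 𝕜 E A) 0 := by
  obtain ⟨p, hp⟩ := exists_det_one_add_smul_eq A
  rw [funext hp]
  refine ((((hasDerivAt_id (0 : 𝕜)).const_mul (clmTrace 𝕜 E A)).const_add 1).add
    ((p.hasDerivAt 0).mul ((hasDerivAt_id (0 : 𝕜)).pow 2))).congr_deriv ?_
  simp

theorem hasFDerivAt_det_one : HasFDerivAt (ContinuousLinearMap.det (R := 𝕜) (M := E))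
    (clmTrace 𝕜 E) 1 := by
  have hdet : DifferentiableAt 𝕜 (ContinuousLinearMap.det (R := 𝕜) (M := E)) 1 :=
    (contDiff_clm_det (n := 1)).differentiable one_ne_zero 1
  suffices h : fderiv 𝕜 ContinuousLinearMap.det (1 : E →L[𝕜] E) = clmTrace 𝕜 E from
    h ▸ hdet.hasFDerivAt
  refine ContinuousLinearMap.ext fun A => ?_
  have hline : HasDerivAt (fun t : 𝕜 => 1 + t • A) A 0 := by
    simpa only [one_smul] using ((hasDerivAt_id' (0 : 𝕜)).smul_const A).const_add (1 : E →L[𝕜] E)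
  have hone : (1 : E →L[𝕜] E) = 1 + (0 : 𝕜) • A := by rw [zero_smul, add_zero]
  have hcomp := HasFDerivAt.comp_hasDerivAt_of_eq (0 : 𝕜) hdet.hasFDerivAt hline hone
  exact hcomp.unique (hasDerivAt_det_one_add_smul A)

theorem hasFDerivAt_clm_det (hG : G * A = 1) : HasFDerivAt (ContinuousLinearMap.det (R := 𝕜))
    (A.det • clmTrace 𝕜 E ∘L ContinuousLinearMap.mul 𝕜 (E →L[𝕜] E) G) A := by
  have hdet : A.det * G.det = 1 := by
    rw [mul_comm, ← clm_det_mul, hG]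
    exact LinearMap.det_id
  have hfactor : ∀ B : E →L[𝕜] E, B.det = A.det * (G * B).det := fun B => by
    rw [clm_det_mul, ← mul_assoc, hdet, one_mul]
  have hcomp := HasFDerivAt.comp A (g := ContinuousLinearMap.det (R := 𝕜) (M := E))
    (by rw [ContinuousLinearMap.mul_apply', hG]; exact hasFDerivAt_det_one)
    (ContinuousLinearMap.mul 𝕜 (E →L[𝕜] E) G).hasFDerivAt
  exact (hcomp.const_mul A.det).congr_of_eventuallyEq (Eventually.of_forall hfactor)

end Jacobi

theorem hasDerivAt_log_norm {f : ℝ → ℂ} {f' : ℂ} {t : ℝ} (hf : HasDerivAt f f' t)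
    (h : f t ≠ 0) : HasDerivAt (fun s => Real.log ‖f s‖) (f' / f t).re t := by
  have hlog := (hf.div_const (f t)).clog_real (by rw [div_self h]; exact Complex.one_mem_slitPlane)
  rw [div_self h, div_one] at hlog
  refine ((Complex.reCLM.hasFDerivAt.comp_hasDerivAt t hlog).const_add
    (Real.log ‖f t‖)).congr_of_eventuallyEq ?_
  filter_upwards [hf.continuousAt.eventually_ne h] with s hs
  simp only [Function.comp_apply, Complex.reCLM_apply, Complex.log_re, norm_div]
  rw [Real.log_div (norm_ne_zero_iff.mpr hs) (norm_ne_zero_iff.mpr h), add_sub_cancel]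

theorem hasDerivAt_log_norm_det {E : Type*} [NormedAddCommGroup E] [NormedSpace ℂ E]
    [FiniteDimensional ℂ E] {F : ℝ → E →L[ℂ] E} {F' G : E →L[ℂ] E} {t : ℝ}
    (hF : HasDerivAt F F' t) (hG : G * F t = 1) (h : (F t).det ≠ 0) :
    HasDerivAt (fun s => Real.log ‖(F s).det‖) (clmTrace ℂ E (G * F')).re t := by
  have hdet := ((hasFDerivAt_clm_det hG).restrictScalars ℝ).comp_hasDerivAt t hF
  refine (hasDerivAt_log_norm hdet h).congr_deriv (congrArg Complex.re ?_)
  exact mul_div_cancel_left₀ _ h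

/-! ### The Kähler potential -/

section Exchange

theorem spectralProj_Ici_sub_Ioi {K A : Type*} [Field K] [LinearOrder K] [Ring A] [Algebra K A]
    {S : Finset K} {a : A} (l : K) :
    spectralProj S (Set.Ici l) a - spectralProj S (Set.Ioi l) a = spectralProj S {l} a := by
  rw [← spectralProj_diff Set.Ioi_subset_Ici_self, Set.Ici_sdiff_Ioi_same]

section Ring

variable {K A : Type*} [Field K] [LinearOrder K] [IsStrictOrderedRing K] [Ring A] [Algebra K A]
  {S : Finset K} {I : Set K} {a b τ : A}

theorem oppOp_mul_spectralProj_of_sameFiltration (ha : SplitsOn S a) (hb : SplitsOn S b)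
    (hI : IsUpperSet I) (hdis : Disjoint I (-I)) (hab : SameFiltration S a b)
    (hτ : τ * spectralProj S I b = spectralProj S (-I) b * τ) :
    oppOp S I τ a * spectralProj S I b = spectralProj S (-I) a * τ :=
  calc oppOp S I τ a * spectralProj S I b
      = oppOp S I τ a * spectralProj S I a * spectralProj S I b := by
        rw [mul_assoc, hab.mul_upper hI]
    _ = spectralProj S (-I) a * (τ * (spectralProj S I a * spectralProj S I b)) := by
        rw [ha.oppOp_mul_spectralProj hdis, mul_assoc, mul_assoc]
    _ = spectralProj S (-I) a * spectralProj S (-I) b * τ := by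
        rw [hab.mul_upper hI, hτ, mul_assoc]
    _ = spectralProj S (-I) a * τ := by rw [hab.mul_lower ha hb hI.neg]

theorem sum_pos_add_neg {M : Type*} [AddCommMonoid M] (hS : ∀ l ∈ S, -l ∈ S) {f : K → M}
    (hf : f 0 = 0) : ∑ l ∈ S with 0 < l, (f l + f (-l)) = ∑ l ∈ S, f l := by
  have hneg : ∑ l ∈ S with 0 < l, f (-l) = ∑ l ∈ S with ¬0 < l, f l := by
    have hzero : ∑ l ∈ S with ¬0 < l, f l = ∑ l ∈ S with l < 0, f l := by
      refine (Finset.sum_subset (fun l hl => ?_) fun l hl hlt => ?_).symm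
      · rw [Finset.mem_filter] at hl ⊢
        exact ⟨hl.1, hl.2.not_gt⟩
      · rw [Finset.mem_filter] at hl hlt
        rw [le_antisymm (not_lt.mp hl.2) (not_lt.mp fun h => hlt ⟨hl.1, h⟩), hf]
    rw [hzero]
    refine Finset.sum_nbij' (-·) (-·) (fun l hl => ?_) (fun l hl => ?_) (fun l _ => neg_neg l)
      (fun l _ => neg_neg l) fun _ _ => rfl <;> rw [Finset.mem_filter] at hl ⊢
    · exact ⟨hS l hl.1, neg_lt_zero.mpr hl.2⟩
    · exact ⟨hS l hl.1, neg_pos.mpr hl.2⟩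
  rw [Finset.sum_add_distrib, hneg, Finset.sum_filter_add_sum_filter_not]

theorem SplitsOn.sum_smul_spectralProj_sub (hS : ∀ l ∈ S, -l ∈ S) (ha : SplitsOn S a) :
    ∑ l ∈ S with 0 < l, l •
      ((spectralProj S (Set.Ici l) a - spectralProj S (-Set.Ici l) a) -
        (spectralProj S (Set.Ioi l) a - spectralProj S (-Set.Ioi l) a)) = a := by
  have hlower : ∀ l : K, spectralProj S (-Set.Ici l) a - spectralProj S (-Set.Ioi l) a =
      spectralProj S {-l} a := fun l => by
    rw [Set.neg_Ici, Set.neg_Ioi, ← spectralProj_diff Set.Iio_subset_Iic_self,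
      Set.Iic_sdiff_Iio_same]
  calc _ = ∑ l ∈ S with 0 < l, (l • spectralProj S {l} a + (-l) • spectralProj S {-l} a) :=
        Finset.sum_congr rfl fun l _ => by
          rw [sub_sub_sub_comm, spectralProj_Ici_sub_Ioi, hlower, smul_sub, neg_smul,
            sub_eq_add_neg]
    _ = ∑ l ∈ S, l • spectralProj S {l} a :=
        sum_pos_add_neg hS (f := fun l => l • spectralProj S {l} a) (zero_smul K _)
    _ = a := spectralCalc_eq_sum.symm.trans ha.spectralCalc_id

end Ring

theorem clmTrace_mul_exchange {E : Type*} [NormedAddCommGroup E] [NormedSpace ℂ E]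
    [FiniteDimensional ℂ E] {S : Finset ℝ} {I : Set ℝ} {T T₁ τ G : E →L[ℂ] E}
    (hT : SplitsOn S T) (hT₁ : SplitsOn S T₁) (hI : IsUpperSet I) (hdis : Disjoint I (-I))
    (hs : SameFiltration S T T₁) (hτ : τ * spectralProj S I T₁ = spectralProj S (-I) T₁ * τ)
    (hττ : τ * τ = 1) (hG : G * oppOp S I τ T = 1) (V : E →L[ℂ] E) :
    clmTrace ℂ E (G * (spectralProj S (-I) T * (τ * V - V * τ) * spectralProj S I T)) =
      clmTrace ℂ E (V * (spectralProj S I T₁ - spectralProj S (-I) T₁)) := by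
  set P := spectralProj S I T
  set Q := spectralProj S (-I) T
  set P₁ := spectralProj S I T₁
  set Q₁ := spectralProj S (-I) T₁
  have hGQτ : G * Q * τ = P₁ := by
    rw [mul_assoc, ← oppOp_mul_spectralProj_of_sameFiltration hT hT₁ hI hdis hs hτ, ← mul_assoc,
      hG, one_mul]
  have hGQ : G * Q = P₁ * τ := by rw [← hGQτ, mul_assoc, hττ, mul_one]
  have hPP₁ : P * P₁ = P₁ := hs.mul_upper hI
  have hfst : clmTrace ℂ E (G * Q * τ * V * P) = clmTrace ℂ E (V * P₁) := by
    rw [hGQτ, clmTrace_mul_comm, ← mul_assoc, hPP₁, clmTrace_mul_comm]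
  have hsnd : clmTrace ℂ E (G * Q * V * τ * P) = clmTrace ℂ E (V * Q₁) := by
    have hcycle : τ * P * (P₁ * τ) = Q₁ := by
      rw [mul_assoc, ← mul_assoc P, hPP₁, ← mul_assoc, hτ, mul_assoc, hττ, mul_one]
    rw [hGQ, mul_assoc, mul_assoc, clmTrace_mul_comm, mul_assoc, hcycle]
  rw [mul_sub V, map_sub, ← hfst, ← hsnd, ← map_sub]
  simp only [mul_sub, sub_mul, mul_assoc]

section Adjoint

variable {L : Type*} [NormedLieRing L] [NormedLieAlgebra ℂ L] [FiniteDimensional ℂ L]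
  {S : Finset ℝ} {I : Set ℝ} {τ : L →L[ℂ] L}

theorem clmTrace_adC_mul_adC (u v : L) : clmTrace ℂ L (adC u * adC v) = killingForm ℂ L u v :=
  (killingForm_apply_apply ℂ L u v).symm

theorem killingForm_eq_sum (hS : ∀ l ∈ S, -l ∈ S) {s : L} (hs : SplitsOn S (adC s)) (v : L) :
    killingForm ℂ L v s = ∑ l ∈ S with 0 < l, (l : ℂ) *
      (clmTrace ℂ L (adC v * (spectralProj S (Set.Ici l) (adC s) -
          spectralProj S (-Set.Ici l) (adC s))) -
        clmTrace ℂ L (adC v * (spectralProj S (Set.Ioi l) (adC s) -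
          spectralProj S (-Set.Ioi l) (adC s)))) := by
  conv_lhs => rw [← clmTrace_adC_mul_adC, ← hs.sum_smul_spectralProj_sub hS]
  rw [Finset.mul_sum, map_sum]
  refine Finset.sum_congr rfl fun l _ => ?_
  rw [← Complex.coe_smul, mul_smul_comm, map_smul, smul_eq_mul, mul_sub, map_sub]

theorem oppDet_expAd (w z : L) :
    oppDet S I τ (expAd w z) = oppDet S I (expAd (-w) * τ * expAd w) z :=
  (clm_det_eq_of_semiconj (expEquiv w) fun u => map_oppOp_apply (T := adC z)
    (T' := adC (expAd w z)) ((expEquiv w).toLinearEquiv.toLinearMap.restrictScalars ℝ)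
    (isAut_expEquiv w z) (fun v => expAd_apply_neg w (τ (expAd w v))) u).symm

theorem hasDerivAt_expAd_conj (τ : L →L[ℂ] L) (v : L) :
    HasDerivAt (fun t : ℝ => expAd (-((t : ℂ) • v)) * τ * expAd ((t : ℂ) • v))
      (τ * adC v - adC v * τ) 0 := by
  have hexp : ∀ w : L, HasDerivAt (fun t : ℝ => expAd ((t : ℂ) • w)) (adC w) 0 := fun w => by
    refine ((hasDerivAt_expAd w _).scomp (0 : ℝ) Complex.ofRealCLM.hasDerivAt).congr_deriv ?_
    rw [Complex.ofRealCLM_apply, Complex.ofReal_one, one_smul, map_zero, zero_smul, expAd_zero,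
      mul_one]
  have hneg := hexp (-v)
  simp only [smul_neg, map_neg] at hneg
  refine ((hneg.mul_const τ).mul (hexp v)).congr_deriv ?_
  rw [Complex.ofReal_zero, zero_smul, neg_zero, expAd_zero, mul_one, one_mul, neg_mul,
    neg_add_eq_sub]

theorem hasDerivAt_log_oppDet {y s s' : L} (hS : ∀ l ∈ S, -l ∈ S) (hy : SplitsOn S (adC y))
    (hs : SplitsOn S (adC s)) (hs' : SplitsOn S (adC s')) (hI : IsUpperSet I)
    (hdis : Disjoint I (-I)) (hys : SameFiltration S (adC y) (adC s))
    (hys' : SameFiltration S (-adC y) (adC s'))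
    (hτs : τ * spectralProj S I (adC s) = spectralProj S (-I) (adC s) * τ)
    (hτs' : τ * spectralProj S I (adC s') = spectralProj S (-I) (adC s') * τ) (hττ : τ * τ = 1)
    (hne : oppDet S I τ y ≠ 0) (v : L) :
    HasDerivAt (fun t : ℝ => Real.log ‖oppDet S I τ (expAd ((t : ℂ) • v) y)‖)
      (clmTrace ℂ L (adC v * (spectralProj S I (adC s) - spectralProj S (-I) (adC s))) +
        clmTrace ℂ L (adC v * (spectralProj S I (adC s') - spectralProj S (-I) (adC s')))).re
      0 := by
  have hG := Ring.inverse_mul_cancel _ (isUnit_oppOp_adC hne)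
  have hfst := clmTrace_mul_exchange hy hs hI hdis hys hτs hττ hG (adC v)
  have hsnd := clmTrace_mul_exchange (hy.neg hS) hs' hI hdis hys' hτs' hττ
    (by rwa [hy.oppOp_neg_right hS]) (adC v)
  rw [hy.spectralProj_neg hS, hy.spectralProj_neg hS, neg_neg] at hsnd
  have hconj := hasDerivAt_expAd_conj τ v
  have hopp : HasDerivAt (fun t : ℝ =>
      oppOp S I (expAd (-((t : ℂ) • v)) * τ * expAd ((t : ℂ) • v)) (adC y)) _ 0 :=
    (((hconj.const_mul (spectralProj S (-I) (adC y))).mul_const _).add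
      ((hconj.const_mul (spectralProj S I (adC y))).mul_const _)).add_const _
  have hzero : expAd (-(((0 : ℝ) : ℂ) • v)) * τ * expAd (((0 : ℝ) : ℂ) • v) = τ := by
    rw [Complex.ofReal_zero, zero_smul, neg_zero, expAd_zero, mul_one, one_mul]
  have hlog := hasDerivAt_log_norm_det hopp (by rw [hzero]; exact hG) (by rw [hzero]; exact hne)
  rw [mul_add, map_add, hfst, hsnd] at hlog
  exact hlog.congr_of_eventuallyEq (Eventually.of_forall fun t =>
    congrArg (fun z => Real.log ‖z‖) (oppDet_expAd _ _))

end Adjoint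

end Exchange

section Potential

variable {L : Type*} [NormedLieRing L] [NormedLieAlgebra ℂ L] [FiniteDimensional ℂ L]
  {θ σ : L →ₛₗ[starRingEnd ℂ] L} {x : L}

/-- The Kähler potential up to an additive constant. Each summand is the logarithm of the absolute
value of a polynomial that vanishes only outside `X*`. -/
def rawPotential (θ σ : L →ₛₗ[starRingEnd ℂ] L) (x y : L) : ℝ :=
  -∑ l ∈ realSpectrum x with 0 < l, l *
    (Real.log ‖oppDet (realSpectrum x) (Set.Ici l) (tau θ σ) y‖ -
      Real.log ‖oppDet (realSpectrum x) (Set.Ioi l) (tau θ σ) y‖)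

/-- The Kähler potential `h` of the theorem, normalized by `h(x) = 0`. -/
def potential (θ σ : L →ₛₗ[starRingEnd ℂ] L) (x y : L) : ℝ :=
  rawPotential θ σ x y - rawPotential θ σ x x

theorem potential_base : potential θ σ x x = 0 := sub_self _

namespace SphericalData

theorem tau_mul_spectralProj (D : SphericalData θ σ x) {s : L}
    (hs : SplitsOn (realSpectrum x) (adC s)) (h : tau θ σ s = -s) (I : Set ℝ) :
    tau θ σ * spectralProj (realSpectrum x) I (adC s) =
      spectralProj (realSpectrum x) (-I) (adC s) * tau θ σ := by
  ext u
  rw [clm_mul_apply, clm_mul_apply, D.spectralProj_tau hs h, neg_neg]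

theorem splitsOn_of_mem_sphericalOrbit (D : SphericalData θ σ x) {s : L}
    (hs : s ∈ sphericalOrbit θ σ x) : SplitsOn (realSpectrum x) (adC s) := by
  obtain ⟨k, hk, rfl⟩ := hs
  exact D.splitsOn (apply_mem_complexOrbit hk (mem_complexOrbit_self x))

theorem oppDet_ne_zero (D : SphericalData θ σ x) {y s : L} (hy : y ∈ compactOrbit θ x)
    (hs : s ∈ sphericalOrbit θ σ x) (hys : SameFiltration (realSpectrum x) (adC y) (adC s))
    {I : Set ℝ} (hI : IsUpperSet I) (hpos : ∀ t ∈ I, 0 < t) :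
    oppDet (realSpectrum x) I (tau θ σ) y ≠ 0 := by
  have hyS := D.splitsOn (compactOrbit_subset hy)
  have hsS := D.splitsOn_of_mem_sphericalOrbit hs
  have hopp : IsOpp (realSpectrum x) I (tau θ σ) (adC y) :=
    (D.isOpp_of_tau hsS (D.tau_of_mem_sphericalOrbit hs) I).of_sameFiltration hsS hyS hI hys.symm
  rw [oppDet_ne_zero_iff hyS (disjoint_neg_of_pos hpos), ← D.isOpp_adC_neg_conj_iff hyS,
    D.conj_eq_neg hy, neg_neg]
  exact ⟨hopp, hopp⟩

theorem hasDerivAt_log_oppDet (D : SphericalData θ σ x) {y s : L} (hy : y ∈ compactOrbit θ x)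
    (hs : s ∈ sphericalOrbit θ σ x) (hys : SameFiltration (realSpectrum x) (adC y) (adC s))
    {I : Set ℝ} (hI : IsUpperSet I) (hpos : ∀ t ∈ I, 0 < t) (v : L) :
    HasDerivAt (fun t : ℝ =>
        Real.log ‖oppDet (realSpectrum x) I (tau θ σ) (expAd ((t : ℂ) • v) y)‖)
      (clmTrace ℂ L (adC v * (spectralProj (realSpectrum x) I (adC s) -
          spectralProj (realSpectrum x) (-I) (adC s))) +
        clmTrace ℂ L (adC v * (spectralProj (realSpectrum x) I (adC (θ s)) -
          spectralProj (realSpectrum x) (-I) (adC (θ s))))).re 0 := by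
  have hyS := D.splitsOn (compactOrbit_subset hy)
  have hsS := D.splitsOn_of_mem_sphericalOrbit hs
  have hτs := D.tau_of_mem_sphericalOrbit hs
  have hconj : ∀ z u : L, θ (adC z u) = adC (θ z) (θ u) := fun z u => D.compact.map_lie z u
  have hsurj : Function.Surjective θ := Function.Involutive.surjective D.compact.involutive
  have hθsS : SplitsOn (realSpectrum x) (adC (θ s)) :=
    hsS.of_surjective (conjR θ : L →ₗ[ℝ] L) hsurj (hconj s)
  have hτθs : tau θ σ (θ s) = -θ s := by rw [← D.conj_tau, hτs, map_neg]
  have hθys : SameFiltration (realSpectrum x) (-adC y) (adC (θ s)) := by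
    rw [← map_neg, ← D.conj_eq_neg hy]
    exact hys.of_surjective (conjR θ : L →ₗ[ℝ] L) hsurj (hconj y) (hconj s)
  exact HyperbolicOrbit.hasDerivAt_log_oppDet D.neg_mem hyS hsS hθsS hI
    (disjoint_neg_of_pos hpos) hys hθys (D.tau_mul_spectralProj hsS hτs I)
    (D.tau_mul_spectralProj hθsS hτθs I) (ContinuousLinearMap.ext D.tau_tau)
    (D.oppDet_ne_zero hy hs hys hI hpos) v

theorem hasDerivAt_rawPotential (D : SphericalData θ σ x) {y s : L} (hy : y ∈ compactOrbit θ x)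
    (hs : s ∈ sphericalOrbit θ σ x) (hys : SameFiltration (realSpectrum x) (adC y) (adC s))
    (v : L) :
    HasDerivAt (fun t : ℝ => rawPotential θ σ x (expAd ((t : ℂ) • v) y))
      (-(killingForm ℂ L v s + killingForm ℂ L v (θ s)).re) 0 := by
  have hsS := D.splitsOn_of_mem_sphericalOrbit hs
  have hθsS : SplitsOn (realSpectrum x) (adC (θ s)) :=
    hsS.of_surjective (conjR θ : L →ₗ[ℝ] L)
      (Function.Involutive.surjective D.compact.involutive) fun u => D.compact.map_lie s u
  have hsum := HasDerivAt.fun_sum (u := {l ∈ realSpectrum x | 0 < l}) fun l hl =>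
    ((D.hasDerivAt_log_oppDet hy hs hys (isUpperSet_Ici l)
      (fun t ht => (Finset.mem_filter.mp hl).2.trans_le ht) v).sub
    (D.hasDerivAt_log_oppDet hy hs hys (isUpperSet_Ioi l)
      (fun t ht => (Finset.mem_filter.mp hl).2.trans ht) v)).const_mul l
  refine hsum.neg.congr_deriv (congrArg Neg.neg ?_)
  rw [killingForm_eq_sum D.neg_mem hsS, killingForm_eq_sum D.neg_mem hθsS,
    ← Finset.sum_add_distrib, Complex.re_sum]
  refine Finset.sum_congr rfl fun l _ => ?_
  simp only [← mul_add, Complex.re_ofReal_mul, Complex.sub_re, Complex.add_re]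
  ring

theorem contDiffAt_rawPotential (D : SphericalData θ σ x) {y s : L} (hy : y ∈ compactOrbit θ x)
    (hs : s ∈ sphericalOrbit θ σ x) (hys : SameFiltration (realSpectrum x) (adC y) (adC s))
    {n : WithTop ℕ∞} : ContDiffAt ℝ n (rawPotential θ σ x) y := by
  have hlog : ∀ I : Set ℝ, IsUpperSet I → (∀ t ∈ I, 0 < t) →
      ContDiffAt ℝ n (fun y => Real.log ‖oppDet (realSpectrum x) I (tau θ σ) y‖) y :=
    fun I hI hpos => by
      have hne := D.oppDet_ne_zero hy hs hys hI hpos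
      have hdet := (contDiff_oppDet (realSpectrum x) I (tau θ σ) (n := n)).restrict_scalars ℝ
      exact (hdet.contDiffAt.norm ℝ hne).log (norm_ne_zero_iff.mpr hne)
  refine ContDiffAt.neg (ContDiffAt.sum fun l hl => contDiffAt_const.mul ?_)
  exact (hlog _ (isUpperSet_Ici l) fun t ht => (Finset.mem_filter.mp hl).2.trans_le ht).sub
    (hlog _ (isUpperSet_Ioi l) fun t ht => (Finset.mem_filter.mp hl).2.trans ht)

theorem add_sectionVec_mem_iwasawaFiber (D : SphericalData θ σ x) {y : L}
    (hy : y ∈ openOrbit θ σ x) : y + sectionVec θ σ x y ∈ iwasawaFiber y := by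
  have hyX := D.mem_openOrbit.mp hy
  have hyS := D.splitsOn (compactOrbit_subset hyX.1)
  change y + sectionVec θ σ x y - y ∈ nilradical y
  rw [add_sub_cancel_left, mem_nilradical_iff hyS]
  exact spectralProj_oppVec hyS disjoint_Ioi_zero hyX.2

theorem sameFiltration_add_sectionVec (D : SphericalData θ σ x) {y : L}
    (hy : y ∈ openOrbit θ σ x) :
    SameFiltration (realSpectrum x) (adC y) (adC (y + sectionVec θ σ x y)) :=
  sameFiltration_of_mem_iwasawaFiber (D.splitsOn (compactOrbit_subset (D.mem_openOrbit.mp hy).1))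
    (D.splitsOn_of_mem_sphericalOrbit (D.add_sectionVec_mem hy))
    (D.add_sectionVec_mem_iwasawaFiber hy)

theorem contDiffAt_potential (D : SphericalData θ σ x) {y : L} (hy : y ∈ openOrbit θ σ x)
    {n : WithTop ℕ∞} : ContDiffAt ℝ n (potential θ σ x) y :=
  (D.contDiffAt_rawPotential (D.mem_openOrbit.mp hy).1 (D.add_sectionVec_mem hy)
    (D.sameFiltration_add_sectionVec hy)).sub contDiffAt_const

theorem re_killingForm_eq_zero (D : SphericalData θ σ x) {y v : L} (hy : y ∈ compactOrbit θ x)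
    (hv : θ v = v) : (killingForm ℂ L y v).re = 0 := by
  have hconj := congrArg Complex.re (D.compact.killingForm_conj y v)
  rw [D.conj_eq_neg hy, hv, map_neg, LinearMap.neg_apply, Complex.neg_re, Complex.conj_re] at hconj
  linarith

theorem hasDerivAt_potential (D : SphericalData θ σ x) {y : L} (hy : y ∈ openOrbit θ σ x) {v : L}
    (hv : θ v = v) : HasDerivAt (fun t : ℝ => potential θ σ x (expAd ((t : ℂ) • v) y))
      (2 * (killingForm ℂ L (y - (y + sectionVec θ σ x y)) v).re) 0 := by
  have hyX := (D.mem_openOrbit.mp hy).1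
  refine ((D.hasDerivAt_rawPotential hyX (D.add_sectionVec_mem hy)
    (D.sameFiltration_add_sectionVec hy) v).sub_const _).congr_deriv ?_
  have hconj := D.compact.killingForm_conj v (y + sectionVec θ σ x y)
  rw [hv] at hconj
  rw [hconj, killingForm_comm v, map_sub, LinearMap.sub_apply, Complex.sub_re, Complex.add_re,
    Complex.conj_re, D.re_killingForm_eq_zero hyX hv]
  ring

end SphericalData

end Potential

section IwasawaProjection

section Ring

variable {A : Type*} [Ring A] [Algebra ℝ A] {S : Finset ℝ} {a b c : A} {I : Set ℝ}

/-- The idempotent with the range of `spectralProj S I a` and the kernel of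
`spectralProj S (-I) b`, where these two are close to each other (and `0` where they are so far
apart that the inverse does not exist). -/
def obliqueProj (S : Finset ℝ) (I : Set ℝ) (a b : A) : A :=
  spectralProj S I a * Ring.inverse (1 + spectralProj S I a - spectralProj S (-I) b)

theorem obliqueProj_eq (hS : ∀ l ∈ S, -l ∈ S) (hb : SplitsOn S b) (hc : SplitsOn S c)
    (hac : SameFiltration S a c) (hbc : SameFiltration S b (-c)) (hI : IsUpperSet I)
    (h : IsUnit (1 + spectralProj S I a - spectralProj S (-I) b)) :
    obliqueProj S I a b = spectralProj S I c := by
  have hlower := hbc.symm.mul_lower (hc.neg hS) hb (I := -I) fun s t hst hs =>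
    hI (neg_le_neg hst) hs
  rw [hc.spectralProj_neg hS, neg_neg] at hlower
  have hfactor : spectralProj S I a =
      spectralProj S I c * (1 + spectralProj S I a - spectralProj S (-I) b) := by
    rw [mul_sub, mul_add, hac.symm.mul_upper hI, hlower, mul_one, add_sub_cancel_left]
  rw [obliqueProj]
  nth_rw 1 [hfactor]
  rw [mul_assoc, Ring.mul_inverse_cancel _ h, mul_one]

end Ring

variable {L : Type*} [NormedLieRing L] [NormedLieAlgebra ℂ L] [FiniteDimensional ℂ L]
  {S : Finset ℝ} {θ : L →ₛₗ[starRingEnd ℂ] L} {x : L}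

/-! ### Smoothness of the Iwasawa projection -/

theorem contDiff_spectralProj_sub_conj (θ : L →ₛₗ[starRingEnd ℂ] L) (S : Finset ℝ) (I : Set ℝ)
    {n : WithTop ℕ∞} : ContDiff ℝ n fun z : L =>
      1 + spectralProj S I (adC z) - spectralProj S (-I) (adC (θ z)) := by
  have hproj (J : Set ℝ) := (contDiff_spectralProj_adC (L := L) S J (n := n)).restrict_scalars ℝ
  exact (contDiff_const.add (hproj I)).sub ((hproj (-I)).comp (conjR θ).contDiff)

theorem spectralProj_sub_conj_eq_one (hS : ∀ l ∈ S, -l ∈ S) {y : L} (hy : SplitsOn S (adC y))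
    (hθy : θ y = -y) (I : Set ℝ) :
    1 + spectralProj S I (adC y) - spectralProj S (-I) (adC (θ y)) = 1 := by
  rw [hθy, map_neg, hy.spectralProj_neg hS, neg_neg, add_sub_cancel_right]

theorem contDiffAt_obliqueProj (hS : ∀ l ∈ S, -l ∈ S) {y : L} (hy : SplitsOn S (adC y))
    (hθy : θ y = -y) (I : Set ℝ) {n : WithTop ℕ∞} :
    ContDiffAt ℝ n (fun z : L => obliqueProj S I (adC z) (adC (θ z))) y := by
  have hinv := contDiffAt_ringInverse ℝ (n := n) (1 : (L →L[ℂ] L)ˣ)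
  rw [Units.val_one, ← spectralProj_sub_conj_eq_one hS hy hθy I] at hinv
  exact ((contDiff_spectralProj_adC S I).restrict_scalars ℝ).contDiffAt.mul
    (hinv.comp y (contDiff_spectralProj_sub_conj θ S I).contDiffAt)

theorem eventually_isUnit_spectralProj_sub_conj (hS : ∀ l ∈ S, -l ∈ S) {y : L}
    (hy : SplitsOn S (adC y)) (hθy : θ y = -y) (I : Set ℝ) :
    ∀ᶠ z in 𝓝 y, IsUnit (1 + spectralProj S I (adC z) - spectralProj S (-I) (adC (θ z))) := by
  refine (contDiff_spectralProj_sub_conj θ S I (n := 0)).continuous.continuousAt.eventually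
    (p := fun T => IsUnit T) (Units.isOpen.eventually_mem ?_)
  change IsUnit (1 + spectralProj S I (adC y) - spectralProj S (-I) (adC (θ y)))
  rw [spectralProj_sub_conj_eq_one hS hy hθy]
  exact isUnit_one

theorem obliqueProj_adC_conj_eq (hθ : IsCompactConjugation θ) (hx : θ x = -x) {z : L}
    (hz : z ∈ complexOrbit x) {I : Set ℝ} (hI : IsUpperSet I)
    (h : IsUnit (1 + spectralProj (realSpectrum x) I (adC z) -
      spectralProj (realSpectrum x) (-I) (adC (θ z)))) :
    obliqueProj (realSpectrum x) I (adC z) (adC (θ z)) =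
      spectralProj (realSpectrum x) I (adC (iwasawaProj θ x z)) := by
  have hsurj : Function.Surjective θ := Function.Involutive.surjective hθ.involutive
  have hzS := splitsOn_of_mem_complexOrbit hθ hx hz
  have hyX := iwasawaProj_mem hθ hx hz
  have hfil := (sameFiltration_iwasawaProj hθ hx hz).symm
  have hθfil := hfil.of_surjective (conjR θ : L →ₗ[ℝ] L) hsurj (hθ.map_lie z)
    (hθ.map_lie (iwasawaProj θ x z)) (T' := adC (θ z)) (T₁' := adC (θ (iwasawaProj θ x z)))
  rw [conj_eq_neg_of_mem hθ.toIsConjugation hx hyX, map_neg] at hθfil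
  exact obliqueProj_eq (fun _ => neg_mem_realSpectrum hθ.toIsConjugation hx)
    (hzS.of_surjective (conjR θ : L →ₗ[ℝ] L) hsurj (hθ.map_lie z))
    (splitsOn_of_mem_complexOrbit hθ hx (compactOrbit_subset hyX)) hfil hθfil hI h

/-- The sum of the oblique projections of the spectral filtrations of `adC z` and `adC (θ z)`,
weighted by the elements of `S`. Near a point of the compact orbit it is the operator `adC` of the
Iwasawa projection of `z`. -/
def obliqueAd (S : Finset ℝ) (θ : L →ₛₗ[starRingEnd ℂ] L) (z : L) : L →L[ℂ] L :=
  ∑ l ∈ S, l • (obliqueProj S (Set.Ici l) (adC z) (adC (θ z)) -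
    obliqueProj S (Set.Ioi l) (adC z) (adC (θ z)))

theorem eventually_adC_iwasawaProj_eq (hθ : IsCompactConjugation θ) (hx : θ x = -x) {y : L}
    (hy : y ∈ compactOrbit θ x) : ∀ᶠ z in 𝓝[complexOrbit x] y,
      adC (iwasawaProj θ x z) = obliqueAd (realSpectrum x) θ z := by
  have hunit (I : ℝ → Set ℝ) : ∀ᶠ z in 𝓝[complexOrbit x] y, ∀ l ∈ realSpectrum x,
      IsUnit (1 + spectralProj (realSpectrum x) (I l) (adC z) -
        spectralProj (realSpectrum x) (-I l) (adC (θ z))) :=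
    (Filter.eventually_all_finset _).mpr fun l _ => eventually_nhdsWithin_of_eventually_nhds <|
      eventually_isUnit_spectralProj_sub_conj
        (fun _ => neg_mem_realSpectrum hθ.toIsConjugation hx)
        (splitsOn_of_mem_complexOrbit hθ hx (compactOrbit_subset hy))
        (conj_eq_neg_of_mem hθ.toIsConjugation hx hy) _
  filter_upwards [hunit Set.Ici, hunit Set.Ioi, eventually_mem_nhdsWithin] with z hIci hIoi hz
  have hprojS := splitsOn_of_mem_complexOrbit hθ hx
    (compactOrbit_subset (iwasawaProj_mem hθ hx hz))
  nth_rw 1 [← hprojS.spectralCalc_id, spectralCalc_eq_sum]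
  refine Finset.sum_congr rfl fun l hl => ?_
  rw [obliqueProj_adC_conj_eq hθ hx hz (isUpperSet_Ici l) (hIci l hl),
    obliqueProj_adC_conj_eq hθ hx hz (isUpperSet_Ioi l) (hIoi l hl), spectralProj_Ici_sub_Ioi, id]

theorem contDiffWithinAt_iwasawaProj (hθ : IsCompactConjugation θ) (hx : θ x = -x) {y : L}
    (hy : y ∈ compactOrbit θ x) {n : WithTop ℕ∞} :
    ContDiffWithinAt ℝ n (iwasawaProj θ x) (complexOrbit x) y := by
  obtain ⟨f, hf⟩ := (adC (L := L)).toLinearMap.exists_leftInverse_of_injective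
    (LinearMap.ker_eq_bot.mpr hθ.adC_injective)
  let F : (L →L[ℂ] L) →L[ℂ] L := LinearMap.toContinuousLinearMap f
  have hF (z : L) : F (adC z) = z := congrArg (fun T : L →ₗ[ℂ] L => T z) hf
  have hsmooth : ContDiffAt ℝ n (obliqueAd (realSpectrum x) θ) y := by
    have hproj (I : Set ℝ) := contDiffAt_obliqueProj
      (fun _ => neg_mem_realSpectrum hθ.toIsConjugation hx)
      (splitsOn_of_mem_complexOrbit hθ hx (compactOrbit_subset hy))
      (conj_eq_neg_of_mem hθ.toIsConjugation hx hy) I (n := n)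
    exact ContDiffAt.sum fun l _ => ((hproj _).sub (hproj _)).const_smul l
  have heq : iwasawaProj θ x =ᶠ[𝓝[complexOrbit x] y]
      fun z => F (obliqueAd (realSpectrum x) θ z) :=
    (eventually_adC_iwasawaProj_eq hθ hx hy).mono fun _ hz => (hF _).symm.trans (congrArg F hz)
  exact ((F.restrictScalars ℝ).contDiff.contDiffAt.comp y hsmooth).contDiffWithinAt
    |>.congr_of_eventuallyEq heq (heq.self_of_nhdsWithin (compactOrbit_subset hy))

end IwasawaProjection

section Parabolic

variable {L : Type*} [NormedLieRing L] [NormedLieAlgebra ℂ L] [FiniteDimensional ℂ L]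
  {S : Finset ℝ}

/-! ### The parabolic subalgebra -/

theorem spectralProj_adC_lie_of_add_mem {y : L} (hy : SplitsOn S (adC y)) {I J K : Set ℝ}
    (h : ∀ l ∈ I, ∀ m ∈ J, l + m ∈ K) {a b : L} (ha : spectralProj S I (adC y) a = a)
    (hb : spectralProj S J (adC y) b = b) : spectralProj S K (adC y) ⁅a, b⁆ = ⁅a, b⁆ := by
  rw [← ha, ← hb]
  set b' := spectralProj S J (adC y) b
  refine hy.spectralProj_induction (p := fun a => spectralProj S K (adC y) ⁅a, b'⁆ = ⁅a, b'⁆)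
    (by rw [zero_lie, map_zero]) (fun v w hv hw => ?_) (fun l hl v hv => ?_) a
  · rw [add_lie, map_add, hv, hw]
  refine hy.spectralProj_induction (p := fun b => spectralProj S K (adC y) ⁅v, b⁆ = ⁅v, b⁆)
    (by rw [lie_zero, map_zero]) (fun w w' hw hw' => ?_) (fun m hm w hw => ?_) b
  · rw [lie_add, map_add, hw, hw']
  exact hy.spectralProj_apply_of_mem (lie_lie_of_eq_smul hv hw) (h l hl m hm)

theorem killingForm_eq_zero_of_spectralProj {y : L} (hy : SplitsOn S (adC y)) {I J : Set ℝ}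
    (h : ∀ l ∈ I, ∀ m ∈ J, l + m ≠ 0) {a b : L} (ha : spectralProj S I (adC y) a = a)
    (hb : spectralProj S J (adC y) b = b) : killingForm ℂ L a b = 0 := by
  rw [← ha, ← hb]
  set b' := spectralProj S J (adC y) b
  refine hy.spectralProj_induction (p := fun a => killingForm ℂ L a b' = 0)
    (by rw [map_zero, LinearMap.zero_apply]) (fun v w hv hw => ?_) (fun l hl v hv => ?_) a
  · rw [map_add, LinearMap.add_apply, hv, hw, add_zero]
  refine hy.spectralProj_induction (p := fun b => killingForm ℂ L v b = 0) (map_zero _)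
    (fun w w' hw hw' => ?_) (fun m hm w hw => ?_) b
  · rw [map_add, hw, hw', add_zero]
  exact killingForm_eq_zero_of_lie_eq_smul hv hw (h l hl m hm)

theorem killingForm_eq_zero_of_mem_parabolic {y n p : L} (hy : SplitsOn S (adC y))
    (hn : spectralProj S (Set.Ioi 0) (adC y) n = n)
    (hp : spectralProj S (Set.Iio 0) (adC y) p = 0) : killingForm ℂ L n p = 0 :=
  killingForm_eq_zero_of_spectralProj hy
    (fun _ hl _ hm => (add_pos_of_pos_of_nonneg hl (not_lt.mp hm)).ne') hn
    (hy.spectralProj_compl_apply hp)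

theorem expAd_mem_of_lie_mem {W : Submodule ℂ L} {u : L} (h : ∀ a ∈ W, ⁅u, a⁆ ∈ W) {a : L}
    (ha : a ∈ W) : expAd u a ∈ W := by
  let _ : NormedAlgebra ℚ (L →L[ℂ] L) := .restrictScalars ℚ ℂ _
  have hpow (k : ℕ) : (adC u ^ k) a ∈ W := by
    induction k with
    | zero => exact ha
    | succ k ih =>
      rw [pow_succ']
      exact h _ ih
  exact (Submodule.closed_of_finiteDimensional W).mem_of_tendsto
    ((NormedSpace.exp_series_hasSum_exp' (𝕂 := ℂ) (adC u)).mapL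
      (ContinuousLinearMap.apply ℂ L a))
    (Eventually.of_forall fun s => W.sum_mem fun k _ => W.smul_mem _ (hpow k))

theorem sameFiltration_expAd {y p : L} (hy : SplitsOn S (adC y))
    (hp : spectralProj S (Set.Iio 0) (adC y) p = 0) :
    SameFiltration S (adC y) (adC (expAd p y)) := by
  intro I hI
  have hexp : ∀ q, spectralProj S (Set.Iio 0) (adC y) q = 0 → ∀ a,
      spectralProj S I (adC y) (expAd q (spectralProj S I (adC y) a)) =
        expAd q (spectralProj S I (adC y) a) := fun q hq a => by
    refine expAd_mem_of_lie_mem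
      (W := LinearMap.eqLocus (spectralProj S I (adC y)).toLinearMap LinearMap.id)
      (fun b hb => ?_) (congrArg (fun T : L →L[ℂ] L => T a) (hy.spectralProj_mul_self I))
    exact spectralProj_adC_lie_of_add_mem hy
      (fun l hl m hm => hI (le_add_of_nonneg_left (not_lt.mp hl)) hm)
      (hy.spectralProj_compl_apply hq) hb
  have hconj (u : L) : spectralProj S I (adC (expAd p y)) u =
      expAd p (spectralProj S I (adC y) (expAd (-p) u)) := by
    nth_rw 1 [← expAd_apply_neg p u]
    exact spectralProj_adC_apply_map (isAut_expEquiv p) I y _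
  constructor <;> ext u <;> rw [clm_mul_apply, hconj]
  · exact hexp p hp _
  · rw [hexp (-p) (by rw [map_neg, hp, neg_zero]), expAd_apply_neg]

theorem IsJ.spectralProj_eq_zero {y v v' : L} (hy : SplitsOn S (adC y)) (h : IsJ y v v') :
    spectralProj S (Set.Iio 0) (adC y) (Complex.I • v - v') = 0 := by
  have hnil : ⁅y, Complex.I • v - v'⁆ ∈ nilradical y := by
    rw [← lie_skew, ← neg_lie, neg_sub, sub_lie, smul_lie]
    exact h
  have hlie : ⁅y, spectralProj S (Set.Iio 0) (adC y) (Complex.I • v - v')⁆ = (0 : ℝ) •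
      spectralProj S (Set.Iio 0) (adC y) (Complex.I • v - v') := by
    rw [← spectralProj_adC_lie, ← (mem_nilradical_iff hy).mp hnil, ← clm_mul_apply,
      hy.spectralProj_mul_of_disjoint (Set.Ioi_disjoint_Iio_of_le le_rfl).symm, zero_smul]
    rfl
  have hzero := hy.spectralProj_apply_of_notMem hlie Set.self_notMem_Iio
  rwa [← clm_mul_apply, hy.spectralProj_mul_self] at hzero

end Parabolic

section OneParameter

variable {L : Type*} [NormedLieRing L] [NormedLieAlgebra ℂ L] [FiniteDimensional ℂ L]
  {θ σ : L →ₛₗ[starRingEnd ℂ] L} {x : L}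

/-! ### Derivatives along one-parameter groups -/

theorem contDiff_expAd_apply (u z : L) {n : WithTop ℕ∞} :
    ContDiff ℂ n (fun t : ℂ => expAd (t • u) z) :=
  Differentiable.contDiff fun t => (hasDerivAt_expAd_apply u z t).differentiableAt

theorem hasDerivAt_expAd_apply_real (u z : L) :
    HasDerivAt (fun t : ℝ => expAd ((t : ℂ) • u) z) ⁅u, z⁆ 0 :=
  ((hasDerivAt_expAd_apply u z ((0 : ℝ) : ℂ)).scomp (0 : ℝ)
    Complex.ofRealCLM.hasDerivAt).congr_deriv (by simp)

theorem expAd_mem_complexOrbit {z : L} (hz : z ∈ complexOrbit x) (u : L) :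
    expAd u z ∈ complexOrbit x :=
  apply_mem_complexOrbit (expEquiv_mem (Set.mem_univ u)) hz

theorem iwasawaProj_expAd_iwasawaProj (hθ : IsCompactConjugation θ) (hx : θ x = -x) {z : L}
    (hz : z ∈ complexOrbit x) (u : L) :
    iwasawaProj θ x (expAd u (iwasawaProj θ x z)) = iwasawaProj θ x (expAd u z) :=
  have hexp := expAd_mem_complexOrbit hz u
  iwasawaProj_eq hθ hx
    (expAd_mem_complexOrbit (compactOrbit_subset (iwasawaProj_mem hθ hx hz)) u)
    (iwasawaProj_mem hθ hx hexp)
    (((sameFiltration_iwasawaProj hθ hx hz).adC_map (isAut_expEquiv u)).trans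
      (sameFiltration_iwasawaProj hθ hx hexp).symm)

theorem hasDerivAt_iwasawaProj_expAd (hθ : IsCompactConjugation θ) (hx : θ x = -x) {y u w : L}
    (hy : y ∈ compactOrbit θ x) (hw : θ w = w)
    (hp : spectralProj (realSpectrum x) (Set.Iio 0) (adC y) (u - w) = 0) :
    HasDerivAt (fun t : ℝ => iwasawaProj θ x (expAd ((t : ℂ) • u) y)) ⁅w, y⁆ 0 := by
  have hyO := compactOrbit_subset hy
  have hyS := splitsOn_of_mem_complexOrbit hθ hx hyO
  set F := fderivWithin ℝ (iwasawaProj θ x) (complexOrbit x) y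
  have hcurve (u : L) :
      HasDerivAt (fun t : ℝ => iwasawaProj θ x (expAd ((t : ℂ) • u) y)) (F ⁅u, y⁆) 0 :=
    ((contDiffWithinAt_iwasawaProj hθ hx hy (n := 1)).differentiableWithinAt one_ne_zero)
      |>.hasFDerivWithinAt.comp_hasDerivAt_of_eq 0 (hasDerivAt_expAd_apply_real u y)
        (Eventually.of_forall fun t => expAd_mem_complexOrbit hyO _) (by simp)
  have hcompact : F ⁅w, y⁆ = ⁅w, y⁆ := by
    refine (hcurve w).unique ((hasDerivAt_expAd_apply_real w y).congr_of_eventuallyEq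
      (Eventually.of_forall fun t => ?_))
    refine iwasawaProj_self hθ hx (apply_mem_compactOrbit (expEquiv_mem ?_) hy)
    change θ ((t : ℂ) • w) = (t : ℂ) • w
    rw [Complex.coe_smul, conj_smul_of_real, hw]
  have hparabolic : F ⁅u - w, y⁆ = 0 := by
    refine (hcurve (u - w)).unique ((hasDerivAt_const (0 : ℝ) y).congr_of_eventuallyEq
      (Eventually.of_forall fun t => ?_))
    refine iwasawaProj_eq hθ hx (expAd_mem_complexOrbit hyO _) hy
      (sameFiltration_expAd hyS ?_).symm
    rw [map_smul, hp, smul_zero]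
  rw [sub_lie, map_sub, hcompact, sub_eq_zero] at hparabolic
  exact hparabolic ▸ hcurve u

namespace SphericalData

theorem hasDerivAt_potential_iwasawaProj_of_compact (D : SphericalData θ σ x) {y : L}
    (hy : y ∈ openOrbit θ σ x) (u : L) :
    HasDerivAt (fun t : ℝ => potential θ σ x (iwasawaProj θ x (expAd ((t : ℂ) • u) y)))
      (2 * (killingForm ℂ L (y - (y + sectionVec θ σ x y)) u).re) 0 := by
  have hyX := D.mem_openOrbit.mp hy
  have hyS := D.splitsOn (compactOrbit_subset hyX.1)
  obtain ⟨w, hw, hp⟩ := exists_realForm_spectralProj_sub_eq_zero D.compact.toIsConjugation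
    D.neg_mem hyS (D.conj_eq_neg hyX.1) u
  have hpot := ((D.contDiffAt_potential hy (n := 1)).differentiableAt one_ne_zero).hasFDerivAt
  have hreal := hpot.comp_hasDerivAt_of_eq 0 (hasDerivAt_expAd_apply_real w y) (by simp)
  have hsec : killingForm ℂ L (sectionVec θ σ x y) (u - w) = 0 :=
    killingForm_eq_zero_of_mem_parabolic hyS (spectralProj_oppVec hyS disjoint_Ioi_zero hyX.2) hp
  rw [map_sub, sub_eq_zero] at hsec
  refine (hpot.comp_hasDerivAt_of_eq 0
    (hasDerivAt_iwasawaProj_expAd D.compact D.base_compact hyX.1 hw hp) ?_).congr_deriv ?_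
  · simp [iwasawaProj_self D.compact D.base_compact hyX.1]
  · rw [hreal.unique (D.hasDerivAt_potential hy hw), sub_add_cancel_left, map_neg,
      LinearMap.neg_apply, LinearMap.neg_apply, hsec]

theorem iwasawaProj_mem_openOrbit (D : SphericalData θ σ x) {z : L} (hz : z ∈ complexOrbit x)
    (h : discr θ σ x z ≠ 0) : iwasawaProj θ x z ∈ openOrbit θ σ x :=
  D.mem_openOrbit.mpr ⟨iwasawaProj_mem D.compact D.base_compact hz,
    (D.discr_iwasawaProj_ne_zero_iff hz).mpr ((D.discr_ne_zero_iff (D.splitsOn hz)).mp h).1⟩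

-- Both sides are the point of the fibre that `tau` maps to its negative, hence the point of the
-- spherical orbit in the fibre through `z`.
theorem sectionVec_iwasawaProj (D : SphericalData θ σ x) {z : L} (hz : z ∈ complexOrbit x)
    (h : discr θ σ x z ≠ 0) :
    iwasawaProj θ x z + sectionVec θ σ x (iwasawaProj θ x z) = z + sectionVec θ σ x z := by
  have hzS := D.splitsOn hz
  have hy := D.iwasawaProj_mem_openOrbit hz h
  have hyS := D.splitsOn (compactOrbit_subset (D.mem_openOrbit.mp hy).1)
  have hnil :=
    (sameFiltration_iwasawaProj D.compact D.base_compact hz).nilradical_eq hyS hzS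
  have hsec := D.add_sectionVec_mem_iwasawaFiber hy
  have hfib := mem_iwasawaFiber_iwasawaProj D.compact D.base_compact hz
  set s := iwasawaProj θ x z + sectionVec θ σ x (iwasawaProj θ x z)
  have hmem : s - z ∈ nilradical z := by
    rw [← hnil, ← sub_sub_sub_cancel_right s z (iwasawaProj θ x z)]
    exact sub_mem hsec hfib
  have hτ := D.tau_of_mem_sphericalOrbit (D.add_sectionVec_mem hy)
  rw [sectionVec, ← eq_oppVec hzS disjoint_Ioi_zero Set.self_notMem_Ioi h
    ((mem_nilradical_iff hzS).mp hmem) (by rwa [add_sub_cancel]), add_sub_cancel]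

theorem hasDerivAt_potential_iwasawaProj (D : SphericalData θ σ x) {z : L}
    (hz : z ∈ complexOrbit x) (h : discr θ σ x z ≠ 0) (u : L) :
    HasDerivAt (fun t : ℝ => potential θ σ x (iwasawaProj θ x (expAd ((t : ℂ) • u) z)))
      (2 * (killingForm ℂ L (iwasawaProj θ x z - (z + sectionVec θ σ x z)) u).re) 0 := by
  have hcompact := D.hasDerivAt_potential_iwasawaProj_of_compact
    (D.iwasawaProj_mem_openOrbit hz h) u
  simpa only [iwasawaProj_expAd_iwasawaProj D.compact D.base_compact hz,
    D.sectionVec_iwasawaProj hz h] using hcompact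

end SphericalData

end OneParameter

/-! ### The equation `i∂∂̄h = ω` -/

section Laplacian

theorem hasDerivAt_add_ofReal_mul (ζ α : ℂ) : HasDerivAt (fun t : ℝ => ζ + (t : ℂ) * α) α 0 :=
  ((Complex.ofRealCLM.hasDerivAt.mul_const α).const_add ζ).congr_deriv (by simp)

variable {C : ℂ → ℂ} {f : ℂ → ℝ}

theorem fderiv_fderiv_of_fderiv_eq_re {α c : ℂ} (hf : ContDiffAt ℝ 2 f 0)
    (hdf : ∀ᶠ ζ in 𝓝 0, ∀ α, fderiv ℝ f ζ α = 2 * (α * C ζ).re)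
    (hC : HasDerivAt (fun t : ℝ => C ((t : ℂ) * α)) c 0) :
    fderiv ℝ (fderiv ℝ f) 0 α α = 2 * (α * c).re := by
  have hline : HasDerivAt (fun t : ℝ => (t : ℂ) * α) α 0 := by
    simpa only [zero_add] using hasDerivAt_add_ofReal_mul 0 α
  have hzero : ((0 : ℝ) : ℂ) * α = 0 := by rw [Complex.ofReal_zero, zero_mul]
  have hdiff : DifferentiableAt ℝ (fderiv ℝ f) 0 :=
    (hf.fderiv_right (m := 1) (by norm_num)).differentiableAt one_ne_zero
  have hleft : HasDerivAt (fun t : ℝ => fderiv ℝ f ((t : ℂ) * α) α)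
      (fderiv ℝ (fderiv ℝ f) 0 α α) 0 :=
    (ContinuousLinearMap.apply ℝ ℝ α).hasFDerivAt.comp_hasDerivAt (0 : ℝ)
      (hdiff.hasFDerivAt.comp_hasDerivAt_of_eq (0 : ℝ) hline hzero.symm)
  have hright : HasDerivAt (fun t : ℝ => 2 * (α * C ((t : ℂ) * α)).re) (2 * (α * c).re) 0 :=
    (Complex.reCLM.hasFDerivAt.comp_hasDerivAt (0 : ℝ) (hC.const_mul α)).const_mul 2
  refine hleft.unique (hright.congr_of_eventuallyEq ?_)
  filter_upwards [(hzero ▸ hline.continuousAt.tendsto).eventually hdf] with t ht using ht α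

theorem laplacian_of_fderiv_eq_re {a b : ℂ} (hf : ContDiffAt ℝ 2 f 0)
    (hdf : ∀ᶠ ζ in 𝓝 0, ∀ α, fderiv ℝ f ζ α = 2 * (α * C ζ).re)
    (ha : HasDerivAt (fun t : ℝ => C ((t : ℂ) * 1)) a 0)
    (hb : HasDerivAt (fun t : ℝ => C ((t : ℂ) * Complex.I)) b 0) :
    Laplacian.laplacian f 0 = 2 * (a + Complex.I * b).re := by
  rw [InnerProductSpace.laplacian_eq_iteratedFDeriv_complexPlane]
  simp only [iteratedFDeriv_two_apply, Matrix.cons_val_zero, Matrix.cons_val_one]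
  rw [fderiv_fderiv_of_fderiv_eq_re hf hdf ha, fderiv_fderiv_of_fderiv_eq_re hf hdf hb, one_mul,
    Complex.add_re, mul_add]

end Laplacian

section KahlerPotential

variable {L : Type*} [NormedLieRing L] [NormedLieAlgebra ℂ L] [FiniteDimensional ℂ L]
  {θ σ : L →ₛₗ[starRingEnd ℂ] L} {x y v : L}

/-- The derivative `∂φ/∂ζ` of the potential `φ(ζ) = h(Π(exp(ζv)y))` along the complex
one-parameter group generated by `v`. -/
def delPotential (θ σ : L →ₛₗ[starRingEnd ℂ] L) (x y v : L) (ζ : ℂ) : ℂ :=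
  killingForm ℂ L (iwasawaProj θ x (expAd (ζ • v) y) -
    (expAd (ζ • v) y + sectionVec θ σ x (expAd (ζ • v) y))) v

namespace SphericalData

theorem contDiffAt_potential_iwasawaProj_expAd (D : SphericalData θ σ x)
    (hy : y ∈ openOrbit θ σ x) (v : L) {n : ℕ∞} :
    ContDiffAt ℝ n (fun ζ : ℂ => potential θ σ x (iwasawaProj θ x (expAd (ζ • v) y))) 0 := by
  have hyX := (D.mem_openOrbit.mp hy).1
  have hproj : ContDiffAt ℝ n (fun ζ : ℂ => iwasawaProj θ x (expAd (ζ • v) y)) 0 :=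
    contDiffWithinAt_univ.mp <| (contDiffWithinAt_iwasawaProj D.compact D.base_compact
      hyX).comp_of_eq (0 : ℂ) ((contDiff_expAd_apply v y).restrict_scalars ℝ).contDiffWithinAt
      (fun ζ _ => expAd_mem_complexOrbit (compactOrbit_subset hyX) _) (by simp)
  have hbase : iwasawaProj θ x (expAd ((0 : ℂ) • v) y) = y := by
    rw [zero_smul, expAd_zero, one_apply_eq_self,
      iwasawaProj_self D.compact D.base_compact hyX]
  exact ContDiffAt.comp (0 : ℂ) (by rw [hbase]; exact D.contDiffAt_potential hy) hproj

theorem fderiv_potential_iwasawaProj_expAd (D : SphericalData θ σ x)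
    (hy : y ∈ openOrbit θ σ x) (v : L) :
    ∀ᶠ ζ in 𝓝 (0 : ℂ), ∀ α, fderiv ℝ (fun ζ : ℂ => potential θ σ x (iwasawaProj θ x
      (expAd (ζ • v) y))) ζ α = 2 * (α * delPotential θ σ x y v ζ).re := by
  have hyX := D.mem_openOrbit.mp hy
  have hdiff := ((D.contDiffAt_potential_iwasawaProj_expAd hy v (n := 1)).eventually
    (by simp)).mono fun ζ h => h.differentiableAt one_ne_zero
  have hcurve : Tendsto (fun ζ : ℂ => expAd (ζ • v) y) (𝓝 0) (𝓝 y) := by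
    simpa using (contDiff_expAd_apply v y (n := 0)).continuous.tendsto 0
  filter_upwards [hdiff, hcurve.eventually (isOpen_discr_ne_zero.eventually_mem hyX.2)]
    with ζ hζ hne α
  have hpot := D.hasDerivAt_potential_iwasawaProj
    (expAd_mem_complexOrbit (compactOrbit_subset hyX.1) (ζ • v)) hne (α • v)
  rw [map_smul, smul_eq_mul] at hpot
  refine (hζ.hasFDerivAt.comp_hasDerivAt_of_eq (0 : ℝ) (hasDerivAt_add_ofReal_mul ζ α)
    (by simp)).unique (hpot.congr_of_eventuallyEq (Eventually.of_forall fun t => ?_))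
  simp only [Function.comp_apply, add_comm ζ, expAd_add_smul, clm_mul_apply, smul_smul]

theorem exists_hasDerivAt_delPotential (D : SphericalData θ σ x) (hy : y ∈ openOrbit θ σ x)
    (v : L) : ∃ d : ℂ, ∀ {α : ℂ} {w : L}, θ w = w →
      spectralProj (realSpectrum x) (Set.Iio 0) (adC y) (α • v - w) = 0 →
      HasDerivAt (fun t : ℝ => delPotential θ σ x y v ((t : ℂ) * α))
        (killingForm ℂ L ⁅w, y⁆ v - α * d) 0 := by
  have hyX := D.mem_openOrbit.mp hy
  have hcurve : DifferentiableAt ℂ (fun ζ : ℂ => expAd (ζ • v) y) 0 :=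
    (hasDerivAt_expAd_apply v y 0).differentiableAt
  have hsec : DifferentiableAt ℂ (fun ζ : ℂ => sectionVec θ σ x (expAd (ζ • v) y)) 0 :=
    DifferentiableAt.comp (0 : ℂ) (by
      rw [zero_smul, expAd_zero, one_apply_eq_self]
      exact (contDiffAt_oppVec hyX.2 (n := 1)).differentiableAt one_ne_zero) hcurve
  obtain ⟨d, hd⟩ : ∃ d, HasDerivAt
      (fun ζ : ℂ => expAd (ζ • v) y + sectionVec θ σ x (expAd (ζ • v) y)) d 0 :=
    ⟨_, (hcurve.add hsec).hasDerivAt⟩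
  refine ⟨killingForm ℂ L d v, fun {α w} hw hp => ?_⟩
  have hproj := hasDerivAt_iwasawaProj_expAd D.compact D.base_compact hyX.1 hw hp
  simp only [smul_smul] at hproj
  have hline : HasDerivAt (fun t : ℝ => (t : ℂ) * α) α 0 := by
    simpa only [zero_add] using hasDerivAt_add_ofReal_mul 0 α
  refine ((((killingCLM L).flip v).restrictScalars ℝ).hasFDerivAt.comp_hasDerivAt (0 : ℝ)
    (hproj.sub (hd.scomp_of_eq (0 : ℝ) hline (by simp)))).congr_deriv ?_
  simp

-- `∂φ/∂ζ` is the pairing with `v` of the difference of the projection `Π` and of a holomorphic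
-- function of `ζ`; the antiholomorphic derivative only sees `Π`, which maps `i[v,y]` to `J[v,y]`.
theorem laplacian_potential (D : SphericalData θ σ x) {v' : L} (hy : y ∈ openOrbit θ σ x)
    (hv : θ v = v) (hv' : θ v' = v') (hJ : IsJ y v v') :
    (1 / 2) * Laplacian.laplacian
      (fun ζ : ℂ => potential θ σ x (iwasawaProj θ x (expAd (ζ • v) y))) 0 = kks y v v' := by
  obtain ⟨d, hd⟩ := D.exists_hasDerivAt_delPotential hy v
  rw [laplacian_of_fderiv_eq_re (D.contDiffAt_potential_iwasawaProj_expAd hy v (n := 2))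
    (D.fderiv_potential_iwasawaProj_expAd hy v) (hd hv (by rw [one_smul, sub_self, map_zero]))
    (hd hv' (hJ.spectralProj_eq_zero
      (D.splitsOn (compactOrbit_subset (D.mem_openOrbit.mp hy).1))))]
  have hreal : killingForm ℂ L ⁅v, y⁆ v = 0 := by
    rw [killingForm_lie_left, lie_self, map_zero, neg_zero]
  have himag : killingForm ℂ L ⁅v', y⁆ v = killingForm ℂ L y ⁅v, v'⁆ := by
    rw [killingForm_lie_left, ← lie_skew, map_neg, neg_neg]
  have hsum : killingForm ℂ L ⁅v, y⁆ v - 1 * d + Complex.I *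
      (killingForm ℂ L ⁅v', y⁆ v - Complex.I * d) =
      Complex.I * killingForm ℂ L y ⁅v, v'⁆ := by
    rw [hreal, himag, mul_sub, ← mul_assoc, Complex.I_mul_I]
    ring
  rw [hsum, Complex.I_mul_re, kks]
  ring

theorem isKahlerPotential (D : SphericalData θ σ x) :
    IsKahlerPotential θ σ x (potential θ σ x) where
  normalized := potential_base
  primitive y hy := ⟨y + sectionVec θ σ x y, D.add_sectionVec_mem hy,
    D.add_sectionVec_mem_iwasawaFiber hy, fun _ hv => D.hasDerivAt_potential hy hv⟩
  potential _ hy v _ hv hv' hJ :=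
    ⟨D.contDiffAt_potential_iwasawaProj_expAd hy v, D.laplacian_potential hy hv hv' hJ⟩

/-! ### The gradient field -/

theorem exists_lie_eq_neg_gradField (D : SphericalData θ σ x) (hy : y ∈ openOrbit θ σ x) :
    ∃ u, θ u = u ∧ -gradField θ σ x y = ⁅u, y⁆ := by
  obtain ⟨hyX, hne⟩ := D.mem_openOrbit.mp hy
  have hyS := D.splitsOn (compactOrbit_subset hyX)
  have hθ := D.compact.toIsConjugation
  set n := sectionVec θ σ x y with hn
  obtain ⟨m, -, hm⟩ :=
    exists_lie_eq_spectralProj hyS Set.self_notMem_Ioi (-(1 / 2 : ℂ) • n)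
  rw [map_smul, hn, sectionVec, spectralProj_oppVec hyS disjoint_Ioi_zero hne, ← sectionVec,
    ← hn] at hm
  have hconj : ⁅θ m, y⁆ = (1 / 2 : ℂ) • θ n := by
    rw [← neg_neg y, ← D.conj_eq_neg hyX, lie_neg, ← hθ.map_lie, hm, LinearMap.map_smulₛₗ]
    simp [Complex.conj_ofNat]
  refine ⟨m + θ m, by rw [map_add, hθ.involutive, add_comm], ?_⟩
  rw [add_lie, hm, hconj, gradField, D.oppVec_neg_Ioi hy, ← hn]
  module

theorem isHalfGradient (D : SphericalData θ σ x) :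
    IsHalfGradient θ σ x (potential θ σ x) (fun y => -gradField θ σ x y) := by
  intro y hy
  obtain ⟨hyX, hne⟩ := D.mem_openOrbit.mp hy
  have hyS := D.splitsOn (compactOrbit_subset hyX)
  obtain ⟨u, hu, hfield⟩ := D.exists_lie_eq_neg_gradField hy
  refine ⟨u, hu, hfield, fun v v' hv hv' hJ => (D.hasDerivAt_potential hy hv).congr_deriv ?_⟩
  set n := sectionVec θ σ x y with hn
  have hnil : killingForm ℂ L n v' = Complex.I * killingForm ℂ L n v := by
    have h := killingForm_eq_zero_of_mem_parabolic hyS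
      (spectralProj_oppVec hyS disjoint_Ioi_zero hne) (hJ.spectralProj_eq_zero hyS)
    rw [map_sub, map_smul, smul_eq_mul, sub_eq_zero] at h
    exact h.symm
  have hconj : killingForm ℂ L (θ n) v' = conj (killingForm ℂ L n v') := by
    rw [← D.compact.killingForm_conj, hv']
  have hlie : killingForm ℂ L y ⁅u, v'⁆ =
      (1 / 2 : ℂ) * (killingForm ℂ L n v' - conj (killingForm ℂ L n v')) := by
    rw [← neg_neg (killingForm ℂ L y _), ← killingForm_lie_left, ← hfield, gradField,
      D.oppVec_neg_Ioi hy, ← hn, ← hconj, map_neg, LinearMap.neg_apply, neg_neg, map_smul,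
      LinearMap.smul_apply, smul_eq_mul, ← sub_eq_add_neg, map_sub, LinearMap.sub_apply]
  have him : ∀ c : ℂ, ((1 / 2 : ℂ) * (Complex.I * c - conj (Complex.I * c))).im = c.re :=
    fun c => by
      rw [Complex.sub_conj, ← mul_assoc]
      simp
  rw [sub_add_cancel_left, map_neg, LinearMap.neg_apply, Complex.neg_re, kks, hlie, hnil, him]

theorem isComplexification (D : SphericalData θ σ x) :
    IsComplexification (fun y => - -gradField θ σ x y) (openOrbit θ σ x) (domainB θ σ x)
      (gradField θ σ x) where
  subset := D.openOrbit_subset_domainB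
  tangent _ hz := D.gradField_tangent hz
  holomorphic := D.differentiableOn_gradField
  restrict _ _ := (neg_neg _).symm

end SphericalData

end KahlerPotential

end HyperbolicOrbit

end

open HyperbolicOrbit in
theorem mainTheorem3 {L : Type*} [NormedLieRing L] [NormedLieAlgebra ℂ L] [FiniteDimensional ℂ L]
    (θ σ : L →ₛₗ[starRingEnd ℂ] L) (hθ : IsCompactConjugation θ) (hσ : IsConjugation σ)
    (hcomm : ∀ u, θ (σ u) = σ (θ u)) (x : L) (hxθ : θ x = -x) (hxσ : σ x = x) :
    IsOpenIn (complexOrbit x) (domainB θ σ x) ∧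
    IsZariskiOpenIn (complexOrbit x) (domainB θ σ x) ∧
    IsConnected (domainB θ σ x) ∧
    (∀ k ∈ sphericalGroup θ σ, ∀ z ∈ domainB θ σ x, k z ∈ domainB θ σ x) ∧
    ∃ (h : L → ℝ) (Y Λ : L → L),
      IsKahlerPotential θ σ x h ∧
      IsHalfGradient θ σ x h Y ∧
      IsComplexification (fun y => -Y y) (openOrbit θ σ x) (domainB θ σ x) Λ ∧
      (∀ Λ', IsComplexification (fun y => -Y y) (openOrbit θ σ x) (domainB θ σ x) Λ' →
        Set.EqOn Λ' Λ (domainB θ σ x)) ∧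
      ∀ k ∈ sphericalGroup θ σ, ∀ z ∈ domainB θ σ x, Λ (k z) = k (Λ z) := by
  have D : SphericalData θ σ x := ⟨hθ, hσ, hcomm, hxθ, hxσ⟩
  refine ⟨D.isOpenIn_domainB, D.isZariskiOpenIn_domainB, D.isConnected_domainB,
    fun k hk z hz => D.apply_mem_domainB hk hz, potential θ σ x, fun y => -gradField θ σ x y,
    gradField θ σ x, D.isKahlerPotential, D.isHalfGradient, D.isComplexification,
    fun Λ' hΛ' => D.eqOn_domainB hΛ'.holomorphic D.differentiableOn_gradField fun y hy => ?_,
    fun k hk z hz => D.gradField_map hk hz⟩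
  rw [hΛ'.restrict y hy, neg_neg]
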